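/- Lemma 2.1. Let $L=1$ and let $s\ge -1$ be real. For real $r$ let $H^r_0(\mathbb R^+)$ be the space of real tempered distributions in $H^r(\mathbb R)$ that are supported in $[0,\infty)$. Let $$h_1\in H_0^{(s+1)/3}(\mathbb R^+),\qquad h_2\in H_0^{s/3}(\mathbb R^+),\qquad h_3\in H_0^{(s-1)/3}(\mathbb R^+),$$ and consider the problem $$v_t+v_x+v_{xxx}=0,\quad v(x,0)=0,\quad v(0,t)=h_1(t),\ v_x(1,t)=h_2(t),\ v_{xx}(1,t)=h_3(t)\qquad(0<x<1,\ t>0).\tag{1}$$ A (weak) solution of (1) is a real function $v$ that lies in $L^2((0,1)\times(0,T))$ for every $T>0$ and satisfies $$\int_0^\infty\!\!\int_0^1 v\,(\varphi_t+\varphi_x+\varphi_{xxx})\,dx\,dt+\langle h_1,\varphi_{xx}(0,\cdot)\rangle+\langle h_2,\varphi_x(1,\cdot)\rangle-\langle h_3,\varphi(1,\cdot)\rangle=0$$ for all $\varphi\in C_c^\infty(\mathbb R^2)$ with $\varphi(0,t)=\varphi_x(0,t)=0$ and $\varphi(1,t)+\varphi_{xx}(1,t)=0$ for all $t$. For $\rho>1$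 let $$\lambda_1^+=i\rho,\qquad \lambda_2^+=\frac{\sqrt{3\rho^2-4}-i\rho}{2},\qquad \lambda_3^+=\frac{-\sqrt{3\rho^2-4}-i\rho}{2}$$ (principal complex square root) be the roots of $\sigma+\lambda+\lambda^3=0$ at $\sigma=i(\rho^3-\rho)$. Let $\Delta^+(\rho)$ be the determinant of the matrix with rows $(1)_j$, $(\lambda_j^+e^{\lambda_j^+})_j$, $((\lambda_j^+)^2e^{\lambda_j^+})_j$, and let $\Delta^+_{j,m}(\rho)$ be the determinant obtained when its $j$-th column is replaced by the $m$-th unit vector. Let $\hat h^+(\rho)=\hat h(i(\rho^3-\rho))$, where $\hat h(\sigma)=\int_0^\infty e^{-\sigma t}h(t)\,dt$ is the Laplace transform (on the imaginary axis it is the Fourier transform of $h$, a locally integrable function). Put $$[U_{j,m}h](x,t)=\frac1{2\pi}\int_1^\infty e^{i(\rho^3-\rho)t}e^{-\lambda_j^+(\rho)(1-x)}(3\rho^2-1)\,\frac{\Delta_{j,m}^+(\rho)}{\Delta^+(\rho)}e^{\lambda_j^+(\rho)}\hat h^+(\rho)\,d\rho\quad(j=1,2),$$ $$[U_{3,m}h](x,t)=\frac1{2\pi}\int_1^\infty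 e^{i(\rho^3-\rho)t}e^{\lambda_3^+(\rho)x}(3\rho^2-1)\,\frac{\Delta_{3,m}^+(\rho)}{\Delta^+(\rho)}\hat h^+(\rho)\,d\rho,$$ $$W_{j,m}h=U_{j,m}h+\overline{U_{j,m}h},\qquad W_{bdr}\vec h=\sum_{j,m=1}^3W_{j,m}h_m .$$ Then (1) has a solution, and every solution $v$ of (1) is given by $v=W_{bdr}\vec h$ in the following sense. If in all nine integrals the range of integration is replaced by $\{1<\rho<R,\ |\rho-2/\sqrt3|>\varepsilon\}$, then the resulting sum converges to $v$ in $L^2((0,1)\times(0,T))$ as $R\to\infty$, $\varepsilon\downarrow0$, for every $T>0$. Moreover, for almost every $(x,t)\in(0,1)\times(0,\infty)$ at which the nine integrals over $(1,\infty)$ converge absolutely, $v(x,t)=[W_{bdr}\vec h](x,t)$ literally. In particular the solution is unique up to null sets. -/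

import Mathlib

open MeasureTheory Filter Topology Set
open scoped SchwartzMap ContDiff ENNReal FourierTransform

noncomputable section

namespace KdVBdr

/-! ### Boundary data -/

/-- The space `H₀^r(ℝ⁺)` of real boundary data: real tempered distributions on the line which lie in
the Sobolev space `H^r(ℝ)` and are supported in `[0, ∞)`. The order `r` may be negative. -/
structure MemHZero (r : ℝ) (h : 𝓢'(ℝ, ℂ)) : Prop where
  sobolev : TemperedDistribution.MemSobolev r 2 h
  supported : Distribution.IsVanishingOn h (Iio (0 : ℝ))
  real : ∀ φ : 𝓢(ℝ, ℂ), (∀ t, (φ t).im = 0) → (h φ).im = 0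

/-- `g τ = ĥ(iτ)` for almost every real `τ`, where `ĥ(s) = ∫₀^∞ e^{-st} h(t) dt` is the Laplace
transform of the distribution `h` supported in `[0, ∞)`. On the imaginary axis this is the Fourier
transform of `h`; in Mathlib's normalisation `(𝓕 h)(ξ) = ĥ(2πiξ)`. -/
def IsLaplaceOnAxis (h : 𝓢'(ℝ, ℂ)) (g : ℝ → ℂ) : Prop :=
  LocallyIntegrable g ∧
    ∀ φ : 𝓢(ℝ, ℂ), Integrable (fun ξ : ℝ => φ ξ * g (2 * Real.pi * ξ)) ∧
      (𝓕 h) φ = ∫ ξ : ℝ, φ ξ * g (2 * Real.pi * ξ)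

/-- Every distribution in a Sobolev space has a Laplace transform on the imaginary axis. -/
theorem exists_isLaplaceOnAxis {r : ℝ} {h : 𝓢'(ℝ, ℂ)}
    (hh : TemperedDistribution.MemSobolev r 2 h) : ∃ g, IsLaplaceOnAxis h g := by
  obtain ⟨f', hf⟩ := TemperedDistribution.memSobolev_iff_exists_smulLeftCLM_fourier.mp hh
  have hπ : (2 * Real.pi : ℝ) ≠ 0 := by positivity
  have hw : (fun x : ℝ => (((1 + ‖x‖ ^ 2) ^ (r / 2) : ℝ) : ℂ)).HasTemperateGrowth := by fun_prop
  have hw' : (fun x : ℝ => (((1 + ‖x‖ ^ 2) ^ (-r / 2) : ℝ) : ℂ)).HasTemperateGrowth := by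
    fun_prop
  have hwc : Continuous (fun x : ℝ => (((1 + ‖x‖ ^ 2) ^ (-r / 2) : ℝ) : ℂ)) := hw'.1.continuous
  have hmul : ∀ x : ℝ, (((1 + ‖x‖ ^ 2) ^ (r / 2) : ℝ) : ℂ) *
      (((1 + ‖x‖ ^ 2) ^ (-r / 2) : ℝ) : ℂ) = 1 := by
    intro x
    rw [← Complex.ofReal_mul, ← Real.rpow_add (by positivity)]
    ring_nf
    simp
  let G : ℝ → ℂ := fun x => (((1 + ‖x‖ ^ 2) ^ (-r / 2) : ℝ) : ℂ) * f' x
  have hG : LocallyIntegrable G := by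
    exact LocallyIntegrable.continuous_mul hwc ((Lp.memLp f').locallyIntegrable (by norm_num))
  have key : ∀ ξ : ℝ, G ((2 * Real.pi)⁻¹ * (2 * Real.pi * ξ)) = G ξ := by
    intro ξ
    rw [inv_mul_cancel_left₀ hπ]
  refine ⟨fun τ => G ((2 * Real.pi)⁻¹ * τ), ?_, ?_⟩
  · rw [locallyIntegrable_iff]
    intro k hk
    have hk' : IsCompact ((fun τ : ℝ => (2 * Real.pi)⁻¹ * τ) '' k) :=
      hk.image (by fun_prop)
    have h1 := (hG.integrableOn_isCompact hk').integrable_indicator hk'.measurableSet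
    have h2 := h1.comp_mul_left' (R := (2 * Real.pi)⁻¹) (inv_ne_zero hπ)
    rw [← integrable_indicator_iff hk.measurableSet]
    refine h2.congr (Eventually.of_forall fun τ => ?_)
    have hinj : Function.Injective (fun τ : ℝ => (2 * Real.pi)⁻¹ * τ) :=
      mul_right_injective₀ (inv_ne_zero hπ)
    by_cases hτ : τ ∈ k
    · have : (2 * Real.pi)⁻¹ * τ ∈ (fun τ : ℝ => (2 * Real.pi)⁻¹ * τ) '' k := ⟨τ, hτ, rfl⟩
      simp only [Set.indicator_of_mem this, Set.indicator_of_mem hτ]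
    · have : (2 * Real.pi)⁻¹ * τ ∉ (fun τ : ℝ => (2 * Real.pi)⁻¹ * τ) '' k := by
        rintro ⟨y, hy, hyy⟩
        exact hτ (hinj hyy ▸ hy)
      simp only [Set.indicator_of_notMem this, Set.indicator_of_notMem hτ]
  · intro φ
    simp only [key]
    let ψ : 𝓢(ℝ, ℂ) := SchwartzMap.smulLeftCLM ℂ
      (fun x : ℝ => (((1 + ‖x‖ ^ 2) ^ (-r / 2) : ℝ) : ℂ)) φ
    have hψ : ∀ x, ψ x = (((1 + ‖x‖ ^ 2) ^ (-r / 2) : ℝ) : ℂ) * φ x := by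
      intro x
      simp only [ψ]
      rw [SchwartzMap.smulLeftCLM_apply_apply hw', smul_eq_mul]
    have e : ∀ x, φ x * G x = ψ x • f' x := by
      intro x
      rw [hψ, smul_eq_mul]
      simp only [G]
      ring
    simp only [e]
    refine ⟨?_, ?_⟩
    · exact MemLp.integrable_mul (p := 2) (q := 2) (ψ.memLp 2 volume) (Lp.memLp f')
    · rw [← Lp.toTemperedDistribution_apply, ← hf, TemperedDistribution.smulLeftCLM_apply_apply]
      congr 1
      ext x
      rw [SchwartzMap.smulLeftCLM_apply_apply hw, hψ, smul_eq_mul, ← mul_assoc, hmul, one_mul]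

/-- For an integrable function `f` on `[0, ∞)` it is the integral `ĥ(iτ) = ∫₀^∞ e^{-iτt} f(t) dt`. -/
theorem isLaplaceOnAxis_of_integrable {h : 𝓢'(ℝ, ℂ)} {f : ℝ → ℂ} (hf : Integrable f)
    (hsupp : ∀ t < 0, f t = 0) (hh : ∀ φ : 𝓢(ℝ, ℂ), h φ = ∫ t, φ t * f t) :
    IsLaplaceOnAxis h (fun τ => ∫ t in Ioi (0 : ℝ), Complex.exp (-(Complex.I * τ) * t) * f t) := by
  have e : ∀ ξ : ℝ, (∫ t in Ioi (0 : ℝ),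
      Complex.exp (-(Complex.I * ((2 * Real.pi * ξ : ℝ) : ℂ)) * t) * f t) = 𝓕 f ξ := by
    intro ξ
    rw [Real.fourier_eq', ← integral_Ici_eq_integral_Ioi,
      setIntegral_eq_integral_of_forall_compl_eq_zero]
    · congr 1
      ext t
      rw [smul_eq_mul]
      congr 2
      simp
      ring
    · intro t ht
      rw [hsupp t (by simpa using ht), mul_zero]
  have hc : Continuous (𝓕 f) := by
    exact VectorFourier.fourierIntegral_continuous Real.continuous_fourierChar (by fun_prop) hf
  have e2 : (fun τ : ℝ => ∫ t in Ioi (0 : ℝ), Complex.exp (-(Complex.I * τ) * t) * f t) =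
      fun τ => 𝓕 f ((2 * Real.pi)⁻¹ * τ) := by
    ext τ
    rw [← e, mul_inv_cancel_left₀ (by positivity)]
  refine ⟨?_, fun φ => ⟨?_, ?_⟩⟩
  · rw [e2]
    exact (hc.comp (by fun_prop)).locallyIntegrable
  · simp only [e]
    refine (φ.integrable (μ := volume)).mul_bdd (c := ∫ t, ‖f t‖) hc.aestronglyMeasurable ?_
    exact Eventually.of_forall fun ξ => VectorFourier.norm_fourierIntegral_le_integral_norm _ _ _ _ _
  · simp only [e]
    rw [TemperedDistribution.fourier_apply, hh]
    have := VectorFourier.integral_fourierIntegral_smul_eq_flip (𝕜 := ℝ) (V := ℝ) (W := ℝ)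
      (e := Real.fourierChar) (μ := volume) (ν := volume) (L := innerₗ ℝ)
      (f := (φ : ℝ → ℂ)) (g := f) Real.continuous_fourierChar (by fun_prop) φ.integrable hf
    simpa [SchwartzMap.fourier_coe, Real.fourier_eq, VectorFourier.fourierIntegral,
      mul_comm] using this

open Classical in
/-- The function `τ ↦ ĥ(iτ)`; it is determined up to a null set, and it exists for every `h` that
lies in some Sobolev space (`exists_isLaplaceOnAxis`). -/
def laplaceOnAxis (h : 𝓢'(ℝ, ℂ)) : ℝ → ℂ :=
  if hh : ∃ g, IsLaplaceOnAxis h g then hh.choose else 0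

open Classical in
/-- The value `⟨h, f⟩` of the distribution `h` at a function `f ∈ C_c^∞(ℝ)`. -/
def pair (h : 𝓢'(ℝ, ℂ)) (f : ℝ → ℂ) : ℂ :=
  if hf : HasCompactSupport f ∧ ContDiff ℝ ∞ f then h (hf.1.toSchwartzMap hf.2) else 0

/-! ### The boundary value problem -/

/-- `k`-th partial derivative in the first variable `x` of a function of `(x, t)`. -/
def dx (k : ℕ) (φ : ℝ × ℝ → ℝ) (p : ℝ × ℝ) : ℝ := iteratedDeriv k (fun y => φ (y, p.2)) p.1

/-- Partial derivative in the second variable `t` of a function of `(x, t)`. -/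
def dt (φ : ℝ × ℝ → ℝ) (p : ℝ × ℝ) : ℝ := deriv (fun r => φ (p.1, r)) p.2

/-- Test functions: smooth compactly supported functions of `(x, t)` that satisfy the adjoint
boundary conditions `φ(0,t) = φ_x(0,t) = 0`, `φ(1,t) + φ_xx(1,t) = 0`. There is no condition at
`t = 0`. -/
structure IsTest (φ : ℝ × ℝ → ℝ) : Prop where
  smooth : ContDiff ℝ ∞ φ
  compact : HasCompactSupport φ
  left : ∀ t, φ (0, t) = 0
  left_deriv : ∀ t, dx 1 φ (0, t) = 0
  right : ∀ t, φ (1, t) + dx 2 φ (1, t) = 0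

/-- `v` is a (weak) solution on `0 < x < 1`, `t > 0` of
`v_t + v_x + v_xxx = 0`, `v(x,0) = 0`, `v(0,t) = h₁(t)`, `v_x(1,t) = h₂(t)`, `v_xx(1,t) = h₃(t)`
(with `h₁, h₂, h₃ = h 0, h 1, h 2`). The identity is obtained by multiplying the equation by a test
function and integrating by parts: the initial and the boundary values enter through it, and
the unknown traces `v(1,·)`, `v_x(0,·)`, `v_xx(0,·)` are multiplied by zero. -/
structure IsSolution (h : Fin 3 → 𝓢'(ℝ, ℂ)) (v : ℝ × ℝ → ℝ) : Prop where
  memLp : ∀ T : ℝ, 0 < T → MemLp v 2 (volume.restrict (Ioo (0 : ℝ) 1 ×ˢ Ioo (0 : ℝ) T))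
  identity : ∀ φ, IsTest φ →
    ((∫ p in Ioo (0 : ℝ) 1 ×ˢ Ioi (0 : ℝ), v p * (dt φ p + dx 1 φ p + dx 3 φ p) : ℝ) : ℂ)
      + pair (h 0) (fun t => (dx 2 φ (0, t) : ℂ))
      + pair (h 1) (fun t => (dx 1 φ (1, t) : ℂ))
      - pair (h 2) (fun t => (φ (1, t) : ℂ)) = 0

/-! ### The explicit formula -/

/-- The roots `λ_j⁺(ρ)` of `s + λ + λ³ = 0` at `s = i(ρ³ - ρ)`; the square root is the principal
complex one. -/
def lam (j : Fin 3) (ρ : ℝ) : ℂ :=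
  ![Complex.I * ρ,
    ((((3 * ρ ^ 2 - 4 : ℝ) : ℂ)) ^ (1 / 2 : ℂ) - Complex.I * ρ) / 2,
    (-(((3 * ρ ^ 2 - 4 : ℝ) : ℂ)) ^ (1 / 2 : ℂ) - Complex.I * ρ) / 2] j

/-- The matrix `A` of the linear system for the coefficients of `e^{λ_j x}`. -/
def coeffMatrix (ρ : ℝ) : Matrix (Fin 3) (Fin 3) ℂ :=
  Matrix.of ![fun _ => 1,
    fun j => lam j ρ * Complex.exp (lam j ρ),
    fun j => lam j ρ ^ 2 * Complex.exp (lam j ρ)]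

/-- `Δ⁺(ρ)`. -/
def Delta (ρ : ℝ) : ℂ := (coeffMatrix ρ).det

/-- `Δ⁺_{j,m}(ρ)`: column `j` of the matrix is replaced by the `m`-th unit vector. -/
def DeltaMinor (j m : Fin 3) (ρ : ℝ) : ℂ :=
  ((coeffMatrix ρ).updateCol j (Pi.single m 1)).det

/-- `[Q⁺_{j,m} h](ρ)`. -/
def Q (j m : Fin 3) (h : 𝓢'(ℝ, ℂ)) (ρ : ℝ) : ℂ :=
  if j = 2 then DeltaMinor j m ρ / Delta ρ * laplaceOnAxis h (ρ ^ 3 - ρ)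
  else DeltaMinor j m ρ / Delta ρ * Complex.exp (lam j ρ) * laplaceOnAxis h (ρ ^ 3 - ρ)

/-- The integrand of `[U_{j,m} h](x,t)`, `p = (x, t)`. -/
def integrand (j m : Fin 3) (h : 𝓢'(ℝ, ℂ)) (p : ℝ × ℝ) (ρ : ℝ) : ℂ :=
  Complex.exp (Complex.I * ((ρ ^ 3 - ρ : ℝ) : ℂ) * (p.2 : ℂ)) *
    (if j = 2 then Complex.exp (lam j ρ * (p.1 : ℂ))
      else Complex.exp (-lam j ρ * ((1 - p.1 : ℝ) : ℂ))) *
    ((3 * ρ ^ 2 - 1 : ℝ) : ℂ) * Q j m h ρ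

/-- The part of `[U_{j,m} h](x,t)` over `ρ ∈ S`. -/
def U (S : Set ℝ) (j m : Fin 3) (h : 𝓢'(ℝ, ℂ)) (p : ℝ × ℝ) : ℂ :=
  1 / (2 * (Real.pi : ℂ)) * ∫ ρ in S, integrand j m h p ρ

/-- The part of `[W_{j,m} h](x,t)` over `ρ ∈ S`. -/
def W (S : Set ℝ) (j m : Fin 3) (h : 𝓢'(ℝ, ℂ)) (p : ℝ × ℝ) : ℂ :=
  U S j m h p + (starRingEnd ℂ) (U S j m h p)

/-- `[W_bdr h](x,t) = ∑_{j,m} [W_{j,m} h_m](x,t)`, the integrals being taken over `ρ ∈ S`. The full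
operator has `S = (1, ∞)`. -/
def Wbdr (S : Set ℝ) (h : Fin 3 → 𝓢'(ℝ, ℂ)) (p : ℝ × ℝ) : ℂ :=
  ∑ j : Fin 3, ∑ m : Fin 3, W S j m (h m) p

/-- The truncated range of integration: `1 < ρ < R` and `|ρ - 2/√3| > ε`. At `ρ = 2/√3` the roots
`λ₂⁺` and `λ₃⁺` coincide and `Δ⁺` vanishes. -/
def cutRange (R ε : ℝ) : Set ℝ := {ρ | 1 < ρ ∧ ρ < R ∧ ε < |ρ - 2 / √3|}

end KdVBdr

end

/-! The formula is the inverse Laplace transform of the solution along the imaginary axis `σ = i(ρ³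
- ρ)`. At each frequency the amplitude in `x` is a combination of the exponentials `e^{λ_j x}`,
whose coefficients are fixed by the three boundary values through Cramer's rule. The data are real,
so the negative frequencies are the conjugates of the positive ones, which `ρ > 1` parametrises.

The main tool is an energy identity with the multiplier `1 + x`. With a Poincaré inequality it gives
resolvent bounds for `Re σ > -1/2`, both for the spatial operator (`direct_estimate`) and for its
adjoint (`adjoint_estimate`). Hence `Δ⁺` does not vanish away from `ρ = 2/√3` (`Delta_ne_zero`), and
the sum over `j` of the kernels stays bounded in `L²(0,1)` near that point although the single terms
need not.

Convergence. For large `ρ` the kernel of `h_{m+1}`, `m = 0, 1, 2`, is of size `ρ^{-m}`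
(`exists_integral_ker_le`). Plancherel's theorem in `t` bounds a truncated wave by a weighted `L²`
norm of the transformed data (`exists_sq_eLpNorm_wave_le`). Frequency is of order `ρ³`, so the
weight `ρ^{-2m}` asks for Sobolev order `-m/3`, and `s ≥ -1` supplies it. The truncations are
therefore Cauchy in `L²((0,1) × ℝ)`. Each truncated wave satisfies the weak identity with truncated
data, and the identity passes to the limit.

Uniqueness (`ae_eq_zero_of_homogeneous`). Let `v` be a homogeneous solution on `(0,1) × (-∞,T)`.
Pairing it with `y(x)θ(s - t)` gives functionals that are bounded for `t ≤ 0` and satisfy `w(y)' =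
w(A y)`, with `A` the adjoint operator. The Laplace transform of such an orbit over `(-∞,0]` is
holomorphic for `Re μ < 0` and is continued by the resolvent of `A` to the rest of the plane. The
continuation is bounded, entire and tends to zero along the positive integers, so it vanishes by
Liouville's theorem.

Uniqueness is used twice. It identifies any solution with the constructed one, and it shows that the
constructed limit vanishes for `t < 0`, because the data are supported in `[0,∞)`. The second use is
what yields the zero initial value. -/

noncomputable section

namespace KdVBdr

local notation "⟪" x ", " y "⟫" => inner ℝ x y

/-! ### Energy identity and resolvent estimates on the unit interval. -/

/-- A triple of successive derivatives of a complex-valued function of one real variable. -/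
structure DerivChain (y y₁ y₂ y₃ : ℝ → ℂ) : Prop where
  one : ∀ x, HasDerivAt y (y₁ x) x
  two : ∀ x, HasDerivAt y₁ (y₂ x) x
  three : ∀ x, HasDerivAt y₂ (y₃ x) x
  cont : Continuous y₃

namespace DerivChain

variable {y y₁ y₂ y₃ : ℝ → ℂ}

lemma cont₀ (h : DerivChain y y₁ y₂ y₃) : Continuous y :=
  continuous_iff_continuousAt.2 fun x => (h.one x).continuousAt

lemma cont₁ (h : DerivChain y y₁ y₂ y₃) : Continuous y₁ :=
  continuous_iff_continuousAt.2 fun x => (h.two x).continuousAt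

lemma cont₂ (h : DerivChain y y₁ y₂ y₃) : Continuous y₂ :=
  continuous_iff_continuousAt.2 fun x => (h.three x).continuousAt

/-- Reflection `x ↦ 1 - x`. -/
lemma reflect (h : DerivChain y y₁ y₂ y₃) :
    DerivChain (fun x => y (1 - x)) (fun x => -y₁ (1 - x)) (fun x => y₂ (1 - x))
      (fun x => -y₃ (1 - x)) where
  one x := by simpa using (h.one (1 - x)).comp_const_sub 1 x
  two x := ((h.two (1 - x)).comp_const_sub 1 x).neg.congr_deriv (neg_neg _)
  three x := by simpa using (h.three (1 - x)).comp_const_sub 1 x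
  cont := (h.cont.comp (by fun_prop)).neg

end DerivChain

/-- The variance of `a` over an interval of length one is nonnegative. -/
lemma sq_integral_le_integral_sq {a : ℝ → ℝ} (ha : Continuous a) :
    (∫ x in (0 : ℝ)..1, a x) ^ 2 ≤ ∫ x in (0 : ℝ)..1, a x ^ 2 := by
  set m := ∫ x in (0 : ℝ)..1, a x with hm
  have h0 : 0 ≤ ∫ x in (0 : ℝ)..1, (a x - m) ^ 2 :=
    intervalIntegral.integral_nonneg (by norm_num) fun x _ => sq_nonneg _
  have h1 : (∫ x in (0 : ℝ)..1, (a x - m) ^ 2) =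
      (∫ x in (0 : ℝ)..1, a x ^ 2) - 2 * m * m + m ^ 2 := by
    have : ∀ x, (a x - m) ^ 2 = a x ^ 2 - 2 * m * a x + m ^ 2 := fun x => by ring
    simp only [this]
    rw [intervalIntegral.integral_add, intervalIntegral.integral_sub,
      intervalIntegral.integral_const_mul, ← hm]
    · simp
    all_goals exact Continuous.intervalIntegrable (by fun_prop) _ _
  nlinarith

/-- A Poincaré inequality on the unit interval. -/
lemma poincare {y y₁ : ℝ → ℂ} (h : ∀ x, HasDerivAt y (y₁ x) x) (hc : Continuous y₁)
    (hz : y 0 = 0 ∨ y 1 = 0) :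
    (∫ x in (0 : ℝ)..1, ‖y x‖ ^ 2) ≤ ∫ x in (0 : ℝ)..1, ‖y₁ x‖ ^ 2 := by
  have hy : Continuous y := continuous_iff_continuousAt.2 fun x => (h x).continuousAt
  -- Integrating from the endpoint where `y` vanishes gives the constant one, which is good enough
  -- for the absorption in `energy_estimate`.
  have key : ∀ x ∈ Icc (0 : ℝ) 1, ‖y x‖ ≤ ∫ x in (0 : ℝ)..1, ‖y₁ x‖ := by
    intro x hx
    rcases hz with hz | hz
    · have : y x = ∫ u in (0 : ℝ)..x, y₁ u := by
        rw [intervalIntegral.integral_eq_sub_of_hasDerivAt (fun u _ => h u)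
          (hc.intervalIntegrable _ _), hz, sub_zero]
      rw [this]
      refine (intervalIntegral.norm_integral_le_integral_norm hx.1).trans ?_
      exact intervalIntegral.integral_mono_interval le_rfl hx.1 hx.2
        (Eventually.of_forall fun _ => norm_nonneg _) (hc.norm.intervalIntegrable _ _)
    · have : y x = -∫ u in x..1, y₁ u := by
        rw [intervalIntegral.integral_eq_sub_of_hasDerivAt (fun u _ => h u)
          (hc.intervalIntegrable _ _), hz]
        ring
      rw [this, norm_neg]
      refine (intervalIntegral.norm_integral_le_integral_norm hx.2).trans ?_
      exact intervalIntegral.integral_mono_interval hx.1 hx.2 le_rfl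
        (Eventually.of_forall fun _ => norm_nonneg _) (hc.norm.intervalIntegrable _ _)
  calc (∫ x in (0 : ℝ)..1, ‖y x‖ ^ 2)
      ≤ ∫ x in (0 : ℝ)..1, (∫ x in (0 : ℝ)..1, ‖y₁ x‖) ^ 2 := by
        refine intervalIntegral.integral_mono_on (by norm_num)
          (Continuous.intervalIntegrable (by fun_prop) _ _)
          (Continuous.intervalIntegrable (by fun_prop) _ _) fun x hx => ?_
        exact pow_le_pow_left₀ (norm_nonneg _) (key x hx) 2
    _ = (∫ x in (0 : ℝ)..1, ‖y₁ x‖) ^ 2 := by simp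
    _ ≤ _ := sq_integral_le_integral_sq hc.norm

/-- The boundary form of the energy identity with the multiplier `1 + x`. -/
def energyForm (y y₁ y₂ : ℝ → ℂ) (x : ℝ) : ℝ :=
  (1 + x) / 2 * ⟪y x, y x⟫ + (1 + x) * ⟪y₂ x, y x⟫ - ⟪y₁ x, y x⟫ - (1 + x) / 2 * ⟪y₁ x, y₁ x⟫

/-- The weight `1 + x` has slope one. This turns the otherwise conservative third-order term into
the damping `-3/2 ‖y'‖²`, while the first-order term costs only `1/2 ‖y‖²`. -/
lemma hasDerivAt_energyForm {y y₁ y₂ y₃ : ℝ → ℂ} (h : DerivChain y y₁ y₂ y₃) (x : ℝ) :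
    HasDerivAt (energyForm y y₁ y₂)
      (1 / 2 * ‖y x‖ ^ 2 + (1 + x) * ⟪y₁ x + y₃ x, y x⟫ - 3 / 2 * ‖y₁ x‖ ^ 2) x := by
  have e0 := (h.one x).inner ℝ (h.one x)
  have e1 := (h.three x).inner ℝ (h.one x)
  have e2 := (h.two x).inner ℝ (h.one x)
  have e3 := (h.two x).inner ℝ (h.two x)
  have p1 : HasDerivAt (fun x : ℝ => 1 + x) 1 x := (hasDerivAt_id x).const_add 1
  have p2 : HasDerivAt (fun x : ℝ => (1 + x) / 2) (1 / 2) x := p1.div_const 2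
  refine ((((p2.mul e0).add (p1.mul e1)).sub e2).sub (p2.mul e3)).congr_deriv ?_
  simp only [← real_inner_self_eq_norm_sq, inner_add_left, real_inner_comm (y x) (y₁ x),
    real_inner_comm (y₁ x) (y₂ x), real_inner_comm (y x) (y₂ x), real_inner_comm (y x) (y₃ x)]
  ring

/-- By the Poincaré inequality the damping absorbs `3/2 ‖y‖²`, more than the cost `1/2 ‖y‖²`; the
surplus tolerates `Re σ` down to `-1/2`. The weight ranges over `[1, 2]`, and the two conditions on
`κ` are the requirement at its two ends. -/
lemma energy_estimate {σ : ℂ} {κ : ℝ} {y y₁ y₂ y₃ : ℝ → ℂ} (h : DerivChain y y₁ y₂ y₃)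
    (hz : y 0 = 0 ∨ y 1 = 0) (hE : energyForm y y₁ y₂ 0 ≤ energyForm y y₁ y₂ 1)
    (hκ : 0 < κ) (hκ1 : κ ≤ 1 + σ.re) (hκ2 : κ ≤ 1 + 2 * σ.re) :
    κ ^ 2 * (∫ x in (0 : ℝ)..1, ‖y x‖ ^ 2) ≤
      4 * ∫ x in (0 : ℝ)..1, ‖σ * y x + y₁ x + y₃ x‖ ^ 2 := by
  have c0 := h.cont₀
  have c1 := h.cont₁
  have c2 := h.cont₂
  have c3 := h.cont
  set N := ∫ x in (0 : ℝ)..1, ‖y x‖ ^ 2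
  set N₁ := ∫ x in (0 : ℝ)..1, ‖y₁ x‖ ^ 2
  set G := ∫ x in (0 : ℝ)..1, ‖σ * y x + y₁ x + y₃ x‖ ^ 2
  have hP : N ≤ N₁ := poincare h.one c1 hz
  have hI : (∫ x in (0 : ℝ)..1, (1 / 2 * ‖y x‖ ^ 2 + (1 + x) * ⟪y₁ x + y₃ x, y x⟫
      - 3 / 2 * ‖y₁ x‖ ^ 2)) = energyForm y y₁ y₂ 1 - energyForm y y₁ y₂ 0 :=
    intervalIntegral.integral_eq_sub_of_hasDerivAt (fun x _ => hasDerivAt_energyForm h x)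
      (Continuous.intervalIntegrable (by fun_prop) _ _)
  have hle : ∀ x ∈ Icc (0 : ℝ) 1, (1 / 2 * ‖y x‖ ^ 2 + (1 + x) * ⟪y₁ x + y₃ x, y x⟫
      - 3 / 2 * ‖y₁ x‖ ^ 2) ≤ (3 / 2 - κ / 2) * ‖y x‖ ^ 2 - 3 / 2 * ‖y₁ x‖ ^ 2
        + 2 / κ * ‖σ * y x + y₁ x + y₃ x‖ ^ 2 := by
    intro x hx
    have hg : ⟪y₁ x + y₃ x, y x⟫ = ⟪σ * y x + y₁ x + y₃ x, y x⟫ - σ.re * ‖y x‖ ^ 2 := by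
      rw [add_assoc, inner_add_left (σ * y x)]
      have : ⟪σ * y x, y x⟫ = σ.re * ‖y x‖ ^ 2 := by
        rw [← Complex.normSq_eq_norm_sq]
        simp [Complex.normSq_apply]
        ring
      rw [this]
      ring
    have hin := real_inner_le_norm (σ * y x + y₁ x + y₃ x) (y x)
    rw [hg]
    set a := ‖σ * y x + y₁ x + y₃ x‖
    set b := ‖y x‖
    have ha : 0 ≤ a := norm_nonneg _
    have hb : 0 ≤ b := norm_nonneg _
    have hσ : κ - 1 ≤ (1 + x) * σ.re := by
      rcases le_total 0 σ.re with hs | hs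
      · nlinarith [hx.1, mul_nonneg hx.1 hs]
      · nlinarith [hx.2, hx.1, mul_nonneg (sub_nonneg.2 hx.2) (neg_nonneg.2 hs)]
    -- Young's inequality, balanced so that half of the gap `κ` is left over.
    have hab : 2 * a * b ≤ κ / 2 * b ^ 2 + 2 / κ * a ^ 2 := by
      have : 0 ≤ (κ * b - 2 * a) ^ 2 / (2 * κ) := by positivity
      have e : (κ * b - 2 * a) ^ 2 / (2 * κ) = κ / 2 * b ^ 2 + 2 / κ * a ^ 2 - 2 * a * b := by
        field_simp
        ring
      linarith
    have h1 : (1 + x) * ⟪σ * y x + y₁ x + y₃ x, y x⟫ ≤ 2 * a * b := by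
      have : (1 + x) * ⟪σ * y x + y₁ x + y₃ x, y x⟫ ≤ (1 + x) * (a * b) :=
        mul_le_mul_of_nonneg_left hin (by linarith [hx.1])
      nlinarith [hx.2, mul_nonneg ha hb]
    nlinarith [sq_nonneg b, mul_le_mul_of_nonneg_right hσ (sq_nonneg b)]
  have hint := intervalIntegral.integral_mono_on (μ := volume) (a := (0 : ℝ)) (b := 1) (by norm_num)
    (Continuous.intervalIntegrable (by fun_prop) _ _)
    (Continuous.intervalIntegrable (by fun_prop) _ _) hle
  rw [hI, intervalIntegral.integral_add (Continuous.intervalIntegrable (by fun_prop) _ _)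
      (Continuous.intervalIntegrable (by fun_prop) _ _),
    intervalIntegral.integral_sub (Continuous.intervalIntegrable (by fun_prop) _ _)
      (Continuous.intervalIntegrable (by fun_prop) _ _),
    intervalIntegral.integral_const_mul, intervalIntegral.integral_const_mul,
    intervalIntegral.integral_const_mul] at hint
  change _ ≤ (3 / 2 - κ / 2) * N - 3 / 2 * N₁ + 2 / κ * G at hint
  have h2 : κ / 2 * N ≤ 2 / κ * G := by linarith
  have h3 := mul_le_mul_of_nonneg_left h2 (show 0 ≤ 2 * κ by positivity)
  have e1 : 2 * κ * (κ / 2 * N) = κ ^ 2 * N := by ring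
  have e2 : 2 * κ * (2 / κ * G) = 4 * G := by field_simp; ring
  linarith

/-- Resolvent estimate for `y(0) = y'(1) = y''(1) = 0`. -/
lemma direct_estimate {σ : ℂ} {κ : ℝ} {y y₁ y₂ y₃ : ℝ → ℂ} (h : DerivChain y y₁ y₂ y₃)
    (hy : y 0 = 0) (hy₁ : y₁ 1 = 0) (hy₂ : y₂ 1 = 0)
    (hκ : 0 < κ) (hκ1 : κ ≤ 1 + σ.re) (hκ2 : κ ≤ 1 + 2 * σ.re) :
    κ ^ 2 * (∫ x in (0 : ℝ)..1, ‖y x‖ ^ 2) ≤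
      4 * ∫ x in (0 : ℝ)..1, ‖σ * y x + y₁ x + y₃ x‖ ^ 2 := by
  refine energy_estimate h (Or.inl hy) ?_ hκ hκ1 hκ2
  -- The boundary form is `-1/2 ‖y'(0)‖²` at the left end and `‖y(1)‖²` at the right end.
  simp only [energyForm, hy, hy₁, hy₂, inner_zero_left, inner_zero_right]
  have h1 : 0 ≤ ⟪y₁ 0, y₁ 0⟫ := real_inner_self_nonneg
  have h2 : 0 ≤ ⟪y 1, y 1⟫ := real_inner_self_nonneg
  linarith

/-- Resolvent estimate for `y(0) = y'(0) = 0`, `y(1) + y''(1) = 0`. -/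
lemma adjoint_estimate {σ : ℂ} {κ : ℝ} {y y₁ y₂ y₃ : ℝ → ℂ} (h : DerivChain y y₁ y₂ y₃)
    (hy : y 0 = 0) (hy₁ : y₁ 0 = 0) (hy₂ : y 1 + y₂ 1 = 0)
    (hκ : 0 < κ) (hκ1 : κ ≤ 1 + σ.re) (hκ2 : κ ≤ 1 + 2 * σ.re) :
    κ ^ 2 * (∫ x in (0 : ℝ)..1, ‖y x‖ ^ 2) ≤
      4 * ∫ x in (0 : ℝ)..1, ‖σ * y x - y₁ x - y₃ x‖ ^ 2 := by
  -- Reflection reverses the sign of odd derivatives and moves the two conditions at `0` to the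
  -- right end.
  have key := energy_estimate (σ := σ) h.reflect (Or.inr (by simp [hy])) ?_ hκ hκ1 hκ2
  · have e1 := intervalIntegral.integral_comp_sub_left (a := 0) (b := 1)
      (fun x => ‖y x‖ ^ 2) (1 : ℝ)
    have e2 := intervalIntegral.integral_comp_sub_left (a := 0) (b := 1)
      (fun x => ‖σ * y x - y₁ x - y₃ x‖ ^ 2) (1 : ℝ)
    simp only [sub_self, sub_zero] at e1 e2
    rw [← e1, ← e2]
    simpa only [sub_eq_add_neg] using key
  -- After reflection the form vanishes at the right end and equals `-1/2 ‖y(1) - y'(1)‖²` at the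
  -- left end.
  · have : y₂ 1 = -y 1 := by linear_combination hy₂
    simp only [energyForm, hy, hy₁, this, sub_zero, sub_self, neg_zero, inner_zero_right,
      inner_neg_left, inner_neg_right]
    have h1 : 0 ≤ ⟪y 1 - y₁ 1, y 1 - y₁ 1⟫ := real_inner_self_nonneg
    rw [inner_sub_left, inner_sub_right, inner_sub_right, real_inner_comm (y₁ 1) (y 1)] at h1
    linarith [real_inner_comm (y₁ 1) (y 1)]

/-! ### Solvability of the adjoint boundary value problem. -/

/-- Variation of constants. -/
lemma exists_linear_ode {E : Type*} [NormedAddCommGroup E] [NormedSpace ℝ E] [CompleteSpace E]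
    (A : E →L[ℝ] E) {F : ℝ → E} (hF : Continuous F) (e : E) :
    ∃ Y : ℝ → E, Y 0 = e ∧ ∀ x, HasDerivAt Y (A (Y x) + F x) x := by
  have hexp : ∀ x : ℝ, HasDerivAt (fun u : ℝ => NormedSpace.exp (u • A))
      (A * NormedSpace.exp (x • A)) x := fun x => hasDerivAt_exp_smul_const' A x
  have hcont : Continuous fun u : ℝ => NormedSpace.exp (u • A) :=
    continuous_iff_continuousAt.2 fun x => (hexp x).continuousAt
  have hG : Continuous fun u : ℝ => NormedSpace.exp ((-u) • A) (F u) :=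
    (hcont.comp continuous_neg).clm_apply hF
  refine ⟨fun x => NormedSpace.exp (x • A)
    (e + ∫ u in (0 : ℝ)..x, NormedSpace.exp ((-u) • A) (F u)), by simp, fun x => ?_⟩
  have hint : HasDerivAt (fun x : ℝ => e + ∫ u in (0 : ℝ)..x, NormedSpace.exp ((-u) • A) (F u))
      (NormedSpace.exp ((-x) • A) (F x)) x :=
    (intervalIntegral.integral_hasDerivAt_right (hG.intervalIntegrable _ _)
      hG.stronglyMeasurable.stronglyMeasurableAtFilter hG.continuousAt).const_add e
  refine ((hexp x).clm_apply hint).congr_deriv ?_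
  let _ : NormedAlgebra ℚ (E →L[ℝ] E) := NormedAlgebra.restrictScalars ℚ ℝ (E →L[ℝ] E)
  have : NormedSpace.exp (x • A) * NormedSpace.exp ((-x) • A) = 1 := by
    rw [← NormedSpace.exp_add_of_commute ((Commute.refl A).smul_left x |>.smul_right (-x))]
    simp
  have h2 := congrArg (fun B : E →L[ℝ] E => B (F x)) this
  simp only [mul_apply_eq_comp, one_apply_eq_self] at h2
  rw [h2, mul_apply_eq_comp]

lemma exists_adjoint_ivp (μ : ℂ) {f : ℝ → ℂ} (hf : Continuous f) (c : ℂ) :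
    ∃ y y₁ y₂ : ℝ → ℂ, DerivChain y y₁ y₂ (fun x => μ * y x - y₁ x - f x) ∧
      y 0 = 0 ∧ y₁ 0 = 0 ∧ y₂ 0 = c := by
  let p₀ : ℂ × ℂ × ℂ →L[ℝ] ℂ := ContinuousLinearMap.fst ℝ ℂ (ℂ × ℂ)
  let p₁ : ℂ × ℂ × ℂ →L[ℝ] ℂ :=
    (ContinuousLinearMap.fst ℝ ℂ ℂ).comp (ContinuousLinearMap.snd ℝ ℂ (ℂ × ℂ))
  let p₂ : ℂ × ℂ × ℂ →L[ℝ] ℂ :=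
    (ContinuousLinearMap.snd ℝ ℂ ℂ).comp (ContinuousLinearMap.snd ℝ ℂ (ℂ × ℂ))
  let A : ℂ × ℂ × ℂ →L[ℝ] ℂ × ℂ × ℂ := p₁.prod (p₂.prod (μ • p₀ - p₁))
  obtain ⟨Y, hY0, hY⟩ := exists_linear_ode A (F := fun x => (0, 0, -f x)) (by fun_prop) (0, 0, c)
  have hYc : Continuous Y := continuous_iff_continuousAt.2 fun x => (hY x).continuousAt
  have e : ∀ x, A (Y x) + (0, 0, -f x) =
      ((Y x).2.1, (Y x).2.2, μ * (Y x).1 - (Y x).2.1 - f x) := by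
    intro x
    simp [A, p₀, p₁, p₂, sub_eq_add_neg]
  refine ⟨fun x => (Y x).1, fun x => (Y x).2.1, fun x => (Y x).2.2, ⟨fun x => ?_, fun x => ?_,
    fun x => ?_, by fun_prop⟩, by simp [hY0], by simp [hY0], by simp [hY0]⟩
  · exact (p₀.hasFDerivAt.comp_hasDerivAt x (hY x)).congr_deriv (by rw [e]; rfl)
  · exact (p₁.hasFDerivAt.comp_hasDerivAt x (hY x)).congr_deriv (by rw [e]; rfl)
  · exact (p₂.hasFDerivAt.comp_hasDerivAt x (hY x)).congr_deriv (by rw [e]; rfl)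

namespace DerivChain

variable {y y₁ y₂ y₃ z z₁ z₂ z₃ : ℝ → ℂ}

lemma add (h : DerivChain y y₁ y₂ y₃) (k : DerivChain z z₁ z₂ z₃) :
    DerivChain (fun x => y x + z x) (fun x => y₁ x + z₁ x) (fun x => y₂ x + z₂ x)
      (fun x => y₃ x + z₃ x) :=
  ⟨fun x => (h.one x).add (k.one x), fun x => (h.two x).add (k.two x),
    fun x => (h.three x).add (k.three x), h.cont.add k.cont⟩

lemma sub (h : DerivChain y y₁ y₂ y₃) (k : DerivChain z z₁ z₂ z₃) :
    DerivChain (fun x => y x - z x) (fun x => y₁ x - z₁ x) (fun x => y₂ x - z₂ x)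
      (fun x => y₃ x - z₃ x) :=
  ⟨fun x => (h.one x).sub (k.one x), fun x => (h.two x).sub (k.two x),
    fun x => (h.three x).sub (k.three x), h.cont.sub k.cont⟩

lemma const_mul (c : ℂ) (h : DerivChain y y₁ y₂ y₃) :
    DerivChain (fun x => c * y x) (fun x => c * y₁ x) (fun x => c * y₂ x) (fun x => c * y₃ x) :=
  ⟨fun x => (h.one x).const_mul c, fun x => (h.two x).const_mul c,
    fun x => (h.three x).const_mul c, continuous_const.mul h.cont⟩

lemma iteratedDeriv_eq (h : DerivChain y y₁ y₂ y₃) :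
    iteratedDeriv 1 y = y₁ ∧ iteratedDeriv 2 y = y₂ ∧ iteratedDeriv 3 y = y₃ := by
  have e1 : iteratedDeriv 1 y = y₁ := by rw [iteratedDeriv_one]; exact funext fun x => (h.one x).deriv
  have e2 : iteratedDeriv 2 y = y₂ := by
    rw [iteratedDeriv_succ, e1]; exact funext fun x => (h.two x).deriv
  refine ⟨e1, e2, ?_⟩
  rw [iteratedDeriv_succ, e2]; exact funext fun x => (h.three x).deriv

/-- Vanishing passes to the derivatives on the open interval and to the endpoints by continuity; it
is the Cauchy data at an endpoint that get used later. -/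
lemma eq_zero_of_integral (h : DerivChain y y₁ y₂ y₃)
    (h0 : (∫ x in (0 : ℝ)..1, ‖y x‖ ^ 2) ≤ 0) :
    ∀ x ∈ Icc (0 : ℝ) 1, y x = 0 ∧ y₁ x = 0 ∧ y₂ x = 0 := by
  have hy : ∀ x ∈ Icc (0 : ℝ) 1, y x = 0 := by
    by_contra! hne
    obtain ⟨x, hx, hxy⟩ := hne
    have c0 := h.cont₀
    have := intervalIntegral.integral_pos (a := (0 : ℝ)) (b := 1) (f := fun x => ‖y x‖ ^ 2)
      (by norm_num) (by fun_prop) (fun _ _ => by positivity) ⟨x, hx, by positivity⟩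
    linarith
  have step : ∀ {u u' : ℝ → ℂ}, (∀ x, HasDerivAt u (u' x) x) → Continuous u' →
      (∀ x ∈ Icc (0 : ℝ) 1, u x = 0) → ∀ x ∈ Icc (0 : ℝ) 1, u' x = 0 := by
    intro u u' hu hc hz
    have ho : ∀ x ∈ Ioo (0 : ℝ) 1, u' x = 0 := fun x hx => by
      refine (hu x).unique ((hasDerivAt_const x (0 : ℂ)).congr_of_eventuallyEq ?_)
      filter_upwards [Ioo_mem_nhds hx.1 hx.2] with w hw using hz w ⟨hw.1.le, hw.2.le⟩
    have hcl : IsClosed {x | u' x = 0} := isClosed_eq hc continuous_const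
    rw [← closure_Ioo (by norm_num : (0 : ℝ) ≠ 1)]
    exact fun x hx => hcl.closure_subset_iff.2 ho hx
  have hy₁ := step h.one h.cont₁ hy
  exact fun x hx => ⟨hy x hx, hy₁ x hx, step h.two h.cont₂ hy₁ x hx⟩

end DerivChain

lemma derivChain_of_contDiff {y : ℝ → ℂ} (hy : ContDiff ℝ ∞ y) :
    DerivChain y (iteratedDeriv 1 y) (iteratedDeriv 2 y) (iteratedDeriv 3 y) := by
  have key : ∀ (k : ℕ) (x : ℝ), HasDerivAt (iteratedDeriv k y) (iteratedDeriv (k + 1) y x) x := by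
    intro k x
    rw [iteratedDeriv_succ]
    exact ((hy.differentiable_iteratedDeriv k (by exact_mod_cast WithTop.coe_lt_top _)) x).hasDerivAt
  refine ⟨fun x => ?_, key 1, key 2, ?_⟩
  · simpa using key 0 x
  · exact hy.continuous_iteratedDeriv 3 (mod_cast ENat.LEInfty.out)

/-- The smooth functions satisfying the adjoint boundary conditions. -/
structure AdjDomain (y : ℝ → ℂ) : Prop where
  smooth : ContDiff ℝ ∞ y
  left : y 0 = 0
  left_deriv : iteratedDeriv 1 y 0 = 0
  right : y 1 + iteratedDeriv 2 y 1 = 0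

/-- The differential expression `y' + y'''`. -/
def adjOp (y : ℝ → ℂ) (x : ℝ) : ℂ := iteratedDeriv 1 y x + iteratedDeriv 3 y x

/-- The resolvent of the adjoint operator on smooth functions. -/
lemma exists_adjoint_resolvent {μ : ℂ} (hμ : -(1 / 2) < μ.re) {f : ℝ → ℂ} (hf : ContDiff ℝ ∞ f) :
    ∃ y, AdjDomain y ∧ ∀ x, μ * y x - adjOp y x = f x := by
  obtain ⟨u, u₁, u₂, hu, hu0, hu1, -⟩ := exists_adjoint_ivp μ hf.continuous 0
  obtain ⟨w, w₁, w₂, hw, hw0, hw1, hw2⟩ :=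
    exists_adjoint_ivp μ (f := fun _ => 0) continuous_const 1
  -- Shooting: both solutions satisfy the conditions at `0`, and a multiple of `w` corrects the
  -- condition at `1`. This fails only if `w` itself solves the homogeneous problem, which the
  -- estimate excludes since `w''(0) = 1`.
  have hne : w 1 + w₂ 1 ≠ 0 := by
    intro h0
    have hκ : 0 < min (1 + μ.re) (1 + 2 * μ.re) := lt_min (by linarith) (by linarith)
    have := adjoint_estimate (σ := μ) hw hw0 hw1 h0 hκ (min_le_left _ _) (min_le_right _ _)
    simp only [sub_zero, sub_self, norm_zero, zero_pow two_ne_zero,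
      intervalIntegral.integral_zero, mul_zero] at this
    have h2 := (hw.eq_zero_of_integral (nonpos_of_mul_nonpos_right this (by positivity)) 0
      (by simp)).2.2
    rw [hw2] at h2
    exact one_ne_zero h2
  set c : ℂ := -(u 1 + u₂ 1) / (w 1 + w₂ 1)
  have hy := hu.add (hw.const_mul c)
  set y := fun x => u x + c * w x
  have heq : ∀ x, μ * u x - u₁ x - f x + c * (μ * w x - w₁ x - 0) =
      μ * y x - (u₁ x + c * w₁ x) - f x := fun x => by simp only [y]; ring
  simp only [heq] at hy
  obtain ⟨d1, d2, d3⟩ := hy.iteratedDeriv_eq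
  -- Bootstrapping: the equation expresses the third derivative through lower ones and the smooth
  -- `f`.
  have hsm : ∀ n : ℕ, ContDiff ℝ n y ∧ ContDiff ℝ n (fun x => u₁ x + c * w₁ x) ∧
      ContDiff ℝ n (fun x => u₂ x + c * w₂ x) := by
    intro n
    induction n with
    | zero => exact ⟨contDiff_zero.2 hy.cont₀, contDiff_zero.2 hy.cont₁, contDiff_zero.2 hy.cont₂⟩
    | succ n ih =>
      have step : ∀ {a b : ℝ → ℂ}, (∀ x, HasDerivAt a (b x) x) → ContDiff ℝ n b →
          ContDiff ℝ (n + 1 : ℕ) a := by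
        intro a b hab hb
        rw [Nat.cast_add, Nat.cast_one, contDiff_succ_iff_deriv]
        refine ⟨fun x => (hab x).differentiableAt, by simp, ?_⟩
        rwa [funext fun x => (hab x).deriv]
      refine ⟨step hy.one ih.2.1, step hy.two ih.2.2, step hy.three ?_⟩
      exact ((contDiff_const.mul ih.1).sub ih.2.1).sub (hf.of_le (by exact_mod_cast le_top))
  refine ⟨y, ⟨contDiff_infty.2 fun n => (hsm n).1, by simp [y, hu0, hw0], ?_, ?_⟩, fun x => ?_⟩
  · rw [d1]; simp [hu1, hw1]
  · rw [d2]
    simp only [y, c]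
    field_simp
    ring
  · rw [adjOp, d1, d3]
    ring

lemma AdjDomain.sub {y z : ℝ → ℂ} (hy : AdjDomain y) (hz : AdjDomain z) :
    AdjDomain (fun x => y x - z x) ∧ ∀ x, adjOp (fun x => y x - z x) x = adjOp y x - adjOp z x := by
  obtain ⟨d1, d2, d3⟩ :=
    ((derivChain_of_contDiff hy.smooth).sub (derivChain_of_contDiff hz.smooth)).iteratedDeriv_eq
  refine ⟨⟨hy.smooth.sub hz.smooth, by simp [hy.left, hz.left], ?_, ?_⟩, fun x => ?_⟩
  · rw [d1]; simp [hy.left_deriv, hz.left_deriv]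
  · rw [d2]; linear_combination hy.right - hz.right
  · rw [adjOp, adjOp, adjOp, d1, d3]; ring

lemma AdjDomain.const_mul {y : ℝ → ℂ} (hy : AdjDomain y) (c : ℂ) :
    AdjDomain (fun x => c * y x) ∧ ∀ x, adjOp (fun x => c * y x) x = c * adjOp y x := by
  obtain ⟨d1, d2, d3⟩ := ((derivChain_of_contDiff hy.smooth).const_mul c).iteratedDeriv_eq
  refine ⟨⟨contDiff_const.mul hy.smooth, by simp [hy.left], ?_, ?_⟩, fun x => ?_⟩
  · rw [d1]; simp [hy.left_deriv]
  · rw [d2]; linear_combination c * hy.right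
  · rw [adjOp, adjOp, d1, d3]; ring

lemma AdjDomain.contDiff_adjOp {y : ℝ → ℂ} (hy : AdjDomain y) : ContDiff ℝ ∞ (adjOp y) := by
  refine ContDiff.add ?_ ?_
  · rw [iteratedDeriv_eq_iterate]; exact ContDiff.iterate_deriv 1 hy.smooth
  · rw [iteratedDeriv_eq_iterate]; exact ContDiff.iterate_deriv 3 hy.smooth

lemma AdjDomain.estimate {μ : ℂ} {κ : ℝ} {y : ℝ → ℂ} (hy : AdjDomain y) (hκ : 0 < κ)
    (hκ1 : κ ≤ 1 + μ.re) (hκ2 : κ ≤ 1 + 2 * μ.re) :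
    κ ^ 2 * (∫ x in (0 : ℝ)..1, ‖y x‖ ^ 2) ≤
      4 * ∫ x in (0 : ℝ)..1, ‖μ * y x - adjOp y x‖ ^ 2 := by
  simpa only [adjOp, sub_add_eq_sub_sub] using
    adjoint_estimate (σ := μ) (derivChain_of_contDiff hy.smooth) hy.left hy.left_deriv hy.right
      hκ hκ1 hκ2

/-! ### Laplace transform of a bounded orbit and Liouville's theorem. -/

section Liouville

variable {ℓ : (ℝ → ℂ) → ℂ} {C : ℝ}

/-- Bounded functionals of the adjoint resolvent: Lipschitz dependence on the parameter. -/
lemma resolvent_functional_lipschitz (hC : 0 ≤ C)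
    (hsub : ∀ y z, Continuous y → Continuous z → ℓ (fun x => y x - z x) = ℓ y - ℓ z)
    (hb : ∀ y, Continuous y → ‖ℓ y‖ ^ 2 ≤ C * ∫ x in (0 : ℝ)..1, ‖y x‖ ^ 2)
    {μ ν : ℂ} {κ : ℝ} (hκ : 0 < κ) (hκ1 : κ ≤ 1 + μ.re) (hκ2 : κ ≤ 1 + 2 * μ.re)
    {g y z : ℝ → ℂ} (hy : AdjDomain y) (hz : AdjDomain z)
    (hyg : ∀ x, μ * y x - adjOp y x = g x) (hzg : ∀ x, ν * z x - adjOp z x = g x) :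
    ‖ℓ y - ℓ z‖ ^ 2 ≤ C * (4 / κ ^ 2 * (‖μ - ν‖ ^ 2 * ∫ x in (0 : ℝ)..1, ‖z x‖ ^ 2)) := by
  obtain ⟨hd, hop⟩ := hy.sub hz
  have h1 := hd.estimate hκ hκ1 hκ2
  have e : ∀ x, μ * (y x - z x) - adjOp (fun x => y x - z x) x = (ν - μ) * z x := by
    intro x
    rw [hop]
    linear_combination hyg x - hzg x
  simp only [e, norm_mul, mul_pow, intervalIntegral.integral_const_mul] at h1
  rw [← hsub y z hy.smooth.continuous hz.smooth.continuous]
  refine (hb _ hd.smooth.continuous).trans (mul_le_mul_of_nonneg_left ?_ hC)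
  rw [norm_sub_rev μ ν, div_mul_eq_mul_div, le_div_iff₀ (by positivity)]
  linarith

/-- The resolvent identity gives the difference quotient `-ℓ(R_μ R_ν f)`, and the Lipschitz bound
for `R_μ` applied to `R_ν f` lets `μ` tend to `ν`. -/
lemma resolvent_functional_hasDerivAt (hC : 0 ≤ C)
    (hsub : ∀ y z, Continuous y → Continuous z → ℓ (fun x => y x - z x) = ℓ y - ℓ z)
    (hsmul : ∀ (c : ℂ) y, Continuous y → ℓ (fun x => c * y x) = c * ℓ y)
    (hb : ∀ y, Continuous y → ‖ℓ y‖ ^ 2 ≤ C * ∫ x in (0 : ℝ)..1, ‖y x‖ ^ 2)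
    {R : ℂ → (ℝ → ℂ) → ℝ → ℂ}
    (hR : ∀ μ : ℂ, -(1 / 2) < μ.re → ∀ f, ContDiff ℝ ∞ f →
      AdjDomain (R μ f) ∧ ∀ x, μ * R μ f x - adjOp (R μ f) x = f x)
    {f : ℝ → ℂ} (hf : ContDiff ℝ ∞ f) {ν : ℂ} (hν : -(1 / 2) < ν.re) :
    HasDerivAt (fun μ => ℓ (R μ f)) (-ℓ (R ν (R ν f))) ν := by
  obtain ⟨hν1, hν2⟩ := hR ν hν f hf
  set g := R ν f with hg
  obtain ⟨hg1, hg2⟩ := hR ν hν g hν1.smooth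
  obtain ⟨κ, hκ, hκν1, hκν2⟩ : ∃ κ : ℝ, 0 < κ ∧ κ < 1 + ν.re ∧ κ < 1 + 2 * ν.re := by
    obtain ⟨κ, h0, h1⟩ := exists_between
      (show (0 : ℝ) < min (1 + ν.re) (1 + 2 * ν.re) from lt_min (by linarith) (by linarith))
    exact ⟨κ, h0, lt_of_lt_of_le h1 (min_le_left _ _), lt_of_lt_of_le h1 (min_le_right _ _)⟩
  set K := C * (4 / κ ^ 2 * ∫ x in (0 : ℝ)..1, ‖R ν g x‖ ^ 2) with hK
  have hK0 : 0 ≤ K := mul_nonneg hC (mul_nonneg (by positivity)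
    (intervalIntegral.integral_nonneg (by norm_num) fun _ _ => sq_nonneg _))
  rw [hasDerivAt_iff_isLittleO]
  refine Asymptotics.IsBigO.trans_isLittleO (g := fun μ => (μ - ν) ^ 2)
    (Asymptotics.IsBigO.of_bound (Real.sqrt K) ?_) ?_
  · have c1 : ContinuousAt (fun μ : ℂ => 1 + μ.re) ν := by fun_prop
    have c2 : ContinuousAt (fun μ : ℂ => 1 + 2 * μ.re) ν := by fun_prop
    filter_upwards [c1.eventually_const_lt hκν1, c2.eventually_const_lt hκν2] with μ h1 h2
    have hμ : -(1 / 2) < μ.re := by linarith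
    obtain ⟨hμ1, hμ2⟩ := hR μ hμ f hf
    obtain ⟨hγ1, hγ2⟩ := hR μ hμ g hν1.smooth
    -- Resolvent identity: the difference of the two sides is annihilated by `μ - A`, so its `L²`
    -- norm is zero and `ℓ` does not see it.
    have hsplit : ℓ (R μ f) - ℓ g = (ν - μ) * ℓ (R μ g) := by
      rw [← hsmul _ _ hγ1.smooth.continuous,
        ← sub_eq_zero, ← hsub _ _ hμ1.smooth.continuous hν1.smooth.continuous,
        ← hsub (fun x => R μ f x - g x) (fun x => (ν - μ) * R μ g x)
          (hμ1.smooth.continuous.sub hν1.smooth.continuous)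
          (continuous_const.mul hγ1.smooth.continuous)]
      obtain ⟨d1, o1⟩ := hμ1.sub hν1
      have hmul := hγ1.const_mul (ν - μ)
      obtain ⟨d2, o2⟩ := d1.sub hmul.1
      have h3 := d2.estimate (μ := μ) hκ h1.le h2.le
      have e : ∀ x, μ * (R μ f x - g x - (ν - μ) * R μ g x) -
          adjOp (fun x => R μ f x - g x - (ν - μ) * R μ g x) x = 0 := by
        intro x
        rw [o2, o1, hmul.2]
        linear_combination hμ2 x - hν2 x - (ν - μ) * hγ2 x
      simp only [e, norm_zero, zero_pow two_ne_zero, intervalIntegral.integral_zero,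
        mul_zero] at h3
      have h4 := nonpos_of_mul_nonpos_right h3 (by positivity)
      have h5 := (hb _ d2.smooth.continuous).trans (mul_nonpos_of_nonneg_of_nonpos hC h4)
      have h6 : ‖ℓ (fun x => R μ f x - g x - (ν - μ) * R μ g x)‖ ^ 2 = 0 :=
        le_antisymm h5 (sq_nonneg _)
      simpa using h6
    have h7 := resolvent_functional_lipschitz hC hsub hb hκ h1.le h2.le hγ1 hg1 hγ2 hg2
    have h8 : ‖ℓ (R μ g) - ℓ (R ν g)‖ ≤ Real.sqrt K * ‖μ - ν‖ := by
      rw [← Real.sqrt_sq (norm_nonneg (μ - ν)), ← Real.sqrt_mul hK0]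
      refine Real.le_sqrt_of_sq_le (h7.trans_eq ?_)
      rw [hK]; ring
    have h9 : ℓ (R μ f) - ℓ g - (μ - ν) • -ℓ (R ν g) =
        -(μ - ν) * (ℓ (R μ g) - ℓ (R ν g)) := by
      rw [hsplit, smul_eq_mul]; ring
    rw [h9, norm_mul, norm_neg, norm_pow, sq]
    nlinarith [mul_le_mul_of_nonneg_left h8 (norm_nonneg (μ - ν))]
  · have h := Asymptotics.isLittleO_pow_sub_sub ν (m := 2) one_lt_two
    exact Asymptotics.isLittleO_norm_left.1 (by simpa only [norm_pow] using h)

/-- For `s ≤ 0` and `Re μ < 0` the exponential decays. A rate `c` survives in a ball around `μ`, and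
half of it pays for the factor `s` created by differentiation. -/
lemma hasDerivAt_laplace_neg {W : ℝ → ℂ} {M : ℝ} (hW : AEStronglyMeasurable W (volume.restrict (Iic 0)))
    (hM : ∀ s ≤ 0, ‖W s‖ ≤ M) {μ : ℂ} (hμ : μ.re < 0) :
    DifferentiableAt ℂ (fun μ : ℂ => ∫ s in Iic (0 : ℝ), Complex.exp (-μ * s) * W s) μ := by
  set c := -μ.re / 2 with hc
  have hc0 : 0 < c := by rw [hc]; linarith
  have hM0 : 0 ≤ M := (norm_nonneg _).trans (hM 0 le_rfl)
  have hnorm : ∀ (ν : ℂ) (s : ℝ), ‖Complex.exp (-ν * s)‖ = Real.exp (-ν.re * s) := by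
    intro ν s; rw [Complex.norm_exp]; simp
  have hint : ∀ a : ℝ, 0 < a → IntegrableOn (fun s => Real.exp (a * s)) (Iic 0) := fun a ha =>
    integrableOn_exp_mul_Iic ha 0
  have hmeas : ∀ ν : ℂ, AEStronglyMeasurable (fun s : ℝ => Complex.exp (-ν * s) * W s)
      (volume.restrict (Iic 0)) := fun ν =>
    (Continuous.aestronglyMeasurable (by fun_prop)).mul hW
  have hball : ∀ ν ∈ Metric.ball μ c, ν.re < -c := by
    intro ν hν
    have h1 := (Complex.abs_re_le_norm (ν - μ)).trans_lt (mem_ball_iff_norm.1 hν)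
    rw [Complex.sub_re, abs_lt] at h1
    linarith [h1.2]
  refine (hasDerivAt_integral_of_dominated_loc_of_deriv_le (𝕜 := ℂ)
    (F' := fun ν s => -s * Complex.exp (-ν * s) * W s)
    (bound := fun s => (2 / c) * M * Real.exp (c / 2 * s))
    (Metric.ball_mem_nhds μ hc0) (Eventually.of_forall hmeas) ?_ ?_ ?_ ?_ ?_).2.differentiableAt
  · refine Integrable.mono' ((hint (-μ.re) (by linarith)).mul_const M) (hmeas μ) ?_
    filter_upwards [ae_restrict_mem measurableSet_Iic] with s hs
    rw [norm_mul, hnorm]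
    exact mul_le_mul_of_nonneg_left (hM s hs) (Real.exp_pos _).le
  · exact (Continuous.aestronglyMeasurable (by fun_prop)).mul hW
  · filter_upwards [ae_restrict_mem measurableSet_Iic] with s hs ν hν
    have hs' : s ≤ 0 := hs
    rw [norm_mul, norm_mul, hnorm, norm_neg, Complex.norm_real, Real.norm_of_nonpos hs']
    have h1 : Real.exp (-ν.re * s) ≤ Real.exp (c * s) := by
      rw [Real.exp_le_exp]
      nlinarith [hball ν hν]
    have h2 : -s ≤ 2 / c * Real.exp (-(c / 2 * s)) := by
      have := Real.add_one_le_exp (-(c / 2 * s))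
      rw [div_mul_eq_mul_div, le_div_iff₀ hc0]
      nlinarith
    have h3 : Real.exp (c * s) = Real.exp (c / 2 * s) * Real.exp (c / 2 * s) := by
      rw [← Real.exp_add]; ring_nf
    have h4 : Real.exp (-(c / 2 * s)) * Real.exp (c / 2 * s) = 1 := by
      rw [← Real.exp_add]; simp
    calc -s * Real.exp (-ν.re * s) * ‖W s‖
        ≤ (2 / c * Real.exp (-(c / 2 * s))) * Real.exp (c * s) * M := by
          gcongr
          exact hM s hs
      _ = 2 / c * M * Real.exp (c / 2 * s) *
          (Real.exp (-(c / 2 * s)) * Real.exp (c / 2 * s)) := by rw [h3]; ring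
      _ = _ := by rw [h4, mul_one]
  · exact (hint _ (by positivity)).const_mul _
  · refine Eventually.of_forall fun s ν _ => ?_
    have h1 : HasDerivAt (fun ν : ℂ => -ν * s) (-1 * s) ν := (hasDerivAt_id ν).neg.mul_const _
    exact ((h1.cexp).mul_const (W s)).congr_deriv (by ring)

/-- A bounded family of functionals on `(-∞, 0]` that is transported by the adjoint operator
vanishes. -/
lemma functional_eq_zero {w : (ℝ → ℂ) → ℝ → ℂ} (hC : 0 ≤ C)
    (hsub : ∀ y z, Continuous y → Continuous z → ∀ t,
      w (fun x => y x - z x) t = w y t - w z t)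
    (hsmul : ∀ (c : ℂ) y, Continuous y → ∀ t, w (fun x => c * y x) t = c * w y t)
    (hb : ∀ y, Continuous y → ∀ t ≤ 0, ‖w y t‖ ^ 2 ≤ C * ∫ x in (0 : ℝ)..1, ‖y x‖ ^ 2)
    (hd : ∀ y, AdjDomain y → ∀ t ≤ 0, HasDerivAt (w y) (w (adjOp y) t) t)
    {y₀ : ℝ → ℂ} (hy₀ : AdjDomain y₀) : w y₀ 0 = 0 := by
  have hopc : ∀ y, AdjDomain y → ContDiff ℝ ∞ (adjOp y) := fun y hy => hy.contDiff_adjOp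
  choose! R hR using fun (μ : ℂ) (hμ : -(1 / 2) < μ.re) (f : ℝ → ℂ) (hf : ContDiff ℝ ∞ f) =>
    exists_adjoint_resolvent hμ hf
  -- With this `f` the solution of the resolvent equation at `μ = 0` is `y₀` on the unit interval.
  -- Moreover `w f` is minus a derivative, which provides its measurability.
  set f : ℝ → ℂ := fun x => (-1) * adjOp y₀ x with hfdef
  have hf : ContDiff ℝ ∞ f := contDiff_const.mul (hopc y₀ hy₀)
  obtain ⟨M, hM⟩ : ∃ M, ∀ t ≤ 0, ‖w f t‖ ≤ M :=
    ⟨_, fun t ht => Real.le_sqrt_of_sq_le (hb f hf.continuous t ht)⟩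
  have hWm : AEStronglyMeasurable (w f) (volume.restrict (Iic 0)) := by
    refine (((measurable_deriv (w y₀)).neg).aestronglyMeasurable).congr ?_
    filter_upwards [ae_restrict_mem measurableSet_Iic] with t ht
    rw [hfdef, hsmul _ _ (hopc y₀ hy₀).continuous, Pi.neg_apply, (hd y₀ hy₀ t ht).deriv]
    ring
  -- In the strip both descriptions are available: `-e^{-μs} w(R_μ f)(s)` is an antiderivative of
  -- the integrand and vanishes at `-∞`.
  have hstrip : ∀ μ : ℂ, -(1 / 2) < μ.re → μ.re < 0 →
      (∫ s in Iic (0 : ℝ), Complex.exp (-μ * s) * w f s) = -w (R μ f) 0 := by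
    intro μ h1 h2
    obtain ⟨r1, r2⟩ := hR μ h1 f hf
    obtain ⟨B, hB⟩ : ∃ B, ∀ t ≤ 0, ‖w (R μ f) t‖ ≤ B :=
      ⟨_, fun t ht => Real.le_sqrt_of_sq_le (hb _ r1.smooth.continuous t ht)⟩
    have hnorm : ∀ s : ℝ, ‖Complex.exp (-μ * s)‖ = Real.exp (-μ.re * s) := by
      intro s; rw [Complex.norm_exp]; simp
    have hder : ∀ s ≤ (0 : ℝ), HasDerivAt (fun s : ℝ => -(Complex.exp (-μ * s) * w (R μ f) s))
        (Complex.exp (-μ * s) * w f s) s := by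
      intro s hs
      have e1 : HasDerivAt (fun s : ℝ => Complex.exp (-μ * s)) (Complex.exp (-μ * s) * -μ) s := by
        have : HasDerivAt (fun s : ℝ => -μ * (s : ℂ)) (-μ) s := by
          simpa using (Complex.ofRealCLM.hasDerivAt (x := s)).const_mul (-μ)
        exact this.cexp
      refine (e1.mul (hd _ r1 s hs)).neg.congr_deriv ?_
      have e2 : w f s = μ * w (R μ f) s - w (adjOp (R μ f)) s := by
        rw [← hsmul _ _ r1.smooth.continuous, ← hsub (fun x => μ * R μ f x) (adjOp (R μ f))
          (continuous_const.mul r1.smooth.continuous) (hopc _ r1).continuous]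
        congr 1
        exact funext fun x => (r2 x).symm
      rw [e2]; ring
    have hint : IntegrableOn (fun s : ℝ => Complex.exp (-μ * s) * w f s) (Iic 0) := by
      refine Integrable.mono' ((integrableOn_exp_mul_Iic (a := -μ.re) (by linarith) 0).mul_const M)
        ((Continuous.aestronglyMeasurable (by fun_prop)).mul hWm) ?_
      filter_upwards [ae_restrict_mem measurableSet_Iic] with s hs
      rw [norm_mul, hnorm]
      exact mul_le_mul_of_nonneg_left (hM s hs) (Real.exp_pos _).le
    have hlim : Tendsto (fun s : ℝ => -(Complex.exp (-μ * s) * w (R μ f) s)) atBot (𝓝 0) := by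
      rw [tendsto_zero_iff_norm_tendsto_zero]
      refine squeeze_zero' (g := fun s => Real.exp (-μ.re * s) * B)
        (Eventually.of_forall fun _ => norm_nonneg _) ?_ ?_
      · filter_upwards [eventually_le_atBot (0 : ℝ)] with s hs
        rw [norm_neg, norm_mul, hnorm]
        exact mul_le_mul_of_nonneg_left (hB s hs) (Real.exp_pos _).le
      · have : Tendsto (fun s : ℝ => -μ.re * s) atBot atBot :=
          tendsto_id.const_mul_atBot (by linarith)
        simpa using (Real.tendsto_exp_atBot.comp this).mul_const B
    have := integral_Iic_of_hasDerivAt_of_tendsto' hder hint hlim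
    rw [this]
    simp
  -- The two holomorphic branches are glued in the middle of their common strip `-1/2 < Re μ < 0`.
  set G : ℂ → ℂ := fun μ => if μ.re < -(1 / 4)
    then ∫ s in Iic (0 : ℝ), Complex.exp (-μ * s) * w f s else -w (R μ f) 0 with hG
  have hGl : ∀ μ : ℂ, μ.re < 0 → G μ = ∫ s in Iic (0 : ℝ), Complex.exp (-μ * s) * w f s := by
    intro μ hμ
    by_cases h : μ.re < -(1 / 4)
    · simp only [hG, if_pos h]
    · rw [hstrip μ (by linarith) hμ]; simp only [hG, if_neg h]
  have hGr : ∀ μ : ℂ, -(1 / 2) < μ.re → G μ = -w (R μ f) 0 := by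
    intro μ hμ
    by_cases h : μ.re < -(1 / 4)
    · rw [← hstrip μ hμ (by linarith)]; simp only [hG, if_pos h]
    · simp only [hG, if_neg h]
  have hGd : Differentiable ℂ G := by
    intro μ
    rcases lt_or_ge μ.re (-(1 / 4)) with h | h
    · refine (hasDerivAt_laplace_neg hWm hM (by linarith)).congr_of_eventuallyEq ?_
      filter_upwards [Complex.continuous_re.continuousAt.eventually_lt_const
        (show μ.re < 0 by linarith)] with ν hν using hGl ν hν
    · have := resolvent_functional_hasDerivAt (ℓ := fun y => w y 0) hC
        (fun y z hy hz => hsub y z hy hz 0) (fun c y hy => hsmul c y hy 0)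
        (fun y hy => hb y hy 0 le_rfl) hR hf (ν := μ) (by linarith)
      refine this.differentiableAt.neg.congr_of_eventuallyEq ?_
      filter_upwards [Complex.continuous_re.continuousAt.eventually_const_lt
        (show -(1 / 2) < μ.re by linarith)] with ν hν using hGr ν hν
  have hGb : ∀ (μ : ℂ) (κ : ℝ), -(1 / 2) < μ.re → 0 < κ → κ ≤ 1 + μ.re → κ ≤ 1 + 2 * μ.re →
      ‖G μ‖ ≤ Real.sqrt (C * (4 * ∫ x in (0 : ℝ)..1, ‖f x‖ ^ 2)) / κ := by
    intro μ κ h0 h1 h2 h3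
    obtain ⟨r1, r2⟩ := hR μ h0 f hf
    have e := r1.estimate h1 h2 h3
    simp only [r2] at e
    rw [hGr μ h0, norm_neg, le_div_iff₀ h1]
    refine Real.le_sqrt_of_sq_le ?_
    rw [mul_pow]
    have h4 := mul_le_mul_of_nonneg_right (hb _ r1.smooth.continuous 0 le_rfl) (sq_nonneg κ)
    nlinarith [mul_le_mul_of_nonneg_left e hC]
  have hbdd : Bornology.IsBounded (range G) := by
    have hM0 : 0 ≤ M := (norm_nonneg _).trans (hM 0 le_rfl)
    refine isBounded_iff_forall_norm_le.2 ⟨max (4 * M)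
      (Real.sqrt (C * (4 * ∫ x in (0 : ℝ)..1, ‖f x‖ ^ 2)) / (1 / 2)), ?_⟩
    rintro _ ⟨μ, rfl⟩
    rcases lt_or_ge μ.re (-(1 / 4)) with h | h
    · refine le_trans ?_ (le_max_left _ _)
      rw [hGl μ (by linarith)]
      calc ‖∫ s in Iic (0 : ℝ), Complex.exp (-μ * s) * w f s‖
          ≤ ∫ s in Iic (0 : ℝ), Real.exp (1 / 4 * s) * M := by
            refine norm_integral_le_of_norm_le
              ((integrableOn_exp_mul_Iic (by norm_num) 0).mul_const M) ?_
            filter_upwards [ae_restrict_mem measurableSet_Iic] with s hs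
            have hs' : s ≤ 0 := hs
            rw [norm_mul, Complex.norm_exp]
            refine mul_le_mul ?_ (hM s hs) (norm_nonneg _) (Real.exp_pos _).le
            rw [Real.exp_le_exp]
            simp only [Complex.neg_re, Complex.mul_re, Complex.ofReal_re, Complex.ofReal_im,
              mul_zero, sub_zero]
            nlinarith
        _ = 4 * M := by
            rw [integral_mul_const, integral_exp_mul_Iic (by norm_num)]
            norm_num
    · exact (hGb μ (1 / 2) (by linarith) (by norm_num) (by linarith) (by linarith)).trans
        (le_max_right _ _)
  -- At `μ = n` the gap `κ = n + 1` is admissible, so the resolvent bound decays.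
  have hlim : Tendsto (fun n : ℕ => G n) atTop (𝓝 0) := by
    rw [tendsto_zero_iff_norm_tendsto_zero]
    refine squeeze_zero (g := fun n : ℕ =>
      Real.sqrt (C * (4 * ∫ x in (0 : ℝ)..1, ‖f x‖ ^ 2)) / ((n : ℝ) + 1))
      (fun _ => norm_nonneg _) (fun n => ?_) ?_
    · refine hGb n (n + 1) ?_ (by positivity) ?_ ?_ <;> simp only [Complex.natCast_re] <;>
        linarith [(Nat.cast_nonneg n : (0 : ℝ) ≤ n)]
    · exact tendsto_const_nhds.div_atTop
        (tendsto_atTop_add_const_right _ _ tendsto_natCast_atTop_atTop)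
  have hG0 : G 0 = 0 := by
    have : ∀ n : ℕ, G n = G 0 := fun n => hGd.apply_eq_apply_of_bounded hbdd _ _
    simp only [this] at hlim
    exact tendsto_nhds_unique tendsto_const_nhds hlim
  have h0 : -(1 / 2) < (0 : ℂ).re := by norm_num
  rw [hGr 0 h0, neg_eq_zero] at hG0
  obtain ⟨r1, r2⟩ := hR 0 h0 f hf
  -- With equal parameters the Lipschitz bound is zero, so `y₀` and the chosen `R 0 f` have the same
  -- functional value.
  have := resolvent_functional_lipschitz (ℓ := fun y => w y 0) (μ := 0) (ν := 0) hC
    (fun y z hy hz => hsub y z hy hz 0) (fun y hy => hb y hy 0 le_rfl) one_pos (by simp) (by simp)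
    hy₀ r1 (g := f) (fun x => by rw [hfdef]; ring) r2
  simpa [hG0] using this

end Liouville

/-! ### Square-integrable pairings and separated test functions. -/

lemma norm_integral_mul_sq_le {α : Type*} [MeasurableSpace α] {μ : Measure α} {f g : α → ℂ}
    (hf : MemLp f 2 μ) (hg : MemLp g 2 μ) :
    ‖∫ a, f a * g a ∂μ‖ ^ 2 ≤ (∫ a, ‖f a‖ ^ 2 ∂μ) * ∫ a, ‖g a‖ ^ 2 ∂μ := by
  have h2 : ENNReal.ofReal 2 = 2 := by norm_num
  have h := integral_mul_le_Lp_mul_Lq_of_nonneg (μ := μ) (p := 2) (q := 2)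
    Real.HolderConjugate.two_two (f := fun a => ‖f a‖) (g := fun a => ‖g a‖)
    (Eventually.of_forall fun _ => norm_nonneg _) (Eventually.of_forall fun _ => norm_nonneg _)
    (by rw [h2]; exact hf.norm) (by rw [h2]; exact hg.norm)
  have h1 : ‖∫ a, f a * g a ∂μ‖ ≤ ∫ a, ‖f a‖ * ‖g a‖ ∂μ := by
    refine (norm_integral_le_integral_norm _).trans_eq ?_
    simp only [norm_mul]
  have e : ∀ u : α → ℂ, ((∫ a, ‖u a‖ ^ (2 : ℝ) ∂μ) ^ (1 / (2 : ℝ))) ^ 2 = ∫ a, ‖u a‖ ^ 2 ∂μ := by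
    intro u
    have h0 : 0 ≤ ∫ a, ‖u a‖ ^ 2 ∂μ := integral_nonneg fun _ => sq_nonneg _
    simp only [Real.rpow_two]
    rw [← Real.sqrt_eq_rpow, Real.sq_sqrt h0]
  rw [← e f, ← e g, ← mul_pow]
  exact pow_le_pow_left₀ (norm_nonneg _) (h1.trans h) 2

lemma memLp_prod_mul {α β : Type*} [MeasurableSpace α] [MeasurableSpace β] {μ : Measure α}
    {ν : Measure β} [SFinite μ] [SFinite ν] {f : α → ℂ} {g : β → ℂ} (hf : MemLp f 2 μ)
    (hg : MemLp g 2 ν) : MemLp (fun p : α × β => f p.1 * g p.2) 2 (μ.prod ν) := by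
  have hm : AEStronglyMeasurable (fun p : α × β => f p.1 * g p.2) (μ.prod ν) :=
    hf.1.comp_fst.mul hg.1.comp_snd
  rw [memLp_two_iff_integrable_sq_norm hm]
  simp only [norm_mul, mul_pow]
  exact ((memLp_two_iff_integrable_sq_norm hf.1).1 hf).mul_prod
    ((memLp_two_iff_integrable_sq_norm hg.1).1 hg)

lemma memLp_of_continuous_Ioo {y : ℝ → ℂ} (hy : Continuous y) :
    MemLp y 2 (volume.restrict (Ioo (0 : ℝ) 1)) := by
  rw [memLp_two_iff_integrable_sq_norm hy.aestronglyMeasurable]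
  exact ((hy.norm.pow 2).integrableOn_Icc (a := 0) (b := 1)).mono_set Ioo_subset_Icc_self

lemma iteratedDeriv_re {y : ℝ → ℂ} (hy : ContDiff ℝ ∞ y) (k : ℕ) (x : ℝ) :
    iteratedDeriv k (fun x => (y x).re) x = (iteratedDeriv k y x).re := by
  induction k generalizing x with
  | zero => simp
  | succ k ih =>
    rw [iteratedDeriv_succ, iteratedDeriv_succ, funext ih]
    have h : HasDerivAt (iteratedDeriv k y) (deriv (iteratedDeriv k y) x) x :=
      ((hy.differentiable_iteratedDeriv k (by exact_mod_cast WithTop.coe_lt_top _)) x).hasDerivAt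
    exact (Complex.reCLM.hasFDerivAt.comp_hasDerivAt x h).deriv

/-- Adjoint data can be cut off outside of a neighbourhood of the unit interval. -/
lemma AdjDomain.exists_hasCompactSupport {y : ℝ → ℂ} (hy : AdjDomain y) :
    ∃ z, AdjDomain z ∧ HasCompactSupport z ∧
      ∀ x ∈ Icc (0 : ℝ) 1, z x = y x ∧ adjOp z x = adjOp y x := by
  let χ : ContDiffBump (1 / 2 : ℝ) := ⟨1, 2, one_pos, one_lt_two⟩
  have hev : ∀ x ∈ Icc (0 : ℝ) 1, (fun x => (χ x : ℂ) * y x) =ᶠ[𝓝 x] y := by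
    intro x hx
    have : Metric.closedBall (1 / 2 : ℝ) 1 ∈ 𝓝 x := by
      rw [Real.closedBall_eq_Icc]
      exact Icc_mem_nhds (by linarith [hx.1]) (by linarith [hx.2])
    filter_upwards [this] with u hu
    rw [χ.one_of_mem_closedBall hu, Complex.ofReal_one, one_mul]
  have hd : ∀ (k : ℕ), ∀ x ∈ Icc (0 : ℝ) 1,
      iteratedDeriv k (fun x => (χ x : ℂ) * y x) x = iteratedDeriv k y x :=
    fun k x hx => (hev x hx).iteratedDeriv_eq k
  have h0 : (0 : ℝ) ∈ Icc (0 : ℝ) 1 := by simp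
  have h1 : (1 : ℝ) ∈ Icc (0 : ℝ) 1 := by simp
  refine ⟨fun x => (χ x : ℂ) * y x, ⟨(Complex.ofRealCLM.contDiff.comp χ.contDiff).mul hy.smooth,
    ?_, ?_, ?_⟩, ?_, fun x hx => ⟨(hev x hx).eq_of_nhds, ?_⟩⟩
  · exact (hev 0 h0).eq_of_nhds.trans hy.left
  · rw [hd 1 0 h0]; exact hy.left_deriv
  · rw [hd 2 1 h1, (hev 1 h1).eq_of_nhds]; exact hy.right
  · exact (χ.hasCompactSupport.comp_left (g := fun r : ℝ => (r : ℂ)) (by simp)).mul_right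
  · rw [adjOp, adjOp, hd 1 x hx, hd 3 x hx]

/-- Test functions are real, so a complex adjoint profile enters through its real part; compact
support in `x` is arranged beforehand by a cutoff. -/
lemma isTest_re_mul {y : ℝ → ℂ} (hy : AdjDomain y) (hyc : HasCompactSupport y) {θ : ℝ → ℝ}
    (hθ : ContDiff ℝ ∞ θ) (hθc : HasCompactSupport θ) :
    IsTest (fun p : ℝ × ℝ => (y p.1).re * θ p.2) ∧
      ∀ p : ℝ × ℝ, dt (fun p : ℝ × ℝ => (y p.1).re * θ p.2) p
        + dx 1 (fun p : ℝ × ℝ => (y p.1).re * θ p.2) p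
        + dx 3 (fun p : ℝ × ℝ => (y p.1).re * θ p.2) p =
      (y p.1 * ((deriv θ p.2 : ℝ) : ℂ) + adjOp y p.1 * (θ p.2 : ℂ)).re := by
  have hdx : ∀ (k : ℕ) (p : ℝ × ℝ), dx k (fun p : ℝ × ℝ => (y p.1).re * θ p.2) p =
      (iteratedDeriv k y p.1).re * θ p.2 := by
    intro k p
    rw [← iteratedDeriv_re hy.smooth]
    exact iteratedDeriv_mul_const_field (fun x => (y x).re) (θ p.2)
  refine ⟨⟨?_, ?_, fun t => ?_, fun t => ?_, fun t => ?_⟩, fun p => ?_⟩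
  · exact (Complex.reCLM.contDiff.comp (hy.smooth.comp contDiff_fst)).mul (hθ.comp contDiff_snd)
  · refine HasCompactSupport.of_support_subset_isCompact (hyc.isCompact.prod hθc.isCompact) ?_
    intro p hp
    rw [Function.mem_support] at hp
    refine ⟨subset_tsupport _ ?_, subset_tsupport _ (right_ne_zero_of_mul hp)⟩
    intro h
    exact left_ne_zero_of_mul hp (by rw [h]; rfl)
  · simp [hy.left]
  · simp only [hdx, hy.left_deriv, Complex.zero_re, zero_mul]
  · have := congrArg Complex.re hy.right
    simp only [hdx, Complex.add_re, Complex.zero_re] at this ⊢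
    rw [← add_mul, this, zero_mul]
  · have hdt : dt (fun p : ℝ × ℝ => (y p.1).re * θ p.2) p = (y p.1).re * deriv θ p.2 := by
      exact (((hθ.differentiable (by simp)) p.2).hasDerivAt.const_mul (y p.1).re).deriv
    rw [hdx, hdx, hdt]
    simp only [adjOp, Complex.add_re, Complex.mul_re, Complex.ofReal_re, Complex.ofReal_im,
      mul_zero, sub_zero]
    ring

lemma volume_restrict_prod (s t : Set ℝ) :
    (volume : Measure (ℝ × ℝ)).restrict (s ×ˢ t) = (volume.restrict s).prod (volume.restrict t) := by
  rw [Measure.volume_eq_prod, Measure.prod_restrict]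

/-- Compactness leaves a gap before `T`, and the gap survives translations to the left. -/
lemma exists_lt_of_tsupport_subset {T : ℝ} {θ : ℝ → ℝ} (hθ : HasCompactSupport θ)
    (hs : tsupport θ ⊆ Iio T) : ∃ T' < T, ∀ s, T' ≤ s → θ s = 0 := by
  rcases (tsupport θ).eq_empty_or_nonempty with h | h
  · exact ⟨T - 1, by linarith, fun s _ => image_eq_zero_of_notMem_tsupport (by simp [h])⟩
  · obtain ⟨m, hm, hm'⟩ := hθ.isCompact.exists_isGreatest h
    obtain ⟨T', h1, h2⟩ := exists_between (mem_Iio.1 (hs hm))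
    exact ⟨T', h2, fun s hs' => image_eq_zero_of_notMem_tsupport fun h' =>
      absurd (hm' h') (by linarith)⟩

/-! ### Homogeneous weak solutions as transported functionals. -/

section Homogeneous

variable {T : ℝ} {v : ℝ × ℝ → ℝ}

lemma memLp_of_continuous_hasCompactSupport {θ : ℝ → ℝ} (hθ : Continuous θ)
    (hc : HasCompactSupport θ) : MemLp (fun s => (θ s : ℂ)) 2 (volume : Measure ℝ) :=
  (hθ.memLp_of_hasCompactSupport hc).ofReal

lemma memLp_separated {y : ℝ → ℂ} (hy : Continuous y) {θ : ℝ → ℂ} (hθ : MemLp θ 2) (S : Set ℝ) :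
    MemLp (fun p : ℝ × ℝ => y p.1 * θ p.2) 2 (volume.restrict (Ioo (0 : ℝ) 1 ×ˢ S)) := by
  rw [volume_restrict_prod]
  exact memLp_prod_mul (memLp_of_continuous_Ioo hy) (hθ.mono_measure Measure.restrict_le_self)

lemma integrable_separated {S : Set ℝ}
    (hv : MemLp v 2 (volume.restrict (Ioo (0 : ℝ) 1 ×ˢ S))) {y : ℝ → ℂ} (hy : Continuous y)
    {θ : ℝ → ℂ} (hθ : MemLp θ 2) :
    IntegrableOn (fun p : ℝ × ℝ => (v p : ℂ) * (y p.1 * θ p.2)) (Ioo (0 : ℝ) 1 ×ˢ S) :=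
  MemLp.integrable_mul (p := 2) (q := 2) hv.ofReal (memLp_separated hy hθ S)

/-- The real part is the weak identity for `Re y · θ`; the imaginary part is the same identity for
the profile `-i y`. -/
lemma complex_identity (hv : MemLp v 2 (volume.restrict (Ioo (0 : ℝ) 1 ×ˢ Iio T)))
    (hid : ∀ φ, IsTest φ → (∃ T' < T, ∀ p : ℝ × ℝ, T' ≤ p.2 → φ p = 0) →
      ∫ p in Ioo (0 : ℝ) 1 ×ˢ Iio T, v p * (dt φ p + dx 1 φ p + dx 3 φ p) = 0)
    {y : ℝ → ℂ} (hy : AdjDomain y) {θ : ℝ → ℝ} (hθ : ContDiff ℝ ∞ θ) (hθc : HasCompactSupport θ)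
    (hT : ∃ T' < T, ∀ s, T' ≤ s → θ s = 0) :
    (∫ p in Ioo (0 : ℝ) 1 ×ˢ Iio T, (v p : ℂ) * (y p.1 * ((deriv θ p.2 : ℝ) : ℂ))) +
      ∫ p in Ioo (0 : ℝ) 1 ×ˢ Iio T, (v p : ℂ) * (adjOp y p.1 * (θ p.2 : ℂ)) = 0 := by
  have hm : MeasurableSet (Ioo (0 : ℝ) 1 ×ˢ Iio T) := measurableSet_Ioo.prod measurableSet_Iio
  have hθ2 := memLp_of_continuous_hasCompactSupport hθ.continuous hθc
  have hθ2' := memLp_of_continuous_hasCompactSupport (hθ.continuous_deriv (by simp)) hθc.deriv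
  have hint : ∀ {y : ℝ → ℂ}, AdjDomain y → IntegrableOn (fun p : ℝ × ℝ =>
      (v p : ℂ) * (y p.1 * ((deriv θ p.2 : ℝ) : ℂ) + adjOp y p.1 * (θ p.2 : ℂ)))
      (Ioo (0 : ℝ) 1 ×ˢ Iio T) := by
    intro y hy
    simp only [mul_add]
    exact (integrable_separated hv hy.smooth.continuous hθ2').add
      (integrable_separated hv hy.contDiff_adjOp.continuous hθ2)
  have hre : ∀ {y : ℝ → ℂ}, AdjDomain y → (∫ p in Ioo (0 : ℝ) 1 ×ˢ Iio T,
      (v p : ℂ) * (y p.1 * ((deriv θ p.2 : ℝ) : ℂ) + adjOp y p.1 * (θ p.2 : ℂ))).re = 0 := by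
    intro y hy
    obtain ⟨z, hz, hzc, hzy⟩ := hy.exists_hasCompactSupport
    obtain ⟨t1, t2⟩ := isTest_re_mul hz hzc hθ hθc
    obtain ⟨T', hT', h0⟩ := hT
    have := hid _ t1 ⟨T', hT', fun p hp => by rw [h0 p.2 hp, mul_zero]⟩
    refine Eq.trans ?_ this
    refine (Complex.reCLM.integral_comp_comm (hint hy)).symm.trans ?_
    refine setIntegral_congr_fun hm fun p hp => ?_
    simp only [Complex.reCLM_apply, Complex.re_ofReal_mul]
    obtain ⟨e1, e2⟩ := hzy p.1 ⟨hp.1.1.le, hp.1.2.le⟩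
    rw [t2, e1, e2]
  rw [← integral_add (integrable_separated hv hy.smooth.continuous hθ2')
    (integrable_separated hv hy.contDiff_adjOp.continuous hθ2)]
  simp only [← mul_add]
  refine Complex.ext (hre hy) ?_
  obtain ⟨k1, k2⟩ := hy.const_mul (-Complex.I)
  have h := hre k1
  have e : ∀ p : ℝ × ℝ, (v p : ℂ) * (-Complex.I * y p.1 * ((deriv θ p.2 : ℝ) : ℂ) +
      adjOp (fun x => -Complex.I * y x) p.1 * (θ p.2 : ℂ)) =
      -Complex.I * ((v p : ℂ) * (y p.1 * ((deriv θ p.2 : ℝ) : ℂ) + adjOp y p.1 * (θ p.2 : ℂ))) := by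
    intro p; rw [k2]; ring
  simp only [e, integral_const_mul] at h
  simpa using h

/-- The shift acts only on the smooth factor `θ`, so no time regularity of `v` is needed. Shifts by
less than one keep the support of `θ'` inside one ball, whose indicator dominates. -/
lemma hasDerivAt_translated (hv : MemLp v 2 (volume.restrict (Ioo (0 : ℝ) 1 ×ˢ Iio T)))
    {y : ℝ → ℂ} (hy : Continuous y) {θ : ℝ → ℝ} (hθ : ContDiff ℝ ∞ θ) (hθc : HasCompactSupport θ)
    (t₀ : ℝ) :
    HasDerivAt (fun t => ∫ p in Ioo (0 : ℝ) 1 ×ˢ Iio T, (v p : ℂ) * (y p.1 * (θ (p.2 - t) : ℂ)))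
      (-∫ p in Ioo (0 : ℝ) 1 ×ˢ Iio T, (v p : ℂ) * (y p.1 * ((deriv θ (p.2 - t₀) : ℝ) : ℂ))) t₀ := by
  have hvc := hv.ofReal (K := ℂ)
  have hθ' : Continuous (deriv θ) := hθ.continuous_deriv (by simp)
  obtain ⟨B, hB⟩ := hθ'.bounded_above_of_compact_support hθc.deriv
  obtain ⟨r, hr⟩ := hθc.deriv.isCompact.isBounded.subset_closedBall 0
  set K := Metric.closedBall t₀ (r + 1)
  have hK : MemLp (K.indicator fun _ : ℝ => (B : ℂ)) 2 (volume : Measure ℝ) :=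
    memLp_indicator_const 2 Metric.isClosed_closedBall.measurableSet _
      (Or.inr (isCompact_closedBall t₀ (r + 1)).measure_lt_top.ne)
  have hθt : ∀ t, MemLp (fun s => (θ (s - t) : ℂ)) 2 (volume : Measure ℝ) := fun t =>
    memLp_of_continuous_hasCompactSupport (θ := fun s => θ (s - t))
      (hθ.continuous.comp (by fun_prop)) (hθc.comp_homeomorph (Homeomorph.subRight t))
  have := hasDerivAt_integral_of_dominated_loc_of_deriv_le (𝕜 := ℝ)
    (μ := volume.restrict (Ioo (0 : ℝ) 1 ×ˢ Iio T))
    (F := fun t p => (v p : ℂ) * (y p.1 * (θ (p.2 - t) : ℂ)))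
    (F' := fun t p => -((v p : ℂ) * (y p.1 * ((deriv θ (p.2 - t) : ℝ) : ℂ)))) (x₀ := t₀)
    (bound := fun p => ‖(v p : ℂ) * (y p.1 * (K.indicator (fun _ : ℝ => (B : ℂ)) p.2))‖)
    (Metric.ball_mem_nhds t₀ one_pos) ?_ ?_ ?_ ?_ ?_ ?_
  · rw [← integral_neg]
    exact this.2
  · exact Eventually.of_forall fun t => (integrable_separated hv hy (hθt t)).aestronglyMeasurable
  · exact integrable_separated hv hy (hθt t₀)
  · exact (hvc.1.mul (Continuous.aestronglyMeasurable (by fun_prop))).neg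
  · refine Eventually.of_forall fun p t ht => ?_
    rw [norm_neg, norm_mul, norm_mul, norm_mul, norm_mul]
    refine mul_le_mul_of_nonneg_left (mul_le_mul_of_nonneg_left ?_ (norm_nonneg _)) (norm_nonneg _)
    rw [Complex.norm_real]
    by_cases hp : p.2 - t ∈ tsupport (deriv θ)
    · have h1 := mem_closedBall_zero_iff.1 (hr hp)
      have h2 := mem_ball_iff_norm.1 ht
      have h3 : p.2 ∈ K := by
        rw [mem_closedBall_iff_norm]
        calc ‖p.2 - t₀‖ = ‖(p.2 - t) + (t - t₀)‖ := by ring_nf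
          _ ≤ r + 1 := (norm_add_le _ _).trans (add_le_add h1 h2.le)
      rw [indicator_of_mem h3, Complex.norm_real]
      exact (hB _).trans (le_abs_self B)
    · rw [image_eq_zero_of_notMem_tsupport hp, norm_zero]
      exact norm_nonneg _
  · exact (integrable_separated hv hy hK).norm
  · refine Eventually.of_forall fun p t _ => ?_
    have h1 : HasDerivAt (fun t => θ (p.2 - t)) (-deriv θ (p.2 - t)) t :=
      ((hθ.differentiable (by simp)) (p.2 - t)).hasDerivAt.comp_const_sub p.2 t
    have h2 := (h1.ofReal_comp.const_mul (y p.1)).const_mul (v p : ℂ)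
    exact h2.congr_deriv (by push_cast; ring)

/-- Shifting `θ` by `t ≤ 0` keeps the test function admissible, so the weak identity becomes the
transport equation of `functional_eq_zero`. Cauchy–Schwarz bounds the orbit uniformly, since a shift
preserves the norm of `θ`. -/
lemma separated_eq_zero (hv : MemLp v 2 (volume.restrict (Ioo (0 : ℝ) 1 ×ˢ Iio T)))
    (hid : ∀ φ, IsTest φ → (∃ T' < T, ∀ p : ℝ × ℝ, T' ≤ p.2 → φ p = 0) →
      ∫ p in Ioo (0 : ℝ) 1 ×ˢ Iio T, v p * (dt φ p + dx 1 φ p + dx 3 φ p) = 0)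
    {y : ℝ → ℂ} (hy : AdjDomain y) {θ : ℝ → ℝ} (hθ : ContDiff ℝ ∞ θ) (hθc : HasCompactSupport θ)
    (hT : tsupport θ ⊆ Iio T) :
    ∫ p in Ioo (0 : ℝ) 1 ×ˢ Iio T, (v p : ℂ) * (y p.1 * (θ p.2 : ℂ)) = 0 := by
  obtain ⟨T', hT', h0⟩ := exists_lt_of_tsupport_subset hθc hT
  have hθt : ∀ t, MemLp (fun s => (θ (s - t) : ℂ)) 2 (volume : Measure ℝ) := fun t =>
    memLp_of_continuous_hasCompactSupport (θ := fun s => θ (s - t))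
      (hθ.continuous.comp (by fun_prop)) (hθc.comp_homeomorph (Homeomorph.subRight t))
  set w : (ℝ → ℂ) → ℝ → ℂ := fun y t =>
    ∫ p in Ioo (0 : ℝ) 1 ×ˢ Iio T, (v p : ℂ) * (y p.1 * (θ (p.2 - t) : ℂ)) with hw
  set V := ∫ p in Ioo (0 : ℝ) 1 ×ˢ Iio T, ‖(v p : ℂ)‖ ^ 2
  set Θ := ∫ s, ‖(θ s : ℂ)‖ ^ 2
  have hV : 0 ≤ V := integral_nonneg fun _ => sq_nonneg _
  have hΘ : 0 ≤ Θ := integral_nonneg fun _ => sq_nonneg _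
  have := functional_eq_zero (w := w) (C := V * Θ) (mul_nonneg hV hΘ) ?_ ?_ ?_ ?_ hy
  · simpa [hw] using this
  · intro y z hy hz t
    have := integral_sub (integrable_separated hv hy (hθt t)) (integrable_separated hv hz (hθt t))
    refine Eq.trans ?_ this
    refine integral_congr_ae (Eventually.of_forall fun p => ?_)
    dsimp only
    ring
  · intro c y hy t
    refine Eq.trans ?_ (integral_const_mul c _)
    refine integral_congr_ae (Eventually.of_forall fun p => ?_)
    dsimp only
    ring
  · intro y hy t _
    refine (norm_integral_mul_sq_le hv.ofReal (memLp_separated hy (hθt t) _)).trans ?_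
    rw [mul_assoc]
    refine mul_le_mul_of_nonneg_left ?_ hV
    rw [volume_restrict_prod]
    simp only [norm_mul, mul_pow]
    rw [integral_prod_mul (fun x => ‖y x‖ ^ 2) (fun s => ‖(θ (s - t) : ℂ)‖ ^ 2),
      intervalIntegral.integral_of_le zero_le_one, ← integral_Ioc_eq_integral_Ioo, mul_comm]
    refine mul_le_mul_of_nonneg_right ?_ (integral_nonneg fun _ => sq_nonneg _)
    refine (setIntegral_le_integral
      ((memLp_two_iff_integrable_sq_norm (hθt t).1).1 (hθt t))
      (Eventually.of_forall fun _ => sq_nonneg _)).trans_eq ?_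
    exact integral_sub_right_eq_self (fun s => ‖(θ s : ℂ)‖ ^ 2) t
  · intro y hy t ht
    refine (hasDerivAt_translated hv hy.smooth.continuous hθ hθc t).congr_deriv ?_
    have := complex_identity hv hid hy (θ := fun s => θ (s - t))
      (hθ.comp (contDiff_id.sub contDiff_const)) (hθc.comp_homeomorph (Homeomorph.subRight t))
      ⟨T', hT', fun s hs => h0 _ (by linarith)⟩
    have e : ∀ s, deriv (fun s => θ (s - t)) s = deriv θ (s - t) := fun s =>
      deriv_comp_sub_const θ t s
    simp only [e] at this
    rw [neg_eq_iff_add_eq_zero]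
    exact this

end Homogeneous

/-! ### Moments of the time slices and uniqueness. -/

lemma derivChain_polynomial (P : Polynomial ℂ) :
    DerivChain (fun x => P.eval (x : ℂ)) (fun x => P.derivative.eval (x : ℂ))
      (fun x => P.derivative.derivative.eval (x : ℂ))
      (fun x => P.derivative.derivative.derivative.eval (x : ℂ)) :=
  ⟨fun x => (P.hasDerivAt x).comp_ofReal, fun x => (P.derivative.hasDerivAt x).comp_ofReal,
    fun x => (P.derivative.derivative.hasDerivAt x).comp_ofReal, by fun_prop⟩

/-- A double zero at `0` and a triple zero at `1` enforce all adjoint conditions, and the free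
factor `x^k` still gives every moment. -/
lemma adjDomain_polynomial (k : ℕ) :
    AdjDomain (fun x : ℝ => (x : ℂ) ^ 2 * (1 - x) ^ 3 * x ^ k) := by
  set P : Polynomial ℂ := Polynomial.X ^ 2 * (1 - Polynomial.X) ^ 3 * Polynomial.X ^ k with hP
  have e : (fun x : ℝ => (x : ℂ) ^ 2 * (1 - x) ^ 3 * x ^ k) = fun x : ℝ => P.eval (x : ℂ) := by
    ext x; simp [hP]
  rw [e]
  obtain ⟨d1, d2, -⟩ := (derivChain_polynomial P).iteratedDeriv_eq
  refine ⟨?_, by simp [hP], ?_, ?_⟩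
  · rw [← e]
    have : ContDiff ℝ ∞ (fun x : ℝ => (x : ℂ)) := Complex.ofRealCLM.contDiff
    exact ((this.pow 2).mul ((contDiff_const.sub this).pow 3)).mul (this.pow k)
  · rw [d1]; simp [hP, Polynomial.derivative_mul, Polynomial.derivative_pow]
  · rw [d2]; simp [hP, Polynomial.derivative_mul, Polynomial.derivative_pow]

/-- The moment problem on the unit interval is determinate. -/
lemma ae_eq_zero_of_moments {u : ℝ → ℂ} (hu : IntegrableOn u (Ioo 0 1))
    (hm : ∀ k : ℕ, ∫ x in Ioo (0 : ℝ) 1, u x * (x : ℂ) ^ k = 0) :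
    ∀ᵐ x, x ∈ Ioo (0 : ℝ) 1 → u x = 0 := by
  have hbd : ∀ g : ℝ → ℝ, Continuous g → IntegrableOn (fun x => u x * (g x : ℂ)) (Ioo 0 1) := by
    intro g hg
    obtain ⟨C, hC⟩ := (isCompact_Icc (a := (0 : ℝ)) (b := 1)).exists_bound_of_continuousOn
      hg.continuousOn
    refine hu.mul_bdd (c := C) (Continuous.aestronglyMeasurable (by fun_prop)) ?_
    filter_upwards [ae_restrict_mem measurableSet_Ioo] with x hx
    rw [Complex.norm_real]
    exact hC x ⟨hx.1.le, hx.2.le⟩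
  have hpoly : ∀ p : Polynomial ℝ, ∫ x in Ioo (0 : ℝ) 1, u x * ((p.eval x : ℝ) : ℂ) = 0 := by
    intro p
    induction p using Polynomial.induction_on' with
    | add p q hp hq =>
      simp only [Polynomial.eval_add, Complex.ofReal_add, mul_add]
      rw [integral_add (hbd _ p.continuous) (hbd _ q.continuous), hp, hq, add_zero]
    | monomial n a =>
      have : ∀ x : ℝ, u x * ((((Polynomial.monomial n) a).eval x : ℝ) : ℂ) =
          (a : ℂ) * (u x * (x : ℂ) ^ n) := by
        intro x
        rw [Polynomial.eval_monomial]; push_cast; ring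
      simp only [this]
      rw [integral_const_mul, hm, mul_zero]
  have hcont : ∀ g : ℝ → ℝ, Continuous g → ∫ x in Ioo (0 : ℝ) 1, u x * (g x : ℂ) = 0 := by
    intro g hg
    set N := ∫ x in Ioo (0 : ℝ) 1, ‖u x‖
    have hN : 0 ≤ N := integral_nonneg fun _ => norm_nonneg _
    have key : ∀ ε > 0, ‖∫ x in Ioo (0 : ℝ) 1, u x * (g x : ℂ)‖ ≤ N * ε := by
      intro ε hε
      obtain ⟨p, hp⟩ := exists_polynomial_near_of_continuousOn 0 1 g hg.continuousOn ε hε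
      have : ∫ x in Ioo (0 : ℝ) 1, u x * (g x : ℂ) =
          ∫ x in Ioo (0 : ℝ) 1, (u x * (g x : ℂ) - u x * ((p.eval x : ℝ) : ℂ)) := by
        rw [integral_sub (hbd g hg) (hbd _ p.continuous), hpoly, sub_zero]
      rw [this, ← integral_mul_const]
      refine norm_integral_le_of_norm_le (hu.norm.mul_const ε) ?_
      filter_upwards [ae_restrict_mem measurableSet_Ioo] with x hx
      rw [← mul_sub, norm_mul, ← Complex.ofReal_sub, Complex.norm_real, norm_sub_rev]
      exact mul_le_mul_of_nonneg_left (hp x ⟨hx.1.le, hx.2.le⟩).le (norm_nonneg _)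
    rw [← norm_le_zero_iff]
    refine le_of_forall_pos_le_add fun ε hε => ?_
    refine (key (ε / (N + 1)) (by positivity)).trans ?_
    rw [zero_add, mul_div_assoc', div_le_iff₀ (by positivity)]
    nlinarith
  refine isOpen_Ioo.ae_eq_zero_of_integral_contDiff_smul_eq_zero hu.locallyIntegrableOn
    fun g hg _ hgs => ?_
  rw [← hcont g hg.continuous, setIntegral_eq_integral_of_forall_compl_eq_zero]
  · refine integral_congr_ae (Eventually.of_forall fun x => ?_)
    simp only [Complex.real_smul]
    ring
  · intro x hx
    rw [image_eq_zero_of_notMem_tsupport fun h => hx (hgs h)]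
    simp

/-- Uniqueness: a square integrable weak solution on `(0, 1) × (-∞, T)` of the problem with
homogeneous boundary conditions vanishes. -/
theorem ae_eq_zero_of_homogeneous {T : ℝ} {v : ℝ × ℝ → ℝ}
    (hv : MemLp v 2 (volume.restrict (Ioo (0 : ℝ) 1 ×ˢ Iio T)))
    (hid : ∀ φ, IsTest φ → (∃ T' < T, ∀ p : ℝ × ℝ, T' ≤ p.2 → φ p = 0) →
      ∫ p in Ioo (0 : ℝ) 1 ×ˢ Iio T, v p * (dt φ p + dx 1 φ p + dx 3 φ p) = 0) :
    ∀ᵐ p ∂(volume.restrict (Ioo (0 : ℝ) 1 ×ˢ Iio T)), v p = 0 := by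
  set y : ℕ → ℝ → ℂ := fun k x => (x : ℂ) ^ 2 * (1 - x) ^ 3 * x ^ k
  have hy : ∀ k, AdjDomain (y k) := adjDomain_polynomial
  set V : ℕ → ℝ → ℂ := fun k s => ∫ x in Ioo (0 : ℝ) 1, (v (x, s) : ℂ) * y k x with hV
  have hVloc : ∀ k, LocallyIntegrableOn (V k) (Iio T) := by
    intro k
    rw [locallyIntegrableOn_iff isOpen_Iio.isLocallyClosed]
    intro K hKT hK
    have hind : MemLp (K.indicator fun _ : ℝ => (1 : ℂ)) 2 (volume : Measure ℝ) :=
      memLp_indicator_const 2 hK.measurableSet _ (Or.inr hK.measure_lt_top.ne)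
    have h1 := integrable_separated hv (hy k).smooth.continuous hind
    rw [IntegrableOn, volume_restrict_prod] at h1
    have h2 := h1.integral_prod_right
    have e : (fun s => ∫ x in Ioo (0 : ℝ) 1,
        (v (x, s) : ℂ) * (y k x * K.indicator (fun _ : ℝ => (1 : ℂ)) s)) = K.indicator (V k) := by
      ext s
      by_cases hs : s ∈ K
      · simp [hs, hV]
      · simp [hs]
    simp only [e] at h2
    rw [integrable_indicator_iff hK.measurableSet, IntegrableOn, Measure.restrict_restrict
      hK.measurableSet, inter_eq_left.2 hKT] at h2
    exact h2
  -- Each moment, integrated against every `θ` supported before `T`, gives zero; it therefore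
  -- vanishes for almost every time.
  have hVz : ∀ k, ∀ᵐ s, s ∈ Iio T → V k s = 0 := by
    intro k
    refine isOpen_Iio.ae_eq_zero_of_integral_contDiff_smul_eq_zero (hVloc k) fun g hg hgc hgs => ?_
    have h1 := integrable_separated hv (hy k).smooth.continuous
      (memLp_of_continuous_hasCompactSupport hg.continuous hgc)
    have h0 := separated_eq_zero hv hid (hy k) hg hgc hgs
    rw [IntegrableOn, volume_restrict_prod] at h1
    rw [volume_restrict_prod, integral_prod_symm _ h1] at h0
    rw [← h0, ← setIntegral_eq_integral_of_forall_compl_eq_zero (s := Iio T)]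
    · refine integral_congr_ae (Eventually.of_forall fun s => ?_)
      simp only [hV, Complex.real_smul]
      rw [← integral_const_mul]
      refine integral_congr_ae (Eventually.of_forall fun x => ?_)
      dsimp only
      ring
    · intro x hx
      rw [image_eq_zero_of_notMem_tsupport fun h => hx (hgs h), zero_smul]
  have hvp : MemLp (fun p => (v p : ℂ)) 2 ((volume.restrict (Ioo (0 : ℝ) 1)).prod
      (volume.restrict (Iio T))) := by
    rw [← volume_restrict_prod]; exact hv.ofReal
  have hsl1 : ∀ᵐ s ∂(volume.restrict (Iio T)),
      Integrable (fun x => ‖(v (x, s) : ℂ)‖ ^ 2) (volume.restrict (Ioo (0 : ℝ) 1)) :=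
    ((memLp_two_iff_integrable_sq_norm hvp.1).1 hvp).prod_left_ae
  have hsl2 : ∀ᵐ s ∂(volume.restrict (Iio T)),
      AEStronglyMeasurable (fun x => (v (x, s) : ℂ)) (volume.restrict (Ioo (0 : ℝ) 1)) :=
    hvp.1.prod_swap.prodMk_left
  have hzero : ∀ᵐ s ∂(volume.restrict (Iio T)), ∀ᵐ x ∂(volume.restrict (Ioo (0 : ℝ) 1)),
      v (x, s) = 0 := by
    have hVz' : ∀ᵐ s ∂(volume.restrict (Iio T)), ∀ k, V k s = 0 :=
      ae_all_iff.2 fun k => (ae_restrict_iff' measurableSet_Iio).2 (hVz k)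
    filter_upwards [hsl1, hsl2, hVz'] with s h1 h2 h3
    have h4 : MemLp (fun x => (v (x, s) : ℂ)) 2 (volume.restrict (Ioo (0 : ℝ) 1)) :=
      (memLp_two_iff_integrable_sq_norm h2).2 h1
    -- All moments of the slice times `x²(1 - x)³` vanish, and this weight has no zero inside the
    -- interval.
    have h5 := ae_eq_zero_of_moments (u := fun x => (v (x, s) : ℂ) * y 0 x)
      (MemLp.integrable_mul (p := 2) (q := 2) h4
        (memLp_of_continuous_Ioo (hy 0).smooth.continuous)) (fun k => by
        rw [← h3 k]
        refine integral_congr_ae (Eventually.of_forall fun x => ?_)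
        simp only [y]
        ring)
    rw [ae_restrict_iff' measurableSet_Ioo]
    filter_upwards [h5] with x hx hx01
    have hx0 : (x : ℂ) ≠ 0 := Complex.ofReal_ne_zero.2 hx01.1.ne'
    have hx1 : (1 - x : ℂ) ≠ 0 := by
      rw [← Complex.ofReal_one, ← Complex.ofReal_sub]
      exact Complex.ofReal_ne_zero.2 (sub_pos.2 hx01.2).ne'
    simpa [y, hx0, hx1] using hx hx01
  have hmeas : AEMeasurable (fun p => ‖(v p : ℂ)‖ₑ) ((volume.restrict (Ioo (0 : ℝ) 1)).prod
      (volume.restrict (Iio T))) := hvp.1.enorm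
  have h0 : ∫⁻ p, ‖(v p : ℂ)‖ₑ ∂((volume.restrict (Ioo (0 : ℝ) 1)).prod
      (volume.restrict (Iio T))) = 0 := by
    rw [lintegral_prod_symm _ hmeas]
    refine (lintegral_congr_ae (g := fun _ => 0) ?_).trans (by simp)
    filter_upwards [hzero] with s hs
    refine (lintegral_congr_ae (g := fun _ => 0) ?_).trans (by simp)
    filter_upwards [hs] with x hx
    simp [hx]
  rw [volume_restrict_prod]
  filter_upwards [(lintegral_eq_zero_iff' hmeas).1 h0] with p hp
  simpa using hp

/-! ### The kernels of the solution operator -/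

/-- The spectral parameter `σ = i(ρ³ - ρ)`. -/
def sigma (ρ : ℝ) : ℂ := Complex.I * ((ρ ^ 3 - ρ : ℝ) : ℂ)

lemma sqrtTerm_sq (ρ : ℝ) :
    ((((3 * ρ ^ 2 - 4 : ℝ) : ℂ)) ^ (1 / 2 : ℂ)) ^ 2 = 3 * (ρ : ℂ) ^ 2 - 4 := by
  have h := Complex.cpow_nat_inv_pow ((3 * ρ ^ 2 - 4 : ℝ) : ℂ) two_ne_zero
  rw [one_div]
  push_cast at h ⊢
  exact h

lemma lam_root (j : Fin 3) (ρ : ℝ) : sigma ρ + lam j ρ + lam j ρ ^ 3 = 0 := by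
  have h := sqrtTerm_sq ρ
  set q := (((3 * ρ ^ 2 - 4 : ℝ) : ℂ)) ^ (1 / 2 : ℂ) with hq
  have hI : Complex.I ^ 2 = -1 := Complex.I_sq
  fin_cases j <;> simp only [lam, ← hq, sigma, Fin.zero_eta, Fin.mk_one, Fin.reduceFinMk,
    Matrix.cons_val] <;> push_cast
  · linear_combination (Complex.I * (ρ : ℂ) ^ 3) * hI
  · linear_combination ((q - 3 * Complex.I * ρ) / 8) * h +
      (3 * q * (ρ : ℂ) ^ 2 - Complex.I * (ρ : ℂ) ^ 3) / 8 * hI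
  · linear_combination ((-q - 3 * Complex.I * ρ) / 8) * h +
      (-3 * q * (ρ : ℂ) ^ 2 - Complex.I * (ρ : ℂ) ^ 3) / 8 * hI

/-- The radicand stays real, so it runs along the branch cut without crossing it; at zero the
positive exponent gives continuity. -/
lemma continuous_lam (j : Fin 3) : Continuous (lam j) := by
  have h : Continuous fun ρ : ℝ => (((3 * ρ ^ 2 - 4 : ℝ) : ℂ)) ^ (1 / 2 : ℂ) := by
    refine continuous_iff_continuousAt.2 fun ρ => ?_
    exact (Complex.continuousAt_ofReal_cpow_const (3 * ρ ^ 2 - 4) (1 / 2)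
      (Or.inl (by norm_num))).comp (f := fun ρ : ℝ => 3 * ρ ^ 2 - 4) (by fun_prop)
  fin_cases j
  · exact (by fun_prop : Continuous fun ρ : ℝ => Complex.I * (ρ : ℂ))
  · exact (h.sub (by fun_prop : Continuous fun ρ : ℝ => Complex.I * (ρ : ℂ))).div_const 2
  · exact (h.neg.sub (by fun_prop : Continuous fun ρ : ℝ => Complex.I * (ρ : ℂ))).div_const 2

lemma sqrtTerm_ne_zero {ρ : ℝ} (h1 : 1 ≤ ρ) (h2 : ρ ≠ 2 / √3) :
    (((3 * ρ ^ 2 - 4 : ℝ) : ℂ)) ^ (1 / 2 : ℂ) ≠ 0 := by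
  intro h0
  have h := sqrtTerm_sq ρ
  rw [h0] at h
  have h3 : 3 * ρ ^ 2 - 4 = 0 := by
    have : ((3 * ρ ^ 2 - 4 : ℝ) : ℂ) = 0 := by push_cast; rw [← h]; simp
    exact_mod_cast this
  apply h2
  have h4 : √3 ^ 2 = 3 := Real.sq_sqrt (by norm_num)
  rw [eq_div_iff (by positivity)]
  nlinarith [mul_nonneg (by linarith : 0 ≤ ρ) (Real.sqrt_nonneg 3)]

/-- Only `λ₂` and `λ₃` can meet, at the zero of the square root. A collision with `iρ` would force
`12ρ² = 4`, impossible for `ρ ≥ 1`. -/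
lemma lam_injective {ρ : ℝ} (h1 : 1 ≤ ρ) (h2 : ρ ≠ 2 / √3) :
    Function.Injective fun j => lam j ρ := by
  have h := sqrtTerm_sq ρ
  have h0 := sqrtTerm_ne_zero h1 h2
  set q := (((3 * ρ ^ 2 - 4 : ℝ) : ℂ)) ^ (1 / 2 : ℂ) with hq
  have hI : Complex.I ^ 2 = -1 := Complex.I_sq
  have hρ : (12 * ρ ^ 2 - 4 : ℂ) ≠ 0 := by
    have : (12 * ρ ^ 2 - 4 : ℝ) ≠ 0 := by nlinarith
    exact_mod_cast this
  have l0 : lam 0 ρ = Complex.I * ρ := rfl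
  have l1 : lam 1 ρ = (q - Complex.I * ρ) / 2 := rfl
  have l2 : lam 2 ρ = (-q - Complex.I * ρ) / 2 := rfl
  have h01 : lam 0 ρ ≠ lam 1 ρ := by
    rw [l0, l1]
    intro e
    apply hρ
    linear_combination (-2 * q - 6 * Complex.I * ρ) * e - h + 9 * (ρ : ℂ) ^ 2 * hI
  have h02 : lam 0 ρ ≠ lam 2 ρ := by
    rw [l0, l2]
    intro e
    apply hρ
    linear_combination (2 * q - 6 * Complex.I * ρ) * e - h + 9 * (ρ : ℂ) ^ 2 * hI
  have h12 : lam 1 ρ ≠ lam 2 ρ := by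
    rw [l1, l2]
    intro e
    apply h0
    linear_combination e
  intro i j hij
  fin_cases i <;> fin_cases j <;> first | rfl | (exfalso; simp_all)

/-- The exponential solution with coefficients `c`. -/
def expSol (c : Fin 3 → ℂ) (ρ : ℝ) (k : ℕ) (x : ℝ) : ℂ :=
  ∑ j, c j * (lam j ρ ^ k * Complex.exp (lam j ρ * x))

lemma hasDerivAt_expSol (c : Fin 3 → ℂ) (ρ : ℝ) (k : ℕ) (x : ℝ) :
    HasDerivAt (expSol c ρ k) (expSol c ρ (k + 1) x) x := by
  refine HasDerivAt.fun_sum fun j _ => ?_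
  have h : HasDerivAt (fun x : ℝ => lam j ρ * (x : ℂ)) (lam j ρ) x := by
    simpa using (Complex.ofRealCLM.hasDerivAt (x := x)).const_mul (lam j ρ)
  exact ((h.cexp.const_mul (lam j ρ ^ k)).const_mul (c j)).congr_deriv (by ring)

lemma continuous_expSol (c : Fin 3 → ℂ) (ρ : ℝ) (k : ℕ) : Continuous (expSol c ρ k) :=
  continuous_iff_continuousAt.2 fun x => (hasDerivAt_expSol c ρ k x).continuousAt

lemma derivChain_expSol (c : Fin 3 → ℂ) (ρ : ℝ) :
    DerivChain (expSol c ρ 0) (expSol c ρ 1) (expSol c ρ 2) (expSol c ρ 3) :=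
  ⟨hasDerivAt_expSol c ρ 0, hasDerivAt_expSol c ρ 1, hasDerivAt_expSol c ρ 2,
    continuous_expSol c ρ 3⟩

lemma expSol_ode (c : Fin 3 → ℂ) (ρ : ℝ) (x : ℝ) :
    sigma ρ * expSol c ρ 0 x + expSol c ρ 1 x + expSol c ρ 3 x = 0 := by
  simp only [expSol, Finset.mul_sum, ← Finset.sum_add_distrib]
  refine Finset.sum_eq_zero fun j _ => ?_
  linear_combination (c j * Complex.exp (lam j ρ * x)) * lam_root j ρ

lemma expSol_boundary (c : Fin 3 → ℂ) (ρ : ℝ) :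
    expSol c ρ 0 0 = (coeffMatrix ρ).mulVec c 0 ∧ expSol c ρ 1 1 = (coeffMatrix ρ).mulVec c 1 ∧
      expSol c ρ 2 1 = (coeffMatrix ρ).mulVec c 2 := by
  simp only [expSol, Matrix.mulVec, dotProduct, coeffMatrix, Matrix.of_apply, Fin.sum_univ_three,
    Matrix.cons_val, Complex.ofReal_zero, mul_zero, Complex.exp_zero, pow_zero, one_mul, mul_one,
    Complex.ofReal_one, pow_one]
  exact ⟨trivial, by ring, by ring⟩

lemma sigma_re (ρ : ℝ) : (sigma ρ).re = 0 := by
  simp only [sigma, Complex.mul_re, Complex.I_re, Complex.I_im, Complex.ofReal_im, zero_mul,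
    mul_zero, sub_zero]

/-- A null vector of the matrix is an exponential solution with zero boundary values. Since `Re σ =
0` the estimate applies with `κ = 1` and kills it. -/
lemma Delta_ne_zero {ρ : ℝ} (h1 : 1 ≤ ρ) (h2 : ρ ≠ 2 / √3) : Delta ρ ≠ 0 := by
  intro h0
  obtain ⟨c, hc, hA⟩ := Matrix.exists_mulVec_eq_zero_iff.2 h0
  obtain ⟨b0, b1, b2⟩ := expSol_boundary c ρ
  rw [hA] at b0 b1 b2
  have h := direct_estimate (σ := sigma ρ) (κ := 1) (derivChain_expSol c ρ) b0 b1 b2 one_pos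
    (by rw [sigma_re]; norm_num) (by rw [sigma_re]; norm_num)
  simp only [expSol_ode, norm_zero, zero_pow two_ne_zero, intervalIntegral.integral_zero,
    mul_zero, one_pow, one_mul] at h
  obtain ⟨e0, e1, e2⟩ := (derivChain_expSol c ρ).eq_zero_of_integral h 0 (by simp)
  -- The Cauchy data at `0` form a Vandermonde system in the coefficients, with distinct nodes.
  refine hc (Matrix.eq_zero_of_forall_pow_sum_mul_pow_eq_zero (lam_injective h1 h2) fun i => ?_)
  simp only [expSol, Complex.ofReal_zero, mul_zero, Complex.exp_zero, mul_one] at e0 e1 e2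
  fin_cases i
  · exact e0
  · exact e1
  · exact e2

/-- The coefficients of the `m`-th kernel. -/
def kerCoeff (m : Fin 3) (ρ : ℝ) (j : Fin 3) : ℂ := DeltaMinor j m ρ / Delta ρ

/-- The kernel of the boundary value problem with the `m`-th unit vector as boundary data. -/
def ker (m : Fin 3) (ρ : ℝ) (k : ℕ) (x : ℝ) : ℂ := expSol (kerCoeff m ρ) ρ k x

lemma mulVec_kerCoeff {ρ : ℝ} (h1 : 1 ≤ ρ) (h2 : ρ ≠ 2 / √3) (m : Fin 3) :
    (coeffMatrix ρ).mulVec (kerCoeff m ρ) = Pi.single m 1 := by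
  have e : kerCoeff m ρ = (Delta ρ)⁻¹ • (coeffMatrix ρ).cramer (Pi.single m 1) := by
    ext j
    rw [kerCoeff, Pi.smul_apply, Matrix.cramer_apply, smul_eq_mul, div_eq_inv_mul, DeltaMinor]
  rw [e, Matrix.mulVec_smul, Matrix.mulVec_cramer, smul_smul, ← Delta,
    inv_mul_cancel₀ (Delta_ne_zero h1 h2), one_smul]

lemma continuous_coeffMatrix : Continuous coeffMatrix := by
  refine continuous_matrix fun i j => ?_
  have := continuous_lam j
  fin_cases i <;> simp only [coeffMatrix, Matrix.of_apply, Fin.zero_eta, Fin.mk_one,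
    Fin.reduceFinMk, Matrix.cons_val] <;> fun_prop

lemma continuousOn_kerCoeff (m j : Fin 3) :
    ContinuousOn (fun ρ => kerCoeff m ρ j) {ρ | 1 ≤ ρ ∧ ρ ≠ 2 / √3} := by
  refine ContinuousOn.div ?_ ?_ fun ρ hρ => Delta_ne_zero hρ.1 hρ.2
  · exact ((continuous_coeffMatrix.matrix_updateCol j continuous_const).matrix_det).continuousOn
  · exact continuous_coeffMatrix.matrix_det.continuousOn

/-- The factor `e^{λ_j}` in `Q` undoes the shift in `e^{-λ_j(1-x)}`, so all three indices give
`e^{λ_j x}` and the sum over `j` is a kernel. -/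
lemma integrand_eq (j m : Fin 3) (h : 𝓢'(ℝ, ℂ)) (p : ℝ × ℝ) (ρ : ℝ) :
    integrand j m h p ρ = ((3 * ρ ^ 2 - 1 : ℝ) : ℂ) *
      (Complex.exp (Complex.I * ((ρ ^ 3 - ρ : ℝ) : ℂ) * (p.2 : ℂ)) *
        (laplaceOnAxis h (ρ ^ 3 - ρ) *
          (kerCoeff m ρ j * (lam j ρ ^ 0 * Complex.exp (lam j ρ * p.1))))) := by
  by_cases hj : j = 2
  · simp only [integrand, Q, hj, if_true, kerCoeff]
    ring
  · have : Complex.exp (-lam j ρ * ((1 - p.1 : ℝ) : ℂ)) * Complex.exp (lam j ρ) =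
        Complex.exp (lam j ρ * p.1) := by
      rw [← Complex.exp_add]
      congr 1
      push_cast
      ring
    simp only [integrand, Q, hj, if_false, kerCoeff, ← this]
    ring

lemma sum_integrand (m : Fin 3) (h : 𝓢'(ℝ, ℂ)) (p : ℝ × ℝ) (ρ : ℝ) :
    ∑ j, integrand j m h p ρ = ((3 * ρ ^ 2 - 1 : ℝ) : ℂ) *
      (Complex.exp (Complex.I * ((ρ ^ 3 - ρ : ℝ) : ℂ) * (p.2 : ℂ)) *
        (laplaceOnAxis h (ρ ^ 3 - ρ) * ker m ρ 0 p.1)) := by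
  simp only [integrand_eq, ← Finset.mul_sum]
  rfl

lemma ker_boundary {ρ : ℝ} (h1 : 1 ≤ ρ) (h2 : ρ ≠ 2 / √3) (m : Fin 3) :
    ker m ρ 0 0 = (Pi.single m 1 : Fin 3 → ℂ) 0 ∧ ker m ρ 1 1 = (Pi.single m 1 : Fin 3 → ℂ) 1 ∧
      ker m ρ 2 1 = (Pi.single m 1 : Fin 3 → ℂ) 2 := by
  rw [← mulVec_kerCoeff h1 h2 m]
  exact expSol_boundary _ ρ

lemma norm_single_le (m j : Fin 3) : ‖(Pi.single m 1 : Fin 3 → ℂ) j‖ ≤ 1 := by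
  by_cases h : j = m
  · subst h; simp
  · simp [h]

lemma norm_sigma_le {ρ R : ℝ} (h1 : 1 ≤ ρ) (hR : ρ ≤ R) : ‖sigma ρ‖ ≤ R ^ 3 := by
  rw [sigma, norm_mul, Complex.norm_I, one_mul, Complex.norm_real, Real.norm_of_nonneg (sub_nonneg.2 (le_self_pow₀ h1 (by norm_num)))]
  have : ρ ^ 3 ≤ R ^ 3 := pow_le_pow_left₀ (by linarith) hR 3
  linarith

/-- Bounded frequencies: the kernels are bounded in `L²(0, 1)`, also near the double root. -/
lemma integral_ker_le_of_le {ρ R : ℝ} (h1 : 1 ≤ ρ) (h2 : ρ ≠ 2 / √3) (hR : ρ ≤ R) (m : Fin 3) :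
    (∫ x in (0 : ℝ)..1, ‖ker m ρ 0 x‖ ^ 2) ≤ 8 * (3 * R ^ 3 + 3) ^ 2 + 18 := by
  obtain ⟨b0, b1, b2⟩ := ker_boundary h1 h2 m
  set a := (Pi.single m 1 : Fin 3 → ℂ) 0
  set b := (Pi.single m 1 : Fin 3 → ℂ) 1
  set c := (Pi.single m 1 : Fin 3 → ℂ) 2
  have ha : ‖a‖ ≤ 1 := norm_single_le m 0
  have hb : ‖b‖ ≤ 1 := norm_single_le m 1
  have hc : ‖c‖ ≤ 1 := norm_single_le m 2
  have hof : ∀ x : ℝ, HasDerivAt (fun x : ℝ => (x : ℂ)) 1 x := fun x =>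
    (hasDerivAt_id x).ofReal_comp
  -- This quadratic has the boundary values `a`, `b`, `c` of the kernel. Subtracting it leaves
  -- homogeneous conditions and a bounded right-hand side, so the estimate never refers to the
  -- coefficients that may blow up at the double root.
  have hP : DerivChain (fun x : ℝ => a + (b - c) * x + c / 2 * (x : ℂ) ^ 2)
      (fun x : ℝ => (b - c) + c * x) (fun _ => c) (fun _ => 0) := by
    refine ⟨fun x => ?_, fun x => ?_, fun x => hasDerivAt_const _ _, continuous_const⟩
    · exact ((((hof x).const_mul (b - c)).const_add a).add
        (((hof x).pow 2).const_mul (c / 2))).congr_deriv (by simp; ring)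
    · exact (((hof x).const_mul c).const_add (b - c)).congr_deriv (by simp)
  have hchain := (derivChain_expSol (kerCoeff m ρ) ρ).sub hP
  have h := direct_estimate (σ := sigma ρ) (κ := 1) hchain
    (by change ker m ρ 0 0 - _ = 0; rw [b0]; simp)
    (by change ker m ρ 1 1 - _ = 0; rw [b1]; simp)
    (by change ker m ρ 2 1 - _ = 0; rw [b2]; simp) one_pos
    (by rw [sigma_re]; norm_num) (by rw [sigma_re]; norm_num)
  have hx1 : ∀ x ∈ Icc (0 : ℝ) 1, ‖(x : ℂ)‖ ≤ 1 := fun x hx => by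
    rw [Complex.norm_real, Real.norm_of_nonneg hx.1]; exact hx.2
  -- At most one of the entries of a unit vector is nonzero.
  have hbc : ‖b - c‖ ≤ 1 := by
    simp only [b, c]
    fin_cases m <;> simp
  have hPb : ∀ x ∈ Icc (0 : ℝ) 1, ‖a + (b - c) * x + c / 2 * (x : ℂ) ^ 2‖ ≤ 3 := by
    intro x hx
    calc _ ≤ ‖a‖ + ‖b - c‖ * ‖(x : ℂ)‖ + ‖c‖ / 2 * ‖(x : ℂ)‖ ^ 2 := by
          refine (norm_add_le _ _).trans (add_le_add ((norm_add_le _ _).trans ?_) ?_)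
          · rw [norm_mul]
          · rw [norm_mul, norm_div, norm_pow]; simp
      _ ≤ 1 + 1 * 1 + 1 / 2 * 1 ^ 2 := by
          have := hx1 x hx
          gcongr
      _ ≤ 3 := by norm_num
  have hgb : ∀ x ∈ Icc (0 : ℝ) 1,
      ‖sigma ρ * (expSol (kerCoeff m ρ) ρ 0 x - (a + (b - c) * x + c / 2 * (x : ℂ) ^ 2)) +
        (expSol (kerCoeff m ρ) ρ 1 x - ((b - c) + c * x)) +
        (expSol (kerCoeff m ρ) ρ 3 x - 0)‖ ≤ 3 * R ^ 3 + 3 := by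
    intro x hx
    have e : sigma ρ * (expSol (kerCoeff m ρ) ρ 0 x - (a + (b - c) * x + c / 2 * (x : ℂ) ^ 2)) +
        (expSol (kerCoeff m ρ) ρ 1 x - ((b - c) + c * x)) +
        (expSol (kerCoeff m ρ) ρ 3 x - 0) =
        -(sigma ρ * (a + (b - c) * x + c / 2 * (x : ℂ) ^ 2) + ((b - c) + c * x)) := by
      linear_combination expSol_ode (kerCoeff m ρ) ρ x
    rw [e, norm_neg]
    refine (norm_add_le _ _).trans (add_le_add ?_ ?_)
    · rw [norm_mul, mul_comm 3]
      exact mul_le_mul (norm_sigma_le h1 hR) (hPb x hx) (norm_nonneg _)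
        (pow_nonneg (by linarith) 3)
    · refine (norm_add_le _ _).trans ?_
      rw [norm_mul]
      nlinarith [hx1 x hx, norm_nonneg c, norm_nonneg (x : ℂ)]
  have c0 := hchain.cont₀
  have c1 := hchain.cont₁
  have c3 := hchain.cont
  have cP := hP.cont₀
  have hG : (∫ x in (0 : ℝ)..1,
      ‖sigma ρ * (expSol (kerCoeff m ρ) ρ 0 x - (a + (b - c) * x + c / 2 * (x : ℂ) ^ 2)) +
        (expSol (kerCoeff m ρ) ρ 1 x - ((b - c) + c * x)) +
        (expSol (kerCoeff m ρ) ρ 3 x - 0)‖ ^ 2) ≤ ∫ _ in (0 : ℝ)..1, (3 * R ^ 3 + 3) ^ 2 := by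
    refine intervalIntegral.integral_mono_on (by norm_num)
      (Continuous.intervalIntegrable (by fun_prop) _ _)
      (Continuous.intervalIntegrable (by fun_prop) _ _) fun x hx => ?_
    exact pow_le_pow_left₀ (norm_nonneg _) (hgb x hx) 2
  have hK : (∫ x in (0 : ℝ)..1, ‖ker m ρ 0 x‖ ^ 2) ≤
      ∫ x in (0 : ℝ)..1, (2 * ‖expSol (kerCoeff m ρ) ρ 0 x -
        (a + (b - c) * x + c / 2 * (x : ℂ) ^ 2)‖ ^ 2 + 18) := by
    have cK : Continuous (ker m ρ 0) := continuous_expSol _ ρ 0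
    refine intervalIntegral.integral_mono_on (by norm_num)
      (Continuous.intervalIntegrable (by fun_prop) _ _)
      (Continuous.intervalIntegrable (by fun_prop) _ _) fun x hx => ?_
    have h5 := norm_add_le (expSol (kerCoeff m ρ) ρ 0 x -
      (a + (b - c) * x + c / 2 * (x : ℂ) ^ 2)) (a + (b - c) * x + c / 2 * (x : ℂ) ^ 2)
    rw [sub_add_cancel] at h5
    have h6 := hPb x hx
    change ‖expSol (kerCoeff m ρ) ρ 0 x‖ ^ 2 ≤ _
    set N := ‖expSol (kerCoeff m ρ) ρ 0 x‖
    set u := ‖expSol (kerCoeff m ρ) ρ 0 x - (a + (b - c) * x + c / 2 * (x : ℂ) ^ 2)‖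
    have h7 : N ≤ u + 3 := by linarith
    nlinarith [pow_le_pow_left₀ (norm_nonneg _) h7 2, sq_nonneg (u - 3)]
  rw [intervalIntegral.integral_add (Continuous.intervalIntegrable (by fun_prop) _ _)
    (Continuous.intervalIntegrable (by fun_prop) _ _),
    intervalIntegral.integral_const_mul] at hK
  simp only [intervalIntegral.integral_const, sub_zero, one_smul, one_pow, one_mul] at hK hG h
  linarith

/-- The roots for large frequencies. -/
lemma lam_large {ρ : ℝ} (hρ : 4 ≤ ρ) : ∃ q : ℝ, 6 ≤ q ∧ q ≤ 2 * ρ ∧ q ^ 2 = 3 * ρ ^ 2 - 4 ∧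
    lam 0 ρ = Complex.I * ρ ∧ lam 1 ρ = (q - Complex.I * ρ) / 2 ∧
    lam 2 ρ = (-q - Complex.I * ρ) / 2 := by
  have h0 : 0 ≤ 3 * ρ ^ 2 - 4 := by nlinarith
  have hs := Real.sq_sqrt h0
  have e : (((3 * ρ ^ 2 - 4 : ℝ) : ℂ)) ^ (1 / 2 : ℂ) = ((√(3 * ρ ^ 2 - 4) : ℝ) : ℂ) := by
    rw [Real.sqrt_eq_rpow, Complex.ofReal_cpow h0]
    norm_num
  refine ⟨√(3 * ρ ^ 2 - 4), Real.le_sqrt_of_sq_le (by nlinarith), ?_, hs, rfl, ?_, ?_⟩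
  · exact Real.sqrt_le_iff.2 ⟨by linarith, by nlinarith⟩
  · rw [← e]; rfl
  · rw [← e]; rfl

/-- Large frequencies: the coefficients are controlled by the boundary data. -/
lemma coeff_bound {ρ : ℝ} (hρ : 4 ≤ ρ) {c r : Fin 3 → ℂ} (h : (coeffMatrix ρ).mulVec c = r) :
    ∀ x ∈ Icc (0 : ℝ) 1, ‖expSol c ρ 0 x‖ ≤ 10 * (‖r 0‖ + (‖r 1‖ / ρ + ‖r 2‖ / ρ ^ 2)) := by
  obtain ⟨q, hq6, hq2, hqq, l0, l1, l2⟩ := lam_large hρ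
  have hr : ∀ i, (coeffMatrix ρ).mulVec c i = r i := fun i => by rw [h]
  have r0 := hr 0
  have r1 := hr 1
  have r2 := hr 2
  simp only [Matrix.mulVec, dotProduct, coeffMatrix, Matrix.of_apply, Fin.sum_univ_three,
    Matrix.cons_val, one_mul] at r0 r1 r2
  have re0 : (lam 0 ρ).re = 0 := by rw [l0]; simp
  have re1 : (lam 1 ρ).re = q / 2 := by rw [l1]; simp
  have re2 : (lam 2 ρ).re = -q / 2 := by rw [l2]; simp
  have im0 : (lam 0 ρ).im = ρ := by rw [l0]; simp
  have im1 : (lam 1 ρ).im = -ρ / 2 := by rw [l1]; simp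
  have im2 : (lam 2 ρ).im = -ρ / 2 := by rw [l2]; simp
  set z₁ := lam 0 ρ
  set z₂ := lam 1 ρ
  set z₃ := lam 2 ρ
  have hnz : ∀ z : ℂ, ‖z‖ ^ 2 = z.re ^ 2 + z.im ^ 2 := fun z => by
    rw [← Complex.normSq_eq_norm_sq, Complex.normSq_apply]; ring
  have n1 : ‖z₁‖ = ρ := by
    rw [← abs_of_nonneg (norm_nonneg z₁), ← abs_of_nonneg (by linarith : 0 ≤ ρ),
      ← sq_eq_sq_iff_abs_eq_abs, hnz, re0, im0]
    ring
  have n2 : ‖z₂‖ ≤ ρ := by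
    refine le_of_sq_le_sq ?_ (by linarith)
    rw [hnz, re1, im1]; nlinarith
  have n2' : ρ / 2 ≤ ‖z₂‖ := by
    refine le_of_sq_le_sq ?_ (norm_nonneg _)
    rw [hnz, re1, im1]; nlinarith
  have n3 : ‖z₃‖ ≤ ρ := by
    refine le_of_sq_le_sq ?_ (by linarith)
    rw [hnz, re2, im2]; nlinarith
  have n21 : 3 * ρ / 2 ≤ ‖z₂ - z₁‖ := by
    refine le_of_sq_le_sq ?_ (norm_nonneg _)
    rw [hnz, Complex.sub_re, Complex.sub_im, re0, re1, im0, im1]; nlinarith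
  have n23 : ‖z₂ - z₃‖ ≤ 2 * ρ := (norm_sub_le _ _).trans (by linarith)
  have n13 : ‖z₁ - z₃‖ ≤ 2 * ρ := (norm_sub_le _ _).trans (by linarith)
  have E1 : ‖Complex.exp z₁‖ = 1 := by rw [Complex.norm_exp, re0, Real.exp_zero]
  -- For `ρ ≥ 4` one has `q ≥ 6`, so the coupling between the two ends of the interval is at most
  -- `e^{-3}`.
  have hexp : Real.exp (-q / 2) ≤ 1 / 16 := by
    have h1 : Real.exp (-q / 2) ≤ Real.exp (-3) := Real.exp_le_exp.2 (by linarith)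
    have h2 : (16 : ℝ) ≤ Real.exp 3 := by
      have h3 : Real.exp 3 = Real.exp 1 ^ 3 := by rw [← Real.exp_nat_mul]; norm_num
      have h4 : (2.7 : ℝ) ≤ Real.exp 1 := by linarith [Real.exp_one_gt_d9]
      rw [h3]
      exact le_trans (by norm_num) (pow_le_pow_left₀ (by norm_num) h4 3)
    rw [Real.exp_neg] at h1
    refine h1.trans ?_
    rw [one_div]
    exact inv_anti₀ (by norm_num) h2
  set e := Real.exp (-q / 2)
  have he0 : 0 < e := Real.exp_pos _
  have E3 : ‖Complex.exp z₃‖ = e := by rw [Complex.norm_exp, re2]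
  have E2 : ‖Complex.exp (-z₂)‖ = e := by rw [Complex.norm_exp, Complex.neg_re, re1, ← neg_div]
  set a := c 0
  -- The growing exponential is normalised at the right end, where it is largest.
  set b := c 1 * Complex.exp z₂ with hb
  set d := c 2
  have hb' : c 1 = b * Complex.exp (-z₂) := by
    rw [hb, mul_assoc, ← Complex.exp_add, add_neg_cancel, Complex.exp_zero, mul_one]
  set D := ‖r 1‖ / ρ + ‖r 2‖ / ρ ^ 2 with hD
  have hρ0 : 0 < ρ := by linarith
  have hDρ : ρ ^ 2 * D = ρ * ‖r 1‖ + ‖r 2‖ := by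
    rw [hD]; field_simp
  have hD0 : 0 ≤ D := by positivity
  -- The two conditions at `1` are solved for `a` and `b` by elimination; the decaying mode enters
  -- only with the small factor `e`.
  have ka : ‖a‖ ≤ D + 2 * e * ‖d‖ := by
    have h1 : a * z₁ * Complex.exp z₁ * (z₂ - z₁) =
        z₂ * r 1 - r 2 - d * z₃ * Complex.exp z₃ * (z₂ - z₃) := by
      linear_combination z₂ * r1 - r2
    have h2 := congrArg norm h1
    rw [norm_mul, norm_mul, norm_mul, E1, n1, mul_one] at h2
    have h3 : ‖z₂ * r 1 - r 2 - d * z₃ * Complex.exp z₃ * (z₂ - z₃)‖ ≤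
        ρ * ‖r 1‖ + ‖r 2‖ + ‖d‖ * ρ * e * (2 * ρ) := by
      refine (norm_sub_le _ _).trans (add_le_add ((norm_sub_le _ _).trans ?_) ?_)
      · rw [norm_mul]; gcongr
      · rw [norm_mul, norm_mul, norm_mul, E3]; gcongr
    have h4 : ‖a‖ * ρ * (3 * ρ / 2) ≤ ρ ^ 2 * D + ‖d‖ * ρ * e * (2 * ρ) := by
      rw [hDρ]
      exact (mul_le_mul_of_nonneg_left n21 (by positivity)).trans (h2.trans_le h3)
    have h5 : ρ ^ 2 * ‖a‖ ≤ ρ ^ 2 * (D + 2 * e * ‖d‖) := by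
      nlinarith [mul_nonneg (sq_nonneg ρ) (norm_nonneg a)]
    exact le_of_mul_le_mul_left h5 (by positivity)
  have kb : ‖b‖ ≤ 2 * D + 4 * e * ‖d‖ := by
    have h1 : b * z₂ * (z₂ - z₁) =
        -(z₁ * r 1 - r 2 - d * z₃ * Complex.exp z₃ * (z₁ - z₃)) := by
      rw [hb]
      linear_combination -z₁ * r1 + r2
    have h2 := congrArg norm h1
    rw [norm_neg, norm_mul, norm_mul] at h2
    have h3 : ‖z₁ * r 1 - r 2 - d * z₃ * Complex.exp z₃ * (z₁ - z₃)‖ ≤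
        ρ * ‖r 1‖ + ‖r 2‖ + ‖d‖ * ρ * e * (2 * ρ) := by
      refine (norm_sub_le _ _).trans (add_le_add ((norm_sub_le _ _).trans ?_) ?_)
      · rw [norm_mul, n1]
      · rw [norm_mul, norm_mul, norm_mul, E3]; gcongr
    have h4 : ‖b‖ * (ρ / 2) * (3 * ρ / 2) ≤ ρ ^ 2 * D + ‖d‖ * ρ * e * (2 * ρ) := by
      rw [hDρ]
      refine le_trans ?_ (h2.trans_le h3)
      gcongr
    have h5 : ρ ^ 2 * ‖b‖ ≤ ρ ^ 2 * (2 * D + 4 * e * ‖d‖) := by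
      nlinarith [mul_nonneg (sq_nonneg ρ) (norm_nonneg b),
        mul_nonneg (sq_nonneg ρ) hD0, mul_nonneg (mul_nonneg (sq_nonneg ρ) he0.le) (norm_nonneg d)]
    exact le_of_mul_le_mul_left h5 (by positivity)
  -- The condition at `0` bounds `d`, and smallness of `e` closes the circular system of
  -- inequalities.
  have kd : ‖d‖ ≤ ‖r 0‖ + ‖a‖ + ‖b‖ * e := by
    have h1 : d = r 0 - a - b * Complex.exp (-z₂) := by
      rw [← hb']; linear_combination r0
    rw [h1]
    refine (norm_sub_le _ _).trans (add_le_add (norm_sub_le _ _) ?_)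
    rw [norm_mul, E2]
  have hed : e * ‖d‖ ≤ 1 / 16 * ‖d‖ := mul_le_mul_of_nonneg_right hexp (norm_nonneg _)
  have hbe : ‖b‖ * e ≤ 1 / 16 * ‖b‖ := by
    rw [mul_comm]; exact mul_le_mul_of_nonneg_right hexp (norm_nonneg _)
  intro x hx
  have hsum : expSol c ρ 0 x = a * Complex.exp (z₁ * x) + b * Complex.exp (z₂ * (x - 1)) +
      d * Complex.exp (z₃ * x) := by
    have : Complex.exp (z₂ * x) = Complex.exp z₂ * Complex.exp (z₂ * (x - 1)) := by
      rw [← Complex.exp_add]; congr 1; ring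
    simp only [expSol, Fin.sum_univ_three, pow_zero, one_mul]
    change a * Complex.exp (z₁ * x) + c 1 * Complex.exp (z₂ * x) + d * Complex.exp (z₃ * x) = _
    rw [this, hb]
    ring
  have x1 : ‖Complex.exp (z₁ * x)‖ ≤ 1 := by
    rw [Complex.norm_exp, Complex.re_mul_ofReal, re0, zero_mul, Real.exp_zero]
  have x2 : ‖Complex.exp (z₂ * (x - 1))‖ ≤ 1 := by
    rw [Complex.norm_exp, ← Complex.ofReal_one, ← Complex.ofReal_sub, Complex.re_mul_ofReal, re1,
      Real.exp_le_one_iff]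
    exact mul_nonpos_of_nonneg_of_nonpos (by linarith) (by linarith [hx.2])
  have x3 : ‖Complex.exp (z₃ * x)‖ ≤ 1 := by
    rw [Complex.norm_exp, Complex.re_mul_ofReal, re2, Real.exp_le_one_iff]
    exact mul_nonpos_of_nonpos_of_nonneg (by linarith) hx.1
  rw [hsum]
  have hfin := norm_add₃_le (a := a * Complex.exp (z₁ * x)) (b := b * Complex.exp (z₂ * (x - 1)))
    (c := d * Complex.exp (z₃ * x))
  simp only [norm_mul] at hfin
  have y1 := mul_le_of_le_one_right (norm_nonneg a) x1
  have y2 := mul_le_of_le_one_right (norm_nonneg b) x2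
  have y3 := mul_le_of_le_one_right (norm_nonneg d) x3
  have p0 := norm_nonneg (r 0)
  clear_value a b d z₁ z₂ z₃ D e
  clear h r0 r1 r2 hr hb hb'
  linarith

/-- The sharp frequency weights of the three kernels. -/
lemma exists_integral_ker_le : ∃ C : ℝ, 0 ≤ C ∧ ∀ ρ : ℝ, 1 ≤ ρ → ρ ≠ 2 / √3 → ∀ m : Fin 3,
    (∫ x in (0 : ℝ)..1, ‖ker m ρ 0 x‖ ^ 2) ≤ C / ρ ^ (2 * (m : ℕ)) := by
  -- Bounded range `ρ ≤ 4`, where `ρ^{2m} ≤ 4⁴` because `m ≤ 2`; beyond it the explicit coefficient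
  -- bound takes over.
  set C₁ : ℝ := 8 * (3 * 4 ^ 3 + 3) ^ 2 + 18
  refine ⟨max (C₁ * 4 ^ 4) 100, by positivity, fun ρ h1 h2 m => ?_⟩
  have hρ0 : 0 < ρ := by linarith
  rw [le_div_iff₀ (by positivity)]
  rcases le_total ρ 4 with h4 | h4
  · refine le_trans ?_ (le_max_left _ _)
    refine mul_le_mul (integral_ker_le_of_le h1 h2 h4 m) ?_ (by positivity) (by positivity)
    calc ρ ^ (2 * (m : ℕ)) ≤ ρ ^ 4 := pow_le_pow_right₀ h1 (by omega)
      _ ≤ 4 ^ 4 := pow_le_pow_left₀ hρ0.le h4 4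
  · refine le_trans ?_ (le_max_right _ _)
    have hb := coeff_bound h4 (mulVec_kerCoeff h1 h2 m)
    have hb2 : ∀ x ∈ Icc (0 : ℝ) 1, ‖ker m ρ 0 x‖ ^ 2 ≤ 100 / ρ ^ (2 * (m : ℕ)) := by
      intro x hx
      have h3 : ‖ker m ρ 0 x‖ ≤ 10 / ρ ^ (m : ℕ) := by
        refine (hb x hx).trans_eq ?_
        fin_cases m <;> simp <;> ring
      refine (pow_le_pow_left₀ (norm_nonneg _) h3 2).trans_eq ?_
      rw [div_pow, ← pow_mul, mul_comm (m : ℕ) 2]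
      norm_num
    have cK : Continuous (ker m ρ 0) := continuous_expSol _ ρ 0
    have := intervalIntegral.integral_mono_on (μ := volume) (a := (0 : ℝ)) (b := 1) (by norm_num)
      (Continuous.intervalIntegrable (by fun_prop) _ _)
      (Continuous.intervalIntegrable continuous_const _ _) hb2
    simp only [intervalIntegral.integral_const, sub_zero, one_smul] at this
    rwa [le_div_iff₀ (by positivity)] at this

/-! ### Plancherel's theorem in the frequency variable `ρ` -/

lemma sq_eLpNorm_two {α E : Type*} [MeasurableSpace α] [NormedAddCommGroup E] (f : α → E)
    (μ : Measure α) : eLpNorm f 2 μ ^ 2 = ∫⁻ a, ‖f a‖ₑ ^ 2 ∂μ := by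
  have h := eLpNorm_nnreal_pow_eq_lintegral (f := f) (p := 2) (μ := μ) two_ne_zero
  simpa using h

/-- The integral transform and the `L²` transform of `g` define the same distribution, hence agree
almost everywhere, and the latter is an isometry. -/
lemma eLpNorm_fourier {g : ℝ → ℂ} (h1 : Integrable g) (h2 : MemLp g 2) :
    eLpNorm (𝓕 g) 2 = eLpNorm g 2 := by
  set G := h2.toLp g with hG
  have hc : Continuous (𝓕 g) :=
    VectorFourier.fourierIntegral_continuous Real.continuous_fourierChar (by fun_prop) h1
  have hdist := Lp.fourier_toTemperedDistribution_eq G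
  have hae : ∀ᵐ x, 𝓕 g x = (𝓕 G : Lp ℂ 2 (volume : Measure ℝ)) x := by
    refine ae_eq_of_integral_contDiff_smul_eq hc.locallyIntegrable
      ((Lp.memLp (𝓕 G : Lp ℂ 2 (volume : Measure ℝ))).locallyIntegrable (by norm_num))
      fun φ hφ hφc => ?_
    have hφ' : ContDiff ℝ ∞ (fun x => (φ x : ℂ)) := Complex.ofRealCLM.contDiff.comp hφ
    have hφc' : HasCompactSupport (fun x => (φ x : ℂ)) :=
      hφc.comp_left (g := fun r : ℝ => (r : ℂ)) (by simp)
    set Φ : 𝓢(ℝ, ℂ) := hφc'.toSchwartzMap hφ' with hΦ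
    have hΦx : ∀ x, Φ x = φ x := fun x => rfl
    have e := congrArg (fun T : 𝓢'(ℝ, ℂ) => T Φ) hdist
    simp only [TemperedDistribution.fourier_apply, Lp.toTemperedDistribution_apply] at e
    have e1 : ∫ x, (𝓕 Φ) x • G x = ∫ x, (𝓕 Φ) x • g x := by
      refine integral_congr_ae ?_
      filter_upwards [h2.coeFn_toLp] with x hx
      rw [hx]
    have e2 := VectorFourier.integral_fourierIntegral_smul_eq_flip (𝕜 := ℝ) (V := ℝ) (W := ℝ)
      (e := Real.fourierChar) (μ := volume) (ν := volume) (L := innerₗ ℝ)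
      (f := (Φ : ℝ → ℂ)) (g := g) Real.continuous_fourierChar (by fun_prop) Φ.integrable h1
    have e3 : ∫ x, (𝓕 Φ) x • g x = ∫ x, Φ x • 𝓕 g x := by
      simpa [SchwartzMap.fourier_coe, Real.fourier_eq, VectorFourier.fourierIntegral,
        mul_comm] using e2
    rw [e1, e3] at e
    simpa only [hΦx, Complex.real_smul, smul_eq_mul] using e
  rw [eLpNorm_congr_ae hae, ← Lp.enorm_def, ← ofReal_norm, Lp.norm_fourier_eq, ofReal_norm,
    Lp.enorm_def]
  exact eLpNorm_congr_ae h2.coeFn_toLp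

lemma lintegral_fourierInv {g : ℝ → ℂ} (h1 : Integrable g) (h2 : MemLp g 2) :
    ∫⁻ t, ‖𝓕⁻ g t‖ₑ ^ 2 = ∫⁻ ξ, ‖g ξ‖ₑ ^ 2 := by
  rw [← sq_eLpNorm_two g, ← eLpNorm_fourier h1 h2, sq_eLpNorm_two]
  have := (Measure.measurePreserving_neg (volume : Measure ℝ)).lintegral_comp_emb
    (Homeomorph.neg ℝ).measurableEmbedding (fun t => ‖𝓕 g t‖ₑ ^ 2)
  rw [← this]
  simp only [Real.fourierInv_eq_fourier_neg]

/-- The frequency as a function of `ρ`, in the normalisation of the Fourier transform. -/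
def freq (ρ : ℝ) : ℝ := (2 * Real.pi)⁻¹ * (ρ ^ 3 - ρ)

lemma hasDerivAt_freq (ρ : ℝ) : HasDerivAt freq ((2 * Real.pi)⁻¹ * (3 * ρ ^ 2 - 1)) ρ := by
  have h := (((hasDerivAt_pow 3 ρ).sub (hasDerivAt_id ρ)).const_mul (2 * Real.pi)⁻¹)
  exact h.congr_deriv (by simp)

lemma strictMonoOn_freq : StrictMonoOn freq (Ici 1) := by
  intro a ha b _ hab
  have ha' : (1 : ℝ) ≤ a := ha
  have hb' : (1 : ℝ) < b := lt_of_le_of_lt ha' hab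
  refine mul_lt_mul_of_pos_left ?_ (by positivity)
  nlinarith [mul_pos (sub_pos.2 hab) (show 0 < a ^ 2 + a * b + b ^ 2 - 1 by nlinarith)]

lemma two_pi_mul_freq (ρ : ℝ) : 2 * Real.pi * freq ρ = ρ ^ 3 - ρ := by
  rw [freq, mul_inv_cancel_left₀ (by positivity)]

lemma abs_deriv_freq {ρ : ℝ} (h : 1 ≤ ρ) :
    |(2 * Real.pi)⁻¹ * (3 * ρ ^ 2 - 1)| = (2 * Real.pi)⁻¹ * (3 * ρ ^ 2 - 1) :=
  abs_of_nonneg (mul_nonneg (by positivity) (by nlinarith))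

lemma integrableOn_image_freq {F : Type*} [NormedAddCommGroup F] [NormedSpace ℝ F] {S : Set ℝ}
    (hS : MeasurableSet S) (hS1 : S ⊆ Ici 1) (g : ℝ → F) :
    IntegrableOn g (freq '' S) ↔
      IntegrableOn (fun ρ => ((2 * Real.pi)⁻¹ * (3 * ρ ^ 2 - 1)) • g (freq ρ)) S := by
  rw [integrableOn_image_iff_integrableOn_abs_deriv_smul hS
    (fun ρ _ => (hasDerivAt_freq ρ).hasDerivWithinAt) (strictMonoOn_freq.injOn.mono hS1)]
  exact integrableOn_congr_fun (fun ρ hρ => by rw [abs_deriv_freq (hS1 hρ)]) hS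

lemma integral_image_freq {F : Type*} [NormedAddCommGroup F] [NormedSpace ℝ F] {S : Set ℝ}
    (hS : MeasurableSet S) (hS1 : S ⊆ Ici 1) (g : ℝ → F) :
    ∫ ξ in freq '' S, g ξ = ∫ ρ in S, ((2 * Real.pi)⁻¹ * (3 * ρ ^ 2 - 1)) • g (freq ρ) := by
  rw [integral_image_eq_integral_abs_deriv_smul hS
    (fun ρ _ => (hasDerivAt_freq ρ).hasDerivWithinAt) (strictMonoOn_freq.injOn.mono hS1)]
  exact setIntegral_congr_fun hS (fun ρ hρ => by rw [abs_deriv_freq (hS1 hρ)])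

lemma lintegral_image_freq {S : Set ℝ}
    (hS : MeasurableSet S) (hS1 : S ⊆ Ici 1) (g : ℝ → ℝ≥0∞) :
    ∫⁻ ξ in freq '' S, g ξ =
      ∫⁻ ρ in S, ENNReal.ofReal ((2 * Real.pi)⁻¹ * (3 * ρ ^ 2 - 1)) * g (freq ρ) := by
  rw [lintegral_image_eq_lintegral_abs_deriv_mul hS
    (fun ρ _ => (hasDerivAt_freq ρ).hasDerivWithinAt) (strictMonoOn_freq.injOn.mono hS1)]
  exact setLIntegral_congr_fun hS (fun ρ hρ => by rw [abs_deriv_freq (hS1 hρ)])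

lemma measurableSet_image_freq {S : Set ℝ} (hS : MeasurableSet S) (hS1 : S ⊆ Ici 1) :
    MeasurableSet (freq '' S) :=
  measurable_image_of_fderivWithin hS
    (fun ρ _ => (hasDerivAt_freq ρ).hasDerivWithinAt.hasFDerivWithinAt)
    (strictMonoOn_freq.injOn.mono hS1)

/-- Plancherel's theorem (as an inequality) for oscillatory integrals with phase `(ρ³ - ρ) t`. -/
lemma lintegral_oscillatory_le {S : Set ℝ} (hS : MeasurableSet S) (hS1 : S ⊆ Ici 1) {A : ℝ → ℂ}
    (hA : IntegrableOn (fun ρ => ((3 * ρ ^ 2 - 1 : ℝ) : ℂ) * A ρ) S) :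
    ∫⁻ t : ℝ, ‖1 / (2 * (Real.pi : ℂ)) * ∫ ρ in S, ((3 * ρ ^ 2 - 1 : ℝ) : ℂ) *
        (Complex.exp (Complex.I * ((ρ ^ 3 - ρ : ℝ) : ℂ) * (t : ℂ)) * A ρ)‖ₑ ^ 2 ≤
      ∫⁻ ρ in S, ENNReal.ofReal ((2 * Real.pi)⁻¹ * (3 * ρ ^ 2 - 1)) * ‖A ρ‖ₑ ^ 2 := by
  have hinj := strictMonoOn_freq.injOn.mono hS1
  -- The amplitude as a function of the true frequency, extended by zero: the oscillatory integral
  -- is its inverse Fourier transform.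
  set a : ℝ → ℂ := (freq '' S).indicator fun ξ => A (Function.invFunOn freq S ξ) with ha
  have haf : ∀ ρ ∈ S, a (freq ρ) = A ρ := by
    intro ρ hρ
    rw [ha, indicator_of_mem (mem_image_of_mem _ hρ), hinj.leftInvOn_invFunOn hρ]
  have hm := measurableSet_image_freq hS hS1
  have ha1 : Integrable a := by
    rw [← integrableOn_iff_integrable_of_support_subset (s := freq '' S)
      (by rw [ha]; exact support_indicator_subset), integrableOn_image_freq hS hS1]
    refine (integrableOn_congr_fun (fun ρ hρ => ?_) hS).2 (hA.const_mul (1 / (2 * (Real.pi : ℂ))))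
    rw [haf ρ hρ, Complex.real_smul]
    push_cast
    field_simp
  have hnorm : ∫⁻ ξ, ‖a ξ‖ₑ ^ 2 =
      ∫⁻ ρ in S, ENNReal.ofReal ((2 * Real.pi)⁻¹ * (3 * ρ ^ 2 - 1)) * ‖A ρ‖ₑ ^ 2 := by
    rw [← setLIntegral_congr_fun hS (f := fun ρ =>
      ENNReal.ofReal ((2 * Real.pi)⁻¹ * (3 * ρ ^ 2 - 1)) * ‖a (freq ρ)‖ₑ ^ 2)
      (fun ρ hρ => by simp only [haf ρ hρ]), ← lintegral_image_freq hS hS1 fun ξ => ‖a ξ‖ₑ ^ 2,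
      ← lintegral_indicator hm]
    congr 1 with ξ
    by_cases h : ξ ∈ freq '' S
    · rw [indicator_of_mem h]
    · rw [indicator_of_notMem h, ha, indicator_of_notMem h]; simp
  rw [← hnorm]
  -- If the right side is infinite nothing is claimed; otherwise `a` is also square integrable and
  -- equality holds.
  by_cases htop : ∫⁻ ξ, ‖a ξ‖ₑ ^ 2 = ⊤
  · rw [htop]; exact le_top
  have ha2 : MemLp a 2 := by
    refine ⟨ha1.1, ?_⟩
    rw [← sq_eLpNorm_two] at htop
    rw [lt_top_iff_ne_top]
    intro h
    exact htop (by rw [h]; rfl)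
  rw [← lintegral_fourierInv ha1 ha2]
  refine le_of_eq (lintegral_congr fun t => ?_)
  congr 2
  have e : 𝓕⁻ a t = ∫ ξ in freq '' S, Complex.exp (2 * Real.pi * Complex.I * (t * ξ)) * a ξ := by
    rw [Real.fourierInv_eq', setIntegral_eq_integral_of_forall_compl_eq_zero]
    · refine integral_congr_ae (Eventually.of_forall fun ξ => ?_)
      simp only [smul_eq_mul]
      congr 2
      simp
      ring
    · intro ξ hξ
      rw [ha, indicator_of_notMem hξ, mul_zero]
  rw [e, integral_image_freq hS hS1, ← integral_const_mul]
  refine setIntegral_congr_fun hS fun ρ hρ => ?_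
  simp only [haf ρ hρ, Complex.real_smul]
  have e2 : Complex.I * ((ρ ^ 3 - ρ : ℝ) : ℂ) * (t : ℂ) =
      2 * Real.pi * Complex.I * (t * (freq ρ : ℂ)) := by
    rw [← two_pi_mul_freq]; push_cast; ring
  rw [e2]
  push_cast
  field_simp

/-! ### Boundary data on the frequency side -/

/-- A real test function on the line as a complex Schwartz function. -/
def realTest {φ : ℝ → ℝ} (hφ : ContDiff ℝ ∞ φ) (hφc : HasCompactSupport φ) : 𝓢(ℝ, ℂ) :=
  (hφc.comp_left (g := fun r : ℝ => (r : ℂ)) (by simp)).toSchwartzMap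
    (Complex.ofRealCLM.contDiff.comp hφ)

lemma realTest_apply {φ : ℝ → ℝ} (hφ : ContDiff ℝ ∞ φ) (hφc : HasCompactSupport φ) (x : ℝ) :
    realTest hφ hφc x = (φ x : ℂ) := rfl

lemma isLaplaceOnAxis_laplaceOnAxis {r : ℝ} {h : 𝓢'(ℝ, ℂ)}
    (hh : TemperedDistribution.MemSobolev r 2 h) : IsLaplaceOnAxis h (laplaceOnAxis h) := by
  have hex := exists_isLaplaceOnAxis hh
  rw [laplaceOnAxis, dif_pos hex]
  exact hex.choose_spec

/-- The Fourier transform of the boundary data, as a function. -/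
def dataFourier (h : 𝓢'(ℝ, ℂ)) (ξ : ℝ) : ℂ := laplaceOnAxis h (2 * Real.pi * ξ)

lemma dataFourier_freq (h : 𝓢'(ℝ, ℂ)) (ρ : ℝ) :
    dataFourier h (freq ρ) = laplaceOnAxis h (ρ ^ 3 - ρ) := by
  rw [dataFourier, two_pi_mul_freq]

section Data

variable {r : ℝ} {h : 𝓢'(ℝ, ℂ)}

lemma dataFourier_pair (hh : TemperedDistribution.MemSobolev r 2 h) (φ : 𝓢(ℝ, ℂ)) :
    Integrable (fun ξ => φ ξ * dataFourier h ξ) ∧ (𝓕 h) φ = ∫ ξ, φ ξ * dataFourier h ξ :=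
  (isLaplaceOnAxis_laplaceOnAxis hh).2 φ

lemma locallyIntegrable_dataFourier (hh : TemperedDistribution.MemSobolev r 2 h) :
    LocallyIntegrable (dataFourier h) := by
  rw [locallyIntegrable_iff]
  intro K hK
  obtain ⟨R, hR⟩ := hK.isBounded.subset_closedBall 0
  let χ : ContDiffBump (0 : ℝ) := ⟨max R 1, max R 1 + 1, by positivity, by linarith⟩
  have h1 := (dataFourier_pair hh (realTest χ.contDiff χ.hasCompactSupport)).1
  refine (h1.integrableOn (s := K)).congr_fun (fun ξ hξ => ?_) hK.measurableSet
  simp only [realTest_apply]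
  rw [χ.one_of_mem_closedBall (Metric.closedBall_subset_closedBall (le_max_left _ _) (hR hξ)),
    Complex.ofReal_one, one_mul]

/-- Tested against smooth functions, the weighted transform agrees with the `L²` function that the
Sobolev condition provides. -/
lemma memLp_dataFourier (hh : TemperedDistribution.MemSobolev r 2 h) :
    MemLp (fun ξ => (((1 + ξ ^ 2) ^ (r / 2) : ℝ) : ℂ) * dataFourier h ξ) 2 := by
  obtain ⟨f', hf⟩ := TemperedDistribution.memSobolev_iff_exists_smulLeftCLM_fourier.mp hh
  have hw : (fun x : ℝ => (((1 + ‖x‖ ^ 2) ^ (r / 2) : ℝ) : ℂ)).HasTemperateGrowth := by fun_prop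
  have hn : ∀ x : ℝ, ‖x‖ ^ 2 = x ^ 2 := fun x => by simp
  have hwc : Continuous fun x : ℝ => (((1 + x ^ 2) ^ (r / 2) : ℝ) : ℂ) := by
    simpa only [hn] using hw.1.continuous
  refine (Lp.memLp f').ae_eq ?_
  refine ae_eq_of_integral_contDiff_smul_eq ((Lp.memLp f').locallyIntegrable (by norm_num))
    (LocallyIntegrable.continuous_mul hwc (locallyIntegrable_dataFourier hh)) fun φ hφ hφc => ?_
  have e := congrArg (fun T : 𝓢'(ℝ, ℂ) => T (realTest hφ hφc)) hf
  simp only [TemperedDistribution.smulLeftCLM_apply_apply, Lp.toTemperedDistribution_apply] at e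
  rw [(dataFourier_pair hh _).2] at e
  simp only [SchwartzMap.smulLeftCLM_apply_apply hw, realTest_apply, smul_eq_mul] at e
  simp only [hn] at e
  simp only [Complex.real_smul]
  rw [← e]
  refine integral_congr_ae (Eventually.of_forall fun x => ?_)
  dsimp only
  ring

/-- Pointwise complex conjugation of a Schwartz function. -/
def conjTest (Θ : 𝓢(ℝ, ℂ)) : 𝓢(ℝ, ℂ) :=
  SchwartzMap.postcompCLM (𝕜 := ℝ) (Complex.conjCLE : ℂ →L[ℝ] ℂ) Θ

lemma conjTest_apply (Θ : 𝓢(ℝ, ℂ)) (x : ℝ) : conjTest Θ x = (starRingEnd ℂ) (Θ x) := rfl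

lemma MemHZero.map_conj (hh : MemHZero r h) (Θ : 𝓢(ℝ, ℂ)) :
    h (conjTest Θ) = (starRingEnd ℂ) (h Θ) := by
  have h1 := hh.real (Θ + conjTest Θ) fun t => by simp [conjTest_apply]
  have h2 := hh.real (-Complex.I • (Θ - conjTest Θ)) fun t => by simp [conjTest_apply]
  simp only [map_add, map_sub, map_smul, Complex.add_im, smul_eq_mul, Complex.mul_im,
    Complex.neg_re, Complex.neg_im, Complex.I_re, Complex.I_im, Complex.sub_re, Complex.sub_im] at h1 h2
  refine Complex.ext ?_ ?_
  · rw [Complex.conj_re]; linarith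
  · rw [Complex.conj_im]; linarith

/-- Real data have a conjugate-symmetric spectrum. This is why positive frequencies, that is `ρ >
1`, suffice. -/
lemma MemHZero.dataFourier_neg (hh : MemHZero r h) :
    ∀ᵐ ξ, dataFourier h (-ξ) = (starRingEnd ℂ) (dataFourier h ξ) := by
  have hl := locallyIntegrable_dataFourier hh.sobolev
  have hln : LocallyIntegrable fun ξ => dataFourier h (-ξ) := by
    rw [locallyIntegrable_iff]
    intro K hK
    have h1 := hl.integrableOn_isCompact (hK.image continuous_neg)
    have e : (fun x : ℝ => -x) ⁻¹' ((fun x : ℝ => -x) '' K) = K :=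
      preimage_image_eq _ neg_injective
    have := (Measure.measurePreserving_neg (volume : Measure ℝ)).integrableOn_comp_preimage
      (Homeomorph.neg ℝ).measurableEmbedding (f := dataFourier h) (s := (fun x : ℝ => -x) '' K)
    have h2 := this.2 h1
    change IntegrableOn _ ((fun x : ℝ => -x) ⁻¹' ((fun x : ℝ => -x) '' K)) _ at h2
    rw [e] at h2
    exact h2
  have hlc : LocallyIntegrable fun ξ => (starRingEnd ℂ) (dataFourier h ξ) := by
    rw [locallyIntegrable_iff]
    intro K hK
    exact Complex.conjLIE.integrable_comp_iff.2 (hl.integrableOn_isCompact hK)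
  refine ae_eq_of_integral_contDiff_smul_eq hln hlc fun φ hφ hφc => ?_
  set Φ := realTest hφ hφc
  have hφ' : ContDiff ℝ ∞ fun x => φ (-x) := hφ.comp contDiff_neg
  have hφc' : HasCompactSupport fun x => φ (-x) := hφc.comp_homeomorph (Homeomorph.neg ℝ)
  set Ψ := realTest hφ' hφc'
  -- Reflecting a real test function conjugates its transform, and real data commute with
  -- conjugation of test functions.
  have hF : 𝓕 Ψ = conjTest (𝓕 Φ) := by
    ext x
    rw [conjTest_apply, SchwartzMap.fourier_coe, SchwartzMap.fourier_coe, Real.fourier_eq',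
      Real.fourier_eq', ← integral_conj, ← integral_neg_eq_self]
    refine integral_congr_ae (Eventually.of_forall fun ξ => ?_)
    simp only [Ψ, Φ, realTest_apply, smul_eq_mul, map_mul, ← Complex.exp_conj, neg_neg]
    congr 2
    · simp [Complex.conj_ofNat]
    · exact (Complex.conj_ofReal _).symm
  have e1 : ∫ x, φ x • dataFourier h (-x) = (𝓕 h) Ψ := by
    rw [(dataFourier_pair hh.sobolev Ψ).2, ← integral_neg_eq_self]
    refine integral_congr_ae (Eventually.of_forall fun ξ => ?_)
    simp [Ψ, realTest_apply]
  have e2 : ∫ x, φ x • (starRingEnd ℂ) (dataFourier h x) = (starRingEnd ℂ) ((𝓕 h) Φ) := by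
    rw [(dataFourier_pair hh.sobolev Φ).2, ← integral_conj]
    refine integral_congr_ae (Eventually.of_forall fun ξ => ?_)
    simp [Φ, realTest_apply]
  rw [e1, e2, TemperedDistribution.fourier_apply, TemperedDistribution.fourier_apply, hF,
    hh.map_conj]

lemma image_freq_Ioi : freq '' Ioi 1 = Ioi 0 := by
  have hc : Continuous freq := by unfold freq; fun_prop
  have h1 : freq 1 = 0 := by simp [freq]
  ext ξ
  constructor
  · rintro ⟨ρ, hρ, rfl⟩
    rw [mem_Ioi, ← h1]
    exact strictMonoOn_freq (by simp) (mem_Ici.2 (le_of_lt hρ)) hρ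
  · intro hξ
    have hξ' : 0 < ξ := hξ
    -- Any point with `R³ - R ≥ 2πξ` serves for the intermediate value theorem; here already `R - 2
    -- = 2πξ`.
    set R := 2 + 2 * Real.pi * ξ with hR
    have hR2 : 2 ≤ R := by rw [hR]; have := Real.pi_pos; nlinarith [mul_pos this hξ']
    have hfR : ξ ≤ freq R := by
      rw [freq, inv_mul_eq_div, le_div_iff₀ (by positivity)]
      have : 2 * Real.pi * ξ = R - 2 := by rw [hR]; ring
      nlinarith [mul_nonneg (by linarith : 0 ≤ R) (by nlinarith : 0 ≤ R ^ 2 - 4)]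
    obtain ⟨ρ, hρ, hρξ⟩ := intermediate_value_Icc (by linarith : (1 : ℝ) ≤ R) hc.continuousOn
      ⟨by rw [h1]; exact hξ'.le, hfR⟩
    refine ⟨ρ, lt_of_le_of_ne hρ.1 fun h => ?_, hρξ⟩
    rw [← h, h1] at hρξ
    exact hξ'.ne hρξ

/-- The oscillatory integral of a test function. -/
def oscTest (ψ : ℝ → ℝ) (ρ : ℝ) : ℂ :=
  ∫ t : ℝ, Complex.exp (Complex.I * ((ρ ^ 3 - ρ : ℝ) : ℂ) * (t : ℂ)) * (ψ t : ℂ)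

lemma fourierInv_realTest_freq {ψ : ℝ → ℝ} (hψ : ContDiff ℝ ∞ ψ) (hψc : HasCompactSupport ψ)
    (ρ : ℝ) : (𝓕⁻ (realTest hψ hψc)) (freq ρ) = oscTest ψ ρ := by
  rw [SchwartzMap.fourierInv_coe, Real.fourierInv_eq', oscTest]
  refine integral_congr_ae (Eventually.of_forall fun t => ?_)
  simp only [realTest_apply, smul_eq_mul]
  congr 2
  rw [← two_pi_mul_freq]
  simp
  ring

lemma integrableOn_data_oscTest (hh : MemHZero r h) {ψ : ℝ → ℝ} (hψ : ContDiff ℝ ∞ ψ)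
    (hψc : HasCompactSupport ψ) :
    IntegrableOn (fun ρ => ((3 * ρ ^ 2 - 1 : ℝ) : ℂ) *
      (laplaceOnAxis h (ρ ^ 3 - ρ) * oscTest ψ ρ)) (Ioi 1) := by
  have h1 := (dataFourier_pair hh.sobolev (𝓕⁻ (realTest hψ hψc))).1.integrableOn (s := freq '' Ioi 1)
  rw [integrableOn_image_freq measurableSet_Ioi Ioi_subset_Ici_self] at h1
  refine IntegrableOn.congr_fun (h1.const_mul (2 * Real.pi : ℂ)) (fun ρ _ => ?_) measurableSet_Ioi
  simp only [Complex.real_smul]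
  rw [fourierInv_realTest_freq, dataFourier_freq]
  push_cast
  field_simp

/-- The pairing of real boundary data with a real test function, on the frequency side. -/
lemma MemHZero.pair_eq (hh : MemHZero r h) {ψ : ℝ → ℝ} (hψ : ContDiff ℝ ∞ ψ)
    (hψc : HasCompactSupport ψ) :
    pair h (fun t => (ψ t : ℂ)) =
      ((2 * (1 / (2 * (Real.pi : ℂ)) * ∫ ρ in Ioi (1 : ℝ), ((3 * ρ ^ 2 - 1 : ℝ) : ℂ) *
        (laplaceOnAxis h (ρ ^ 3 - ρ) * oscTest ψ ρ)).re : ℝ) : ℂ) := by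
  set Φ := realTest hψ hψc with hΦ
  have e0 : pair h (fun t => (ψ t : ℂ)) = h Φ := by
    rw [pair, dif_pos ⟨hψc.comp_left (g := fun r : ℝ => (r : ℂ)) (by simp),
      Complex.ofRealCLM.contDiff.comp hψ⟩]
    rfl
  obtain ⟨hint, hval⟩ := dataFourier_pair hh.sobolev (𝓕⁻ Φ)
  rw [TemperedDistribution.fourier_apply, FourierTransform.fourier_fourierInv_eq] at hval
  have hneg : ∀ ξ, (𝓕⁻ Φ) (-ξ) = (starRingEnd ℂ) ((𝓕⁻ Φ) ξ) := by
    intro ξ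
    rw [SchwartzMap.fourierInv_coe, Real.fourierInv_eq', Real.fourierInv_eq', ← integral_conj]
    refine integral_congr_ae (Eventually.of_forall fun t => ?_)
    simp only [hΦ, realTest_apply, smul_eq_mul, map_mul, ← Complex.exp_conj]
    congr 2
    · simp [Complex.conj_ofNat]
    · exact (Complex.conj_ofReal _).symm
  -- Both factors are conjugate symmetric, so the negative half line contributes the conjugate and
  -- the total is twice a real part.
  have hIic : ∫ ξ in Iic (0 : ℝ), (𝓕⁻ Φ) ξ * dataFourier h ξ =
      (starRingEnd ℂ) (∫ ξ in Ioi (0 : ℝ), (𝓕⁻ Φ) ξ * dataFourier h ξ) := by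
    have := integral_comp_neg_Ioi (0 : ℝ) (fun ξ => (𝓕⁻ Φ) ξ * dataFourier h ξ)
    rw [neg_zero] at this
    rw [← this, ← integral_conj]
    refine setIntegral_congr_ae measurableSet_Ioi ?_
    filter_upwards [hh.dataFourier_neg] with ξ hξ _
    rw [hneg, hξ, map_mul]
  have hIoi : ∫ ξ in Ioi (0 : ℝ), (𝓕⁻ Φ) ξ * dataFourier h ξ =
      1 / (2 * (Real.pi : ℂ)) * ∫ ρ in Ioi (1 : ℝ), ((3 * ρ ^ 2 - 1 : ℝ) : ℂ) *
        (laplaceOnAxis h (ρ ^ 3 - ρ) * oscTest ψ ρ) := by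
    rw [← image_freq_Ioi, integral_image_freq measurableSet_Ioi Ioi_subset_Ici_self,
      ← integral_const_mul]
    refine setIntegral_congr_fun measurableSet_Ioi fun ρ _ => ?_
    simp only [Complex.real_smul]
    rw [fourierInv_realTest_freq, dataFourier_freq]
    push_cast
    field_simp
  rw [e0, hval, ← intervalIntegral.integral_Iic_add_Ioi hint.integrableOn hint.integrableOn (b := 0),
    hIic, hIoi, add_comm, Complex.add_conj]

lemma integrableOn_data (hh : TemperedDistribution.MemSobolev r 2 h) (R : ℝ) :
    IntegrableOn (fun ρ => ((3 * ρ ^ 2 - 1 : ℝ) : ℂ) * laplaceOnAxis h (ρ ^ 3 - ρ)) (Icc 1 R) := by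
  have hc : Continuous freq := by unfold freq; fun_prop
  have h1 := (locallyIntegrable_dataFourier hh).integrableOn_isCompact
    ((isCompact_Icc (a := (1 : ℝ)) (b := R)).image hc)
  rw [integrableOn_image_freq measurableSet_Icc Icc_subset_Ici_self] at h1
  refine IntegrableOn.congr_fun (h1.const_mul (2 * Real.pi : ℂ)) (fun ρ _ => ?_) measurableSet_Icc
  simp only [Complex.real_smul]
  rw [dataFourier_freq]
  push_cast
  field_simp

/-- Frequency is at most of order `ρ³`, so `ρ^{-2m}` is dominated by `(1 + ξ²)^{-m/3}`, which the
Sobolev weight `(1 + ξ²)^r` controls. -/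
lemma lintegral_data_lt_top (hh : TemperedDistribution.MemSobolev r 2 h) (m : Fin 3)
    (hr : -((m : ℕ) : ℝ) / 3 ≤ r) :
    ∫⁻ ρ in Ioi (1 : ℝ), ENNReal.ofReal ((2 * Real.pi)⁻¹ * (3 * ρ ^ 2 - 1)) *
      (ENNReal.ofReal (1 / ρ ^ (2 * (m : ℕ))) * ‖laplaceOnAxis h (ρ ^ 3 - ρ)‖ₑ ^ 2) < ⊤ := by
  have h1 := memLp_dataFourier hh
  have h2 : ∫⁻ ξ in freq '' Ioi 1,
      ‖(((1 + ξ ^ 2) ^ (r / 2) : ℝ) : ℂ) * dataFourier h ξ‖ₑ ^ 2 < ⊤ := by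
    refine (setLIntegral_le_lintegral _ _).trans_lt ?_
    rw [← sq_eLpNorm_two]
    exact ENNReal.pow_lt_top h1.2
  rw [lintegral_image_freq measurableSet_Ioi Ioi_subset_Ici_self] at h2
  have h3 := ENNReal.mul_lt_top (show ENNReal.ofReal 2 < ⊤ from ENNReal.ofReal_lt_top) h2
  refine lt_of_le_of_lt ?_ h3
  rw [← lintegral_const_mul' _ _ ENNReal.ofReal_ne_top]
  refine setLIntegral_mono' measurableSet_Ioi fun ρ hρ => ?_
  have hρ1 : (1 : ℝ) < ρ := hρ
  conv_rhs => rw [mul_left_comm]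
  refine mul_le_mul' le_rfl ?_
  rw [dataFourier_freq, enorm_mul, mul_pow, ← mul_assoc]
  refine mul_le_mul' ?_ le_rfl
  rw [← ofReal_norm, ← ENNReal.ofReal_pow (norm_nonneg _), ← ENNReal.ofReal_mul (by norm_num),
    Complex.norm_real]
  refine ENNReal.ofReal_le_ofReal ?_
  rw [Real.norm_eq_abs, sq_abs, ← Real.rpow_natCast (_ ^ (r / 2)), ← Real.rpow_mul (by positivity)]
  have hf0 : 0 ≤ freq ρ := mul_nonneg (by positivity) (by nlinarith [sq_nonneg ρ])
  have hf1 : freq ρ ≤ ρ ^ 3 := by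
    have hpi : (2 * Real.pi)⁻¹ ≤ 1 := inv_le_one_of_one_le₀ (by linarith [Real.pi_gt_three])
    have hp : 0 ≤ ρ ^ 3 - ρ := by nlinarith [sq_nonneg ρ]
    calc freq ρ ≤ 1 * (ρ ^ 3 - ρ) := mul_le_mul_of_nonneg_right hpi hp
      _ ≤ ρ ^ 3 := by linarith
  have hbase : 1 + freq ρ ^ 2 ≤ 2 * ρ ^ 6 := by
    have a1 : freq ρ ^ 2 ≤ (ρ ^ 3) ^ 2 := pow_le_pow_left₀ hf0 hf1 2
    have a2 : 1 ≤ ρ ^ 6 := one_le_pow₀ hρ1.le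
    nlinarith
  have hb1 : (1 : ℝ) ≤ 1 + freq ρ ^ 2 := by nlinarith [sq_nonneg (freq ρ)]
  set μ : ℝ := ((m : ℕ) : ℝ) / 3 with hμ
  have hμ0 : 0 ≤ μ := by positivity
  have hμ1 : μ ≤ 1 := by
    have : ((m : ℕ) : ℝ) ≤ 3 := by exact_mod_cast (by omega : (m : ℕ) ≤ 3)
    rw [hμ]; linarith
  -- The hypothesis `r ≥ -m/3` enters here; the rest compares `1 + ξ² ≤ 2ρ⁶` to the power `m/3 ≤ 1`.
  have c1 : (1 + freq ρ ^ 2) ^ (-μ) ≤ (1 + freq ρ ^ 2) ^ (r / 2 * (2 : ℕ)) :=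
    Real.rpow_le_rpow_of_exponent_le hb1 (by push_cast; rw [hμ]; linarith)
  have c2 : (1 + freq ρ ^ 2) ^ μ ≤ 2 * ρ ^ (2 * (m : ℕ)) := by
    calc (1 + freq ρ ^ 2) ^ μ ≤ (2 * ρ ^ 6) ^ μ := Real.rpow_le_rpow (by positivity) hbase hμ0
      _ = 2 ^ μ * (ρ ^ 6) ^ μ := Real.mul_rpow (by norm_num) (by positivity)
      _ ≤ 2 * ρ ^ (2 * (m : ℕ)) := by
        have d1 : (2 : ℝ) ^ μ ≤ 2 := by
          simpa using Real.rpow_le_rpow_of_exponent_le (by norm_num : (1 : ℝ) ≤ 2) hμ1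
        have d2 : (ρ ^ 6) ^ μ = ρ ^ (2 * (m : ℕ)) := by
          rw [← Real.rpow_natCast, ← Real.rpow_mul (by linarith), ← Real.rpow_natCast]
          congr 1
          rw [hμ]; push_cast; ring
        rw [d2]
        gcongr
  refine le_trans ?_ (mul_le_mul_of_nonneg_left c1 (by norm_num))
  rw [Real.rpow_neg (by positivity), ← div_eq_mul_inv,
    div_le_div_iff₀ (by positivity) (by positivity), one_mul]
  exact c2

end Data

/-! ### Calculus of test functions -/

section TestFunctions

variable {φ : ℝ × ℝ → ℝ}

lemma dx_zero (φ : ℝ × ℝ → ℝ) : dx 0 φ = φ := by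
  ext p
  simp [dx]

lemma dx_succ_eq_deriv (k : ℕ) (φ : ℝ × ℝ → ℝ) (x t : ℝ) :
    dx (k + 1) φ (x, t) = deriv (fun y => dx k φ (y, t)) x := by
  simp only [dx, iteratedDeriv_succ]

lemma hasDerivAt_fst {g : ℝ × ℝ → ℝ} (hg : ContDiff ℝ ∞ g) (x t : ℝ) :
    HasDerivAt (fun y => g (y, t)) (fderiv ℝ g (x, t) (1, 0)) x :=
  ((hg.differentiable (by simp)) (x, t)).hasFDerivAt.comp_hasDerivAt x
    ((hasDerivAt_id x).prodMk (hasDerivAt_const x t))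

lemma hasDerivAt_snd {g : ℝ × ℝ → ℝ} (hg : ContDiff ℝ ∞ g) (x t : ℝ) :
    HasDerivAt (fun r => g (x, r)) (fderiv ℝ g (x, t) (0, 1)) t :=
  ((hg.differentiable (by simp)) (x, t)).hasFDerivAt.comp_hasDerivAt t
    ((hasDerivAt_const t x).prodMk (hasDerivAt_id t))

lemma contDiff_fderiv_apply {g : ℝ × ℝ → ℝ} (hg : ContDiff ℝ ∞ g) (e : ℝ × ℝ) :
    ContDiff ℝ ∞ fun p => fderiv ℝ g p e :=
  (hg.fderiv_right (m := ∞) (by simp)).clm_apply contDiff_const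

lemma contDiff_dx (hφ : ContDiff ℝ ∞ φ) (k : ℕ) : ContDiff ℝ ∞ (dx k φ) := by
  induction k with
  | zero => rwa [dx_zero]
  | succ k ih =>
    have e : dx (k + 1) φ = fun p => fderiv ℝ (dx k φ) p (1, 0) := by
      ext ⟨x, t⟩
      rw [dx_succ_eq_deriv, (hasDerivAt_fst ih x t).deriv]
    rw [e]
    exact contDiff_fderiv_apply ih _

lemma hasDerivAt_dx (hφ : ContDiff ℝ ∞ φ) (k : ℕ) (x t : ℝ) :
    HasDerivAt (fun y => dx k φ (y, t)) (dx (k + 1) φ (x, t)) x := by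
  rw [dx_succ_eq_deriv]
  exact (hasDerivAt_fst (contDiff_dx hφ k) x t).differentiableAt.hasDerivAt

lemma hasCompactSupport_dx (hφ : ContDiff ℝ ∞ φ) (hc : HasCompactSupport φ) (k : ℕ) :
    HasCompactSupport (dx k φ) := by
  induction k with
  | zero => rwa [dx_zero]
  | succ k ih =>
    have e : dx (k + 1) φ = fun p => fderiv ℝ (dx k φ) p (1, 0) := by
      ext ⟨x, t⟩
      rw [dx_succ_eq_deriv, (hasDerivAt_fst (contDiff_dx hφ k) x t).deriv]
    rw [e]
    exact ih.fderiv_apply ℝ _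

lemma dt_eq (hφ : ContDiff ℝ ∞ φ) : dt φ = fun p => fderiv ℝ φ p (0, 1) := by
  ext ⟨x, t⟩
  exact (hasDerivAt_snd hφ x t).deriv

lemma contDiff_dt (hφ : ContDiff ℝ ∞ φ) : ContDiff ℝ ∞ (dt φ) := by
  rw [dt_eq hφ]
  exact contDiff_fderiv_apply hφ _

lemma hasDerivAt_dt (hφ : ContDiff ℝ ∞ φ) (x t : ℝ) :
    HasDerivAt (fun r => φ (x, r)) (dt φ (x, t)) t := by
  rw [dt_eq hφ]
  exact hasDerivAt_snd hφ x t

lemma hasCompactSupport_dt (hφ : ContDiff ℝ ∞ φ) (hc : HasCompactSupport φ) :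
    HasCompactSupport (dt φ) := by
  rw [dt_eq hφ]
  exact hc.fderiv_apply ℝ _

lemma hasCompactSupport_slice {g : ℝ × ℝ → ℝ} (hc : HasCompactSupport g) (x : ℝ) :
    HasCompactSupport fun t => g (x, t) := by
  refine HasCompactSupport.intro (hc.isCompact.image continuous_snd) fun t ht => ?_
  exact image_eq_zero_of_notMem_tsupport fun h => ht ⟨(x, t), h, rfl⟩

lemma contDiff_slice {g : ℝ × ℝ → ℝ} (hg : ContDiff ℝ ∞ g) (x : ℝ) :
    ContDiff ℝ ∞ fun t => g (x, t) := hg.comp (by fun_prop)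

/-- The adjoint differential operator `φ ↦ φ_t + φ_x + φ_xxx`. -/
def adjL (φ : ℝ × ℝ → ℝ) (p : ℝ × ℝ) : ℝ := dt φ p + dx 1 φ p + dx 3 φ p

lemma IsTest.continuous_adjL (hφ : IsTest φ) : Continuous (adjL φ) :=
  (((contDiff_dt hφ.smooth).continuous.add (contDiff_dx hφ.smooth 1).continuous)).add
    (contDiff_dx hφ.smooth 3).continuous

lemma IsTest.hasCompactSupport_adjL (hφ : IsTest φ) : HasCompactSupport (adjL φ) :=
  ((hasCompactSupport_dt hφ.smooth hφ.compact).add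
    (hasCompactSupport_dx hφ.smooth hφ.compact 1)).add (hasCompactSupport_dx hφ.smooth hφ.compact 3)

lemma eq_zero_of_forall_ge {T' : ℝ} (h : ∀ p : ℝ × ℝ, T' ≤ p.2 → φ p = 0) (k : ℕ) (p : ℝ × ℝ)
    (hp : T' ≤ p.2) : dx k φ p = 0 := by
  have e : (fun y => φ (y, p.2)) = fun _ => 0 := funext fun y => h (y, p.2) hp
  simp [dx, e]

/-- Integration by parts in `x` against a solution of `σ y + y' + y''' = 0`. -/
lemma integral_mul_adjoint_dx {y y₁ y₂ y₃ : ℝ → ℂ} (hy : DerivChain y y₁ y₂ y₃) {σ : ℂ}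
    (hode : ∀ x, σ * y x + y₁ x + y₃ x = 0) (hφ : IsTest φ) (t : ℝ) :
    ∫ x in (0 : ℝ)..1, y x * ((dx 1 φ (x, t) + dx 3 φ (x, t) : ℝ) : ℂ) =
      σ * (∫ x in (0 : ℝ)..1, y x * (φ (x, t) : ℂ)) - y 0 * (dx 2 φ (0, t) : ℂ)
        - y₁ 1 * (dx 1 φ (1, t) : ℂ) + y₂ 1 * (φ (1, t) : ℂ) := by
  have hc : ∀ k, Continuous fun x => ((dx k φ (x, t) : ℝ) : ℂ) := fun k =>
    Complex.continuous_ofReal.comp ((contDiff_dx hφ.smooth k).continuous.comp (by fun_prop))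
  have hd : ∀ k x, HasDerivAt (fun x => ((dx k φ (x, t) : ℝ) : ℂ)) (dx (k + 1) φ (x, t) : ℂ) x :=
    fun k x => (hasDerivAt_dx hφ.smooth k x t).ofReal_comp
  have c0 := hy.cont₀
  -- The bilinear concomitant of the equation and its adjoint. At `1` the test conditions cancel the
  -- terms with `y(1)`; at `0` only `y(0) φ_xx` remains.
  have hF : ∀ x, HasDerivAt (fun x => y x * (dx 0 φ (x, t) : ℂ) + y x * (dx 2 φ (x, t) : ℂ)
      - y₁ x * (dx 1 φ (x, t) : ℂ) + y₂ x * (dx 0 φ (x, t) : ℂ))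
      (y x * ((dx 1 φ (x, t) + dx 3 φ (x, t) : ℝ) : ℂ) - σ * (y x * (dx 0 φ (x, t) : ℂ))) x := by
    intro x
    have h := ((((hy.one x).mul (hd 0 x)).add ((hy.one x).mul (hd 2 x))).sub
      ((hy.two x).mul (hd 1 x))).add ((hy.three x).mul (hd 0 x))
    refine h.congr_deriv ?_
    push_cast
    linear_combination (dx 0 φ (x, t) : ℂ) * hode x
  have i1 : IntervalIntegrable (fun x => y x * ((dx 1 φ (x, t) + dx 3 φ (x, t) : ℝ) : ℂ)) volume 0 1 :=
    (c0.mul (by push_cast; exact (hc 1).add (hc 3))).intervalIntegrable _ _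
  have i2 : IntervalIntegrable (fun x => σ * (y x * (dx 0 φ (x, t) : ℂ))) volume 0 1 :=
    (continuous_const.mul (c0.mul (hc 0))).intervalIntegrable _ _
  have h := intervalIntegral.integral_eq_sub_of_hasDerivAt (fun x _ => hF x) (i1.sub i2)
  rw [intervalIntegral.integral_sub i1 i2, intervalIntegral.integral_const_mul] at h
  have r : (dx 2 φ (1, t) : ℂ) = -(φ (1, t) : ℂ) := by
    rw [← Complex.ofReal_neg, ← eq_neg_of_add_eq_zero_right (hφ.right t)]
  simp only [dx_zero, hφ.left, hφ.left_deriv, r, Complex.ofReal_zero] at h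
  linear_combination h

/-- Integration by parts in `t` against an exponential. -/
lemma integral_exp_mul_dt (hφ : IsTest φ) (σ : ℂ) (x : ℝ) :
    ∫ t : ℝ, Complex.exp (σ * t) * (dt φ (x, t) : ℂ) =
      -(σ * ∫ t : ℝ, Complex.exp (σ * t) * (φ (x, t) : ℂ)) := by
  have hu : ∀ t : ℝ, HasDerivAt (fun t : ℝ => Complex.exp (σ * t)) (σ * Complex.exp (σ * t)) t := by
    intro t
    have h : HasDerivAt (fun t : ℝ => σ * (t : ℂ)) σ t := by
      simpa using (Complex.ofRealCLM.hasDerivAt (x := t)).const_mul σ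
    exact h.cexp.congr_deriv (by ring)
  have hi : ∀ {a : ℝ → ℂ} {g : ℝ × ℝ → ℝ}, Continuous a → Continuous g → HasCompactSupport g →
      Integrable fun t : ℝ => a t * (g (x, t) : ℂ) := by
    intro a g ha hg hgc
    refine Continuous.integrable_of_hasCompactSupport
      (ha.mul (Complex.continuous_ofReal.comp (hg.comp (by fun_prop)))) ?_
    exact ((hasCompactSupport_slice hgc x).comp_left (g := fun r : ℝ => (r : ℂ)) (by simp)).mul_left
  have h := integral_mul_deriv_eq_deriv_mul_of_integrable (fun t _ => hu t)
    (fun t _ => (hasDerivAt_dt hφ.smooth x t).ofReal_comp)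
    (hi (by fun_prop) (contDiff_dt hφ.smooth).continuous (hasCompactSupport_dt hφ.smooth hφ.compact))
    (hi (by fun_prop) hφ.smooth.continuous hφ.compact)
    (hi (by fun_prop) hφ.smooth.continuous hφ.compact)
  rw [h, ← integral_const_mul]
  simp only [mul_assoc]

lemma integrable_continuous_mul_test {a : ℝ × ℝ → ℂ} {g : ℝ × ℝ → ℝ} (ha : Continuous a)
    (hg : Continuous g) (hgc : HasCompactSupport g) (S : Set (ℝ × ℝ)) :
    IntegrableOn (fun p => a p * (g p : ℂ)) S := by
  refine Integrable.integrableOn (Continuous.integrable_of_hasCompactSupport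
    (ha.mul (Complex.continuous_ofReal.comp hg)) ?_)
  exact (hgc.comp_left (g := fun r : ℝ => (r : ℂ)) (by simp)).mul_left

/-- A separated wave `e^{σt} y(x)` solves the problem with the boundary values of `y`. -/
lemma integral_wave_mul_adjL {y y₁ y₂ y₃ : ℝ → ℂ} (hy : DerivChain y y₁ y₂ y₃) {σ : ℂ}
    (hode : ∀ x, σ * y x + y₁ x + y₃ x = 0) (hφ : IsTest φ) :
    ∫ p : ℝ × ℝ in Ioo (0 : ℝ) 1 ×ˢ univ, Complex.exp (σ * (p.2 : ℂ)) * y p.1 * (adjL φ p : ℂ) =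
      - y 0 * (∫ t : ℝ, Complex.exp (σ * t) * (dx 2 φ (0, t) : ℂ))
      - y₁ 1 * (∫ t : ℝ, Complex.exp (σ * t) * (dx 1 φ (1, t) : ℂ))
      + y₂ 1 * ∫ t : ℝ, Complex.exp (σ * t) * (φ (1, t) : ℂ) := by
  have c0 := hy.cont₀
  have ce : Continuous fun p : ℝ × ℝ => Complex.exp (σ * (p.2 : ℂ)) * y p.1 := by fun_prop
  have i1 := integrable_continuous_mul_test ce (contDiff_dt hφ.smooth).continuous
    (hasCompactSupport_dt hφ.smooth hφ.compact) (Ioo (0 : ℝ) 1 ×ˢ univ)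
  have i2 := integrable_continuous_mul_test ce
    ((contDiff_dx hφ.smooth 1).continuous.add (contDiff_dx hφ.smooth 3).continuous)
    ((hasCompactSupport_dx hφ.smooth hφ.compact 1).add (hasCompactSupport_dx hφ.smooth hφ.compact 3))
    (Ioo (0 : ℝ) 1 ×ˢ univ)
  simp only [Pi.add_apply] at i2
  have i3 := integrable_continuous_mul_test ce hφ.smooth.continuous hφ.compact
    (Ioo (0 : ℝ) 1 ×ˢ univ)
  have it : ∀ {g : ℝ × ℝ → ℝ}, Continuous g → HasCompactSupport g → ∀ x,
      Integrable fun t : ℝ => Complex.exp (σ * t) * (g (x, t) : ℂ) := by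
    intro g hg hgc x
    refine Continuous.integrable_of_hasCompactSupport
      ((by fun_prop : Continuous fun t : ℝ => Complex.exp (σ * t)).mul
        (Complex.continuous_ofReal.comp (hg.comp (by fun_prop)))) ?_
    exact ((hasCompactSupport_slice hgc x).comp_left (g := fun r : ℝ => (r : ℂ)) (by simp)).mul_left
  have e0 : ∫ p : ℝ × ℝ in Ioo (0 : ℝ) 1 ×ˢ univ, Complex.exp (σ * (p.2 : ℂ)) * y p.1 * (adjL φ p : ℂ) =
      (∫ p : ℝ × ℝ in Ioo (0 : ℝ) 1 ×ˢ univ, Complex.exp (σ * (p.2 : ℂ)) * y p.1 * (dt φ p : ℂ)) +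
      ∫ p : ℝ × ℝ in Ioo (0 : ℝ) 1 ×ˢ univ, Complex.exp (σ * (p.2 : ℂ)) * y p.1 *
        ((dx 1 φ p + dx 3 φ p : ℝ) : ℂ) := by
    rw [← integral_add i1 i2]
    refine integral_congr_ae (Eventually.of_forall fun p => ?_)
    simp only [adjL]
    push_cast
    ring
  have hdt : ∫ p : ℝ × ℝ in Ioo (0 : ℝ) 1 ×ˢ univ, Complex.exp (σ * (p.2 : ℂ)) * y p.1 * (dt φ p : ℂ) =
      -(σ * ∫ p : ℝ × ℝ in Ioo (0 : ℝ) 1 ×ˢ univ, Complex.exp (σ * (p.2 : ℂ)) * y p.1 * (φ p : ℂ)) := by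
    rw [IntegrableOn, volume_restrict_prod, Measure.restrict_univ] at i1 i3
    rw [volume_restrict_prod, Measure.restrict_univ, integral_prod _ i1, integral_prod _ i3,
      ← integral_const_mul, ← integral_neg]
    refine integral_congr_ae (Eventually.of_forall fun x => ?_)
    have := integral_exp_mul_dt hφ σ x
    calc ∫ t : ℝ, Complex.exp (σ * t) * y x * (dt φ (x, t) : ℂ)
        = y x * ∫ t : ℝ, Complex.exp (σ * t) * (dt φ (x, t) : ℂ) := by
          rw [← integral_const_mul]
          exact integral_congr_ae (Eventually.of_forall fun t => by dsimp only; ring)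
      _ = -(σ * (y x * ∫ t : ℝ, Complex.exp (σ * t) * (φ (x, t) : ℂ))) := by rw [this]; ring
      _ = -(σ * ∫ t : ℝ, Complex.exp (σ * t) * y x * (φ (x, t) : ℂ)) := by
          rw [← integral_const_mul (y x)]
          congr 2
          exact integral_congr_ae (Eventually.of_forall fun t => by dsimp only; ring)
  have hdx : ∫ p : ℝ × ℝ in Ioo (0 : ℝ) 1 ×ˢ univ, Complex.exp (σ * (p.2 : ℂ)) * y p.1 *
        ((dx 1 φ p + dx 3 φ p : ℝ) : ℂ) =
      (σ * ∫ p : ℝ × ℝ in Ioo (0 : ℝ) 1 ×ˢ univ, Complex.exp (σ * (p.2 : ℂ)) * y p.1 * (φ p : ℂ)) +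
      (- y 0 * (∫ t : ℝ, Complex.exp (σ * t) * (dx 2 φ (0, t) : ℂ))
      - y₁ 1 * (∫ t : ℝ, Complex.exp (σ * t) * (dx 1 φ (1, t) : ℂ))
      + y₂ 1 * ∫ t : ℝ, Complex.exp (σ * t) * (φ (1, t) : ℂ)) := by
    have j1 := it (contDiff_dx hφ.smooth 2).continuous (hasCompactSupport_dx hφ.smooth hφ.compact 2) 0
    have j2 := it (contDiff_dx hφ.smooth 1).continuous (hasCompactSupport_dx hφ.smooth hφ.compact 1) 1
    have j3 := it hφ.smooth.continuous hφ.compact 1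
    rw [IntegrableOn, volume_restrict_prod, Measure.restrict_univ] at i2 i3
    rw [volume_restrict_prod, Measure.restrict_univ]
    rw [integral_prod_symm _ i2, integral_prod_symm _ i3, ← integral_const_mul,
      ← integral_const_mul, ← integral_const_mul, ← integral_const_mul]
    have k1 : Integrable fun t : ℝ => -y 0 * (Complex.exp (σ * t) * (dx 2 φ (0, t) : ℂ)) -
        y₁ 1 * (Complex.exp (σ * t) * (dx 1 φ (1, t) : ℂ)) := (j1.const_mul _).sub (j2.const_mul _)
    have k2 : Integrable fun t : ℝ => -y 0 * (Complex.exp (σ * t) * (dx 2 φ (0, t) : ℂ)) -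
        y₁ 1 * (Complex.exp (σ * t) * (dx 1 φ (1, t) : ℂ)) +
        y₂ 1 * (Complex.exp (σ * t) * (φ (1, t) : ℂ)) := k1.add (j3.const_mul _)
    have k3 : Integrable fun t : ℝ => σ * ∫ x in Ioo (0 : ℝ) 1,
        Complex.exp (σ * t) * y x * (φ (x, t) : ℂ) := i3.swap.integral_prod_left.const_mul σ
    rw [← integral_sub (j1.const_mul _) (j2.const_mul _), ← integral_add k1 (j3.const_mul _),
      ← integral_add k3 k2]
    refine integral_congr_ae (Eventually.of_forall fun t => ?_)
    have h := integral_mul_adjoint_dx hy hode hφ t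
    rw [intervalIntegral.integral_of_le zero_le_one, intervalIntegral.integral_of_le zero_le_one,
      integral_Ioc_eq_integral_Ioo, integral_Ioc_eq_integral_Ioo] at h
    have pull : ∀ f : ℝ → ℂ, ∫ x in Ioo (0 : ℝ) 1, Complex.exp (σ * t) * y x * f x =
        Complex.exp (σ * t) * ∫ x in Ioo (0 : ℝ) 1, y x * f x := by
      intro f
      rw [← integral_const_mul]
      exact integral_congr_ae (Eventually.of_forall fun x => by dsimp only; ring)
    dsimp only
    rw [pull fun x => ((dx 1 φ (x, t) + dx 3 φ (x, t) : ℝ) : ℂ), pull fun x => ((φ (x, t) : ℝ) : ℂ), h]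
    ring
  rw [e0, hdt, hdx]
  ring

end TestFunctions

/-! ### Waves with frequencies in a bounded range -/

/-- A bounded range of frequencies that stays away from the double root. -/
structure IsCut (S : Set ℝ) : Prop where
  measurable : MeasurableSet S
  one_lt : S ⊆ Ioi 1
  bounded : ∃ R ε : ℝ, 0 < ε ∧ ∀ ρ ∈ S, ρ ≤ R ∧ ε ≤ |ρ - 2 / √3|

lemma isCut_cutRange (R : ℝ) {ε : ℝ} (hε : 0 < ε) : IsCut (cutRange R ε) where
  measurable := by
    have e : cutRange R ε = Ioi 1 ∩ (Iio R ∩ {ρ : ℝ | ε < |ρ - 2 / √3|}) := rfl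
    rw [e]
    exact measurableSet_Ioi.inter (measurableSet_Iio.inter
      (measurableSet_lt measurable_const (by fun_prop)))
  one_lt ρ hρ := hρ.1
  bounded := ⟨R, ε, hε, fun ρ hρ => ⟨hρ.2.1.le, hρ.2.2.le⟩⟩

namespace IsCut

variable {S : Set ℝ}

lemma mono (hS : IsCut S) {S' : Set ℝ} (h : S' ⊆ S) (hm : MeasurableSet S') : IsCut S' :=
  ⟨hm, h.trans hS.one_lt, by
    obtain ⟨R, ε, hε, hb⟩ := hS.bounded
    exact ⟨R, ε, hε, fun ρ hρ => hb ρ (h hρ)⟩⟩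

lemma one_le (hS : IsCut S) {ρ : ℝ} (hρ : ρ ∈ S) : 1 ≤ ρ := le_of_lt (hS.one_lt hρ)

lemma ne (hS : IsCut S) {ρ : ℝ} (hρ : ρ ∈ S) : ρ ≠ 2 / √3 := by
  obtain ⟨R, ε, hε, hb⟩ := hS.bounded
  intro h
  have := (hb ρ hρ).2
  rw [h, sub_self, abs_zero] at this
  linarith

lemma exists_compact (hS : IsCut S) : ∃ K, IsCompact K ∧ S ⊆ K ∧ K ⊆ {ρ | 1 ≤ ρ ∧ ρ ≠ 2 / √3} := by
  obtain ⟨R, ε, hε, hb⟩ := hS.bounded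
  refine ⟨Icc 1 R ∩ {ρ : ℝ | ε ≤ |ρ - 2 / √3|}, isCompact_Icc.inter_right
    (isClosed_le continuous_const (by fun_prop)),
    fun ρ hρ => ⟨⟨hS.one_le hρ, (hb ρ hρ).1⟩, (hb ρ hρ).2⟩, fun ρ hρ => ⟨hρ.1.1, fun h => ?_⟩⟩
  have := hρ.2
  rw [mem_ofPred_eq, h, sub_self, abs_zero] at this
  linarith

/-- A cut lies in a compact set avoiding the double root, where continuous kernels are bounded, so
local integrability of the data is enough. -/
lemma integrableOn_mul (hS : IsCut S) {r : ℝ} {h : 𝓢'(ℝ, ℂ)}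
    (hh : TemperedDistribution.MemSobolev r 2 h) {g : ℝ → ℂ}
    (hg : ContinuousOn g {ρ | 1 ≤ ρ ∧ ρ ≠ 2 / √3}) :
    IntegrableOn (fun ρ => ((3 * ρ ^ 2 - 1 : ℝ) : ℂ) * laplaceOnAxis h (ρ ^ 3 - ρ) * g ρ) S := by
  obtain ⟨R, ε, hε, hb⟩ := hS.bounded
  obtain ⟨K, hK, hSK, hK'⟩ := hS.exists_compact
  obtain ⟨C, hC⟩ := hK.exists_bound_of_continuousOn (hg.mono hK')
  have h1 := (integrableOn_data hh R).mono_set (s := S) fun ρ hρ => ⟨hS.one_le hρ, (hb ρ hρ).1⟩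
  exact Integrable.mul_bdd h1 ((hg.mono (hSK.trans hK')).aestronglyMeasurable hS.measurable)
    (ae_restrict_of_forall_mem hS.measurable fun ρ hρ => hC ρ (hSK hρ))

end IsCut

section Waves

variable {h : Fin 3 → 𝓢'(ℝ, ℂ)} {r : Fin 3 → ℝ} {S : Set ℝ}

/-- The coefficients of the exponential solution with boundary values `ĥ_m`. -/
def dataCoeff (h : Fin 3 → 𝓢'(ℝ, ℂ)) (ρ : ℝ) (j : Fin 3) : ℂ :=
  ∑ m, laplaceOnAxis (h m) (ρ ^ 3 - ρ) * kerCoeff m ρ j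

/-- The amplitude of frequency `ρ³ - ρ`, with its derivatives. -/
def amplitude (h : Fin 3 → 𝓢'(ℝ, ℂ)) (ρ : ℝ) (k : ℕ) (x : ℝ) : ℂ := expSol (dataCoeff h ρ) ρ k x

lemma amplitude_eq_sum (h : Fin 3 → 𝓢'(ℝ, ℂ)) (ρ : ℝ) (k : ℕ) (x : ℝ) :
    amplitude h ρ k x = ∑ m, laplaceOnAxis (h m) (ρ ^ 3 - ρ) * ker m ρ k x := by
  simp only [amplitude, ker, expSol, dataCoeff, Finset.sum_mul, Finset.mul_sum]
  rw [Finset.sum_comm]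
  exact Finset.sum_congr rfl fun m _ => Finset.sum_congr rfl fun j _ => by ring

lemma amplitude_boundary {ρ : ℝ} (h1 : 1 ≤ ρ) (h2 : ρ ≠ 2 / √3) :
    amplitude h ρ 0 0 = laplaceOnAxis (h 0) (ρ ^ 3 - ρ) ∧
      amplitude h ρ 1 1 = laplaceOnAxis (h 1) (ρ ^ 3 - ρ) ∧
      amplitude h ρ 2 1 = laplaceOnAxis (h 2) (ρ ^ 3 - ρ) := by
  simp only [amplitude_eq_sum, (ker_boundary h1 h2 _).1, (ker_boundary h1 h2 _).2.1,
    (ker_boundary h1 h2 _).2.2, Fin.sum_univ_three]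
  simp

/-- The density of the wave. -/
def waveDensity (h : Fin 3 → 𝓢'(ℝ, ℂ)) (p : ℝ × ℝ) (ρ : ℝ) : ℂ :=
  ((3 * ρ ^ 2 - 1 : ℝ) : ℂ) *
    (Complex.exp (Complex.I * ((ρ ^ 3 - ρ : ℝ) : ℂ) * (p.2 : ℂ)) * amplitude h ρ 0 p.1)

/-- The superposition of the waves with frequencies in `S`. -/
def wave (S : Set ℝ) (h : Fin 3 → 𝓢'(ℝ, ℂ)) (p : ℝ × ℝ) : ℂ :=
  1 / (2 * (Real.pi : ℂ)) * ∫ ρ in S, waveDensity h p ρ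

lemma waveDensity_eq_sum_integrand (h : Fin 3 → 𝓢'(ℝ, ℂ)) (p : ℝ × ℝ) (ρ : ℝ) :
    waveDensity h p ρ = ∑ m, ∑ j, integrand j m (h m) p ρ := by
  simp only [waveDensity, sum_integrand, amplitude_eq_sum, Finset.mul_sum]

/-- The data-dependent factor depends on `ρ` alone and the other factor is jointly continuous; joint
measurability and Fubini's theorem rest on this splitting. -/
lemma waveDensity_eq_sum (h : Fin 3 → 𝓢'(ℝ, ℂ)) (p : ℝ × ℝ) (ρ : ℝ) :
    waveDensity h p ρ = ∑ j, ((3 * ρ ^ 2 - 1 : ℝ) : ℂ) * dataCoeff h ρ j *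
      Complex.exp (Complex.I * ((ρ ^ 3 - ρ : ℝ) : ℂ) * (p.2 : ℂ) + lam j ρ * (p.1 : ℂ)) := by
  simp only [waveDensity, amplitude, expSol, Finset.mul_sum]
  refine Finset.sum_congr rfl fun j _ => ?_
  rw [Complex.exp_add]
  ring

lemma IsCut.integrableOn_integrand (hS : IsCut S)
    (hh : ∀ m, TemperedDistribution.MemSobolev (r m) 2 (h m)) (j m : Fin 3) (p : ℝ × ℝ) :
    IntegrableOn (integrand j m (h m) p) S := by
  have := continuous_lam j
  have hc : Continuous fun ρ : ℝ => Complex.exp (Complex.I * ((ρ ^ 3 - ρ : ℝ) : ℂ) * (p.2 : ℂ)) *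
      Complex.exp (lam j ρ * p.1) := by fun_prop
  refine (hS.integrableOn_mul (hh m) ((continuousOn_kerCoeff m j).mul hc.continuousOn)).congr_fun
    (fun ρ _ => ?_) hS.measurable
  simp only [integrand_eq, Pi.mul_apply]
  ring

/-- Integrability of each of the nine terms is what permits merging them into one integral. -/
lemma Wbdr_eq (p : ℝ × ℝ) (hint : ∀ j m, IntegrableOn (integrand j m (h m) p) S) :
    Wbdr S h p = ((2 * (wave S h p).re : ℝ) : ℂ) := by
  have e : wave S h p = ∑ j, ∑ m, U S j m (h m) p := by
    simp only [wave, U, waveDensity_eq_sum_integrand, ← Finset.mul_sum]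
    rw [integral_finsetSum _ fun m _ => integrable_finsetSum _ fun j _ => hint j m,
      Finset.sum_comm]
    congr 1
    exact Finset.sum_congr rfl fun m _ => integral_finsetSum _ fun j _ => hint j m
  rw [← Complex.add_conj, e]
  simp only [Wbdr, W, map_sum, ← Finset.sum_add_distrib]

lemma IsCut.integrableOn_waveDensity (hS : IsCut S)
    (hh : ∀ m, TemperedDistribution.MemSobolev (r m) 2 (h m)) (p : ℝ × ℝ) :
    IntegrableOn (waveDensity h p) S := by
  have e : waveDensity h p = fun ρ => ∑ m, ∑ j, integrand j m (h m) p ρ :=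
    funext (waveDensity_eq_sum_integrand h p)
  rw [e]
  exact integrable_finsetSum _ fun m _ => integrable_finsetSum _ fun j _ =>
    hS.integrableOn_integrand hh j m p

lemma IsCut.wave_diff (hS : IsCut S) (hh : ∀ m, TemperedDistribution.MemSobolev (r m) 2 (h m))
    {S' : Set ℝ} (hS' : MeasurableSet S') (hsub : S' ⊆ S) (p : ℝ × ℝ) :
    wave S h p - wave S' h p = wave (S \ S') h p := by
  rw [wave, wave, wave, setIntegral_sdiff hS' (hS.integrableOn_waveDensity hh p) hsub]
  ring

lemma IsCut.integrableOn_dataCoeff (hS : IsCut S)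
    (hh : ∀ m, TemperedDistribution.MemSobolev (r m) 2 (h m)) (j : Fin 3) :
    IntegrableOn (fun ρ => ((3 * ρ ^ 2 - 1 : ℝ) : ℂ) * dataCoeff h ρ j) S := by
  simp only [dataCoeff, Finset.mul_sum, ← mul_assoc]
  exact integrable_finsetSum _ fun m _ => hS.integrableOn_mul (hh m) (continuousOn_kerCoeff m j)

lemma continuous_phase (j : Fin 3) : Continuous fun z : (ℝ × ℝ) × ℝ =>
    Complex.exp (Complex.I * ((z.2 ^ 3 - z.2 : ℝ) : ℂ) * (z.1.2 : ℂ) + lam j z.2 * (z.1.1 : ℂ)) := by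
  have := continuous_lam j
  fun_prop

lemma IsCut.aestronglyMeasurable_waveDensity (hS : IsCut S)
    (hh : ∀ m, TemperedDistribution.MemSobolev (r m) 2 (h m)) (μ : Measure (ℝ × ℝ)) [SFinite μ] :
    AEStronglyMeasurable (fun z : (ℝ × ℝ) × ℝ => waveDensity h z.1 z.2)
      (μ.prod (volume.restrict S)) := by
  simp only [waveDensity_eq_sum]
  refine Finset.aestronglyMeasurable_fun_sum _ fun j _ => ?_
  exact (hS.integrableOn_dataCoeff hh j).1.comp_snd.mul (continuous_phase j).aestronglyMeasurable

lemma IsCut.aestronglyMeasurable_wave (hS : IsCut S)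
    (hh : ∀ m, TemperedDistribution.MemSobolev (r m) 2 (h m)) (μ : Measure (ℝ × ℝ)) [SFinite μ] :
    AEStronglyMeasurable (wave S h) μ :=
  (hS.aestronglyMeasurable_waveDensity hh μ).integral_prod_right'.const_mul _

/-! ### The weak formulation for a bounded range of frequencies -/

lemma IsCut.exists_bound_phase (hS : IsCut S) (j : Fin 3) : ∃ C : ℝ, ∀ ρ ∈ S, ∀ p : ℝ × ℝ,
    p.1 ∈ Ioo (0 : ℝ) 1 →
    ‖Complex.exp (Complex.I * ((ρ ^ 3 - ρ : ℝ) : ℂ) * (p.2 : ℂ) + lam j ρ * (p.1 : ℂ))‖ ≤ C := by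
  obtain ⟨K, hK, hSK, -⟩ := hS.exists_compact
  obtain ⟨C, hC⟩ := hK.exists_bound_of_continuousOn (continuous_lam j).continuousOn
  refine ⟨Real.exp C, fun ρ hρ p hp => ?_⟩
  have e : (Complex.I * ((ρ ^ 3 - ρ : ℝ) : ℂ) * (p.2 : ℂ) + lam j ρ * (p.1 : ℂ)).re =
      (lam j ρ).re * p.1 := by
    simp [-Complex.ofReal_sub, -Complex.ofReal_pow]
  rw [Complex.norm_exp, e]
  refine Real.exp_le_exp.2 ?_
  have h1 : |(lam j ρ).re| ≤ C := (Complex.abs_re_le_norm _).trans (hC ρ (hSK hρ))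
  calc (lam j ρ).re * p.1 ≤ |(lam j ρ).re| * 1 :=
        mul_le_mul (le_abs_self _) hp.2.le hp.1.le (abs_nonneg _)
    _ ≤ C := by linarith

lemma IsCut.integrable_waveDensity_mul (hS : IsCut S)
    (hh : ∀ m, TemperedDistribution.MemSobolev (r m) 2 (h m)) {g : ℝ × ℝ → ℂ}
    (hg : IntegrableOn g (Ioo (0 : ℝ) 1 ×ˢ univ)) :
    Integrable (fun z : (ℝ × ℝ) × ℝ => waveDensity h z.1 z.2 * g z.1)
      ((volume.restrict (Ioo (0 : ℝ) 1 ×ˢ univ)).prod (volume.restrict S)) := by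
  simp only [waveDensity_eq_sum, Finset.sum_mul]
  refine integrable_finsetSum _ fun j _ => ?_
  obtain ⟨C, hC⟩ := hS.exists_bound_phase j
  have h1 := hg.mul_prod (hS.integrableOn_dataCoeff hh j)
  have h2 := h1.mul_bdd (c := C) (continuous_phase j).aestronglyMeasurable (by
    rw [Measure.prod_restrict]
    refine ae_restrict_of_forall_mem
      ((measurableSet_Ioo.prod MeasurableSet.univ).prod hS.measurable) fun z hz => ?_
    exact hC z.2 hz.2 z.1 hz.1.1)
  refine h2.congr (Eventually.of_forall fun z => ?_)
  dsimp only
  ring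

/-- The pairing of the boundary data with a test function, restricted to frequencies in `S`. -/
def dataPairing (S : Set ℝ) (h : 𝓢'(ℝ, ℂ)) (ψ : ℝ → ℝ) : ℂ :=
  1 / (2 * (Real.pi : ℂ)) * ∫ ρ in S, ((3 * ρ ^ 2 - 1 : ℝ) : ℂ) *
    (laplaceOnAxis h (ρ ^ 3 - ρ) * oscTest ψ ρ)

/-- Fubini's theorem moves the frequency integral outside, and each separated wave satisfies the
weak identity with its own boundary values. -/
lemma IsCut.integral_superposition_mul_adjL (hS : IsCut S)
    (hh : ∀ m, MemHZero (r m) (h m)) {φ : ℝ × ℝ → ℝ} (hφ : IsTest φ) :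
    ∫ p : ℝ × ℝ in Ioo (0 : ℝ) 1 ×ˢ univ, wave S h p * (adjL φ p : ℂ) =
      -dataPairing S (h 0) (fun t => dx 2 φ (0, t)) - dataPairing S (h 1) (fun t => dx 1 φ (1, t))
      + dataPairing S (h 2) (fun t => φ (1, t)) := by
  have hg : IntegrableOn (fun p => ((adjL φ p : ℝ) : ℂ)) (Ioo (0 : ℝ) 1 ×ˢ univ) :=
    (hφ.continuous_adjL.integrable_of_hasCompactSupport hφ.hasCompactSupport_adjL).ofReal.integrableOn
  have hint := hS.integrable_waveDensity_mul (fun m => (hh m).sobolev) hg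
  set f : Fin 3 → ℝ → ℂ := fun m ρ => ((3 * ρ ^ 2 - 1 : ℝ) : ℂ) * (laplaceOnAxis (h m) (ρ ^ 3 - ρ) *
    oscTest (![fun t => dx 2 φ (0, t), fun t => dx 1 φ (1, t), fun t => φ (1, t)] m) ρ) with hf
  have i0 : IntegrableOn (f 0) S := (integrableOn_data_oscTest (hh 0)
    (contDiff_slice (contDiff_dx hφ.smooth 2) 0)
    (hasCompactSupport_slice (hasCompactSupport_dx hφ.smooth hφ.compact 2) 0)).mono_set hS.one_lt
  have i1 : IntegrableOn (f 1) S := (integrableOn_data_oscTest (hh 1)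
    (contDiff_slice (contDiff_dx hφ.smooth 1) 1)
    (hasCompactSupport_slice (hasCompactSupport_dx hφ.smooth hφ.compact 1) 1)).mono_set hS.one_lt
  have i2 : IntegrableOn (f 2) S := (integrableOn_data_oscTest (hh 2)
    (contDiff_slice hφ.smooth 1) (hasCompactSupport_slice hφ.compact 1)).mono_set hS.one_lt
  have i3 : IntegrableOn (fun ρ => -f 0 ρ - f 1 ρ) S := i0.neg.sub i1
  calc ∫ p : ℝ × ℝ in Ioo (0 : ℝ) 1 ×ˢ univ, wave S h p * (adjL φ p : ℂ)
      = 1 / (2 * (Real.pi : ℂ)) * ∫ p : ℝ × ℝ in Ioo (0 : ℝ) 1 ×ˢ univ,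
          ∫ ρ in S, waveDensity h p ρ * (adjL φ p : ℂ) := by
        rw [← integral_const_mul]
        refine integral_congr_ae (Eventually.of_forall fun p => ?_)
        dsimp only
        rw [integral_mul_const, wave, mul_assoc]
    _ = 1 / (2 * (Real.pi : ℂ)) * ∫ ρ in S,
          ∫ p : ℝ × ℝ in Ioo (0 : ℝ) 1 ×ˢ univ, waveDensity h p ρ * (adjL φ p : ℂ) := by
        rw [integral_integral_swap hint]
    _ = 1 / (2 * (Real.pi : ℂ)) * ∫ ρ in S, (-f 0 ρ - f 1 ρ + f 2 ρ) := by
        congr 1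
        refine setIntegral_congr_fun hS.measurable fun ρ hρ => ?_
        have hw := integral_wave_mul_adjL (derivChain_expSol (dataCoeff h ρ) ρ)
          (expSol_ode (dataCoeff h ρ) ρ) hφ
        obtain ⟨b0, b1, b2⟩ := amplitude_boundary (h := h) (hS.one_le hρ) (hS.ne hρ)
        simp only [amplitude] at b0 b1 b2
        rw [b0, b1, b2] at hw
        have e : ∀ p : ℝ × ℝ, waveDensity h p ρ * (adjL φ p : ℂ) = ((3 * ρ ^ 2 - 1 : ℝ) : ℂ) *
            (Complex.exp (sigma ρ * (p.2 : ℂ)) * expSol (dataCoeff h ρ) ρ 0 p.1 *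
              (adjL φ p : ℂ)) := fun p => by
          simp only [waveDensity, amplitude, sigma]
          ring
        simp only [e]
        rw [integral_const_mul, hw]
        simp only [hf, oscTest, sigma, Matrix.cons_val]
        ring
    _ = 1 / (2 * (Real.pi : ℂ)) * (-(∫ ρ in S, f 0 ρ) - (∫ ρ in S, f 1 ρ) + ∫ ρ in S, f 2 ρ) := by
        rw [integral_add i3 i2, integral_sub (f := fun ρ => -f 0 ρ) i0.neg i1, integral_neg]
    _ = _ := by
        simp only [hf, dataPairing, Matrix.cons_val]
        ring

end Waves

/-! ### Square integrability of the waves -/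

lemma enorm_sum_sq_le (z : Fin 3 → ℂ) : ‖∑ m, z m‖ₑ ^ 2 ≤ ∑ m, 3 * ‖z m‖ₑ ^ 2 := by
  have e : ∀ w : ℂ, ‖w‖ₑ ^ 2 = ENNReal.ofReal (‖w‖ ^ 2) := fun w => by
    rw [← ofReal_norm, ENNReal.ofReal_pow (norm_nonneg _)]
  have h1 : ‖∑ m, z m‖ ^ 2 ≤ ∑ m, 3 * ‖z m‖ ^ 2 := by
    rw [← Finset.mul_sum]
    calc ‖∑ m, z m‖ ^ 2 ≤ (∑ m, ‖z m‖) ^ 2 :=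
          pow_le_pow_left₀ (norm_nonneg _) (norm_sum_le _ _) 2
      _ ≤ 3 * ∑ m, ‖z m‖ ^ 2 := by
          simpa using sq_sum_le_card_mul_sum_sq (s := Finset.univ) (f := fun m => ‖z m‖)
  simp only [e]
  refine (ENNReal.ofReal_le_ofReal h1).trans ?_
  rw [ENNReal.ofReal_sum_of_nonneg fun m _ => by positivity]
  refine Finset.sum_le_sum fun m _ => ?_
  rw [ENNReal.ofReal_mul (by norm_num), ENNReal.ofReal_ofNat]

/-- The known integrability carries the Jacobian `3ρ² - 1`, which is nonzero for `ρ ≥ 1` and can be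
divided out. -/
lemma aestronglyMeasurable_data {r : ℝ} {h : 𝓢'(ℝ, ℂ)}
    (hh : TemperedDistribution.MemSobolev r 2 h) :
    AEStronglyMeasurable (fun ρ => laplaceOnAxis h (ρ ^ 3 - ρ)) (volume.restrict (Ici (1 : ℝ))) := by
  have e : Ici (1 : ℝ) = ⋃ n : ℕ, Icc (1 : ℝ) n := by
    ext ρ
    simp only [mem_Ici, mem_iUnion, mem_Icc, exists_and_left]
    exact ⟨fun h => ⟨h, exists_nat_ge ρ⟩, fun h => h.1⟩
  rw [e, aestronglyMeasurable_iUnion_iff]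
  intro n
  have h1 := (integrableOn_data hh n).1
  have h2 : Measurable fun ρ : ℝ => (((3 * ρ ^ 2 - 1 : ℝ) : ℂ))⁻¹ := by fun_prop
  refine (h2.aestronglyMeasurable.mul h1).congr
    (ae_restrict_of_forall_mem measurableSet_Icc fun ρ hρ => ?_)
  have h3 : ((3 * ρ ^ 2 - 1 : ℝ) : ℂ) ≠ 0 := by
    have : (3 * ρ ^ 2 - 1 : ℝ) ≠ 0 := by nlinarith [hρ.1]
    exact_mod_cast this
  simp only [Pi.mul_apply]
  rw [inv_mul_cancel_left₀ h3]

section Energy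

variable {h : Fin 3 → 𝓢'(ℝ, ℂ)} {r : Fin 3 → ℝ} {S : Set ℝ}

lemma IsCut.aestronglyMeasurable_dataCoeff (hS : IsCut S)
    (hh : ∀ m, TemperedDistribution.MemSobolev (r m) 2 (h m)) (j : Fin 3) :
    AEStronglyMeasurable (fun ρ => dataCoeff h ρ j) (volume.restrict S) := by
  simp only [dataCoeff]
  refine Finset.aestronglyMeasurable_fun_sum _ fun m _ => ?_
  refine ((aestronglyMeasurable_data (hh m)).mono_measure
    (Measure.restrict_mono (hS.one_lt.trans Ioi_subset_Ici_self) le_rfl)).mul ?_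
  exact ((continuousOn_kerCoeff m j).mono fun ρ hρ => ⟨hS.one_le hρ, hS.ne hρ⟩).aestronglyMeasurable
    hS.measurable

/-- The energy density of the wave on the frequency side. -/
def waveEnergy (h : Fin 3 → 𝓢'(ℝ, ℂ)) (ρ : ℝ) : ℝ≥0∞ :=
  ∑ m : Fin 3, ENNReal.ofReal ((2 * Real.pi)⁻¹ * (3 * ρ ^ 2 - 1)) *
    (ENNReal.ofReal (1 / ρ ^ (2 * (m : ℕ))) * ‖laplaceOnAxis (h m) (ρ ^ 3 - ρ)‖ₑ ^ 2)

lemma lintegral_waveEnergy_lt_top (hh : ∀ m, TemperedDistribution.MemSobolev (r m) 2 (h m))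
    (hr : ∀ m : Fin 3, -((m : ℕ) : ℝ) / 3 ≤ r m) :
    ∫⁻ ρ in Ioi (1 : ℝ), waveEnergy h ρ < ⊤ := by
  simp only [waveEnergy]
  rw [lintegral_finsetSum' _ fun m _ => ?_]
  · exact ENNReal.sum_lt_top.2 fun m _ => lintegral_data_lt_top (hh m) m (hr m)
  · have h1 := ((aestronglyMeasurable_data (hh m)).mono_measure
      (Measure.restrict_mono Ioi_subset_Ici_self le_rfl : volume.restrict (Ioi (1 : ℝ)) ≤ _)).enorm
    refine AEMeasurable.mul (Measurable.aemeasurable (by fun_prop)) (AEMeasurable.mul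
      (Measurable.aemeasurable (by fun_prop)) (h1.pow_const 2))

lemma lintegral_ker {ρ : ℝ} {C : ℝ} {m : Fin 3}
    (hC : (∫ x in (0 : ℝ)..1, ‖ker m ρ 0 x‖ ^ 2) ≤ C) :
    ∫⁻ x in Ioo (0 : ℝ) 1, ‖ker m ρ 0 x‖ₑ ^ 2 ≤ ENNReal.ofReal C := by
  have hc : Continuous (ker m ρ 0) := continuous_expSol _ _ _
  rw [intervalIntegral.integral_of_le zero_le_one, integral_Ioc_eq_integral_Ioo] at hC
  refine le_trans (le_of_eq ?_) (ENNReal.ofReal_le_ofReal hC)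
  have hi : IntegrableOn (fun x => ‖ker m ρ 0 x‖ ^ 2) (Ioo 0 1) :=
    ((hc.norm.pow 2).integrableOn_Icc (a := 0) (b := 1)).mono_set Ioo_subset_Icc_self
  rw [ofReal_integral_eq_lintegral_ofReal hi (Eventually.of_forall fun x => by positivity)]
  refine lintegral_congr fun x => ?_
  rw [← ofReal_norm, ENNReal.ofReal_pow (norm_nonneg _)]

lemma exists_lintegral_amplitude_le : ∃ C : ℝ≥0∞, C ≠ ⊤ ∧ ∀ (h : Fin 3 → 𝓢'(ℝ, ℂ)) (ρ : ℝ),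
    1 ≤ ρ → ρ ≠ 2 / √3 →
    ∫⁻ x in Ioo (0 : ℝ) 1, ENNReal.ofReal ((2 * Real.pi)⁻¹ * (3 * ρ ^ 2 - 1)) *
      ‖amplitude h ρ 0 x‖ₑ ^ 2 ≤ C * waveEnergy h ρ := by
  obtain ⟨C, hC0, hC⟩ := exists_integral_ker_le
  refine ⟨3 * ENNReal.ofReal C, ENNReal.mul_ne_top (by norm_num) ENNReal.ofReal_ne_top,
    fun h ρ h1 h2 => ?_⟩
  have hm : ∀ m, Measurable fun x => ‖ker m ρ 0 x‖ₑ ^ 2 := fun m =>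
    (continuous_expSol (kerCoeff m ρ) ρ 0).measurable.enorm.pow_const 2
  rw [lintegral_const_mul' _ _ ENNReal.ofReal_ne_top]
  calc ENNReal.ofReal ((2 * Real.pi)⁻¹ * (3 * ρ ^ 2 - 1)) *
        ∫⁻ x in Ioo (0 : ℝ) 1, ‖amplitude h ρ 0 x‖ₑ ^ 2
      ≤ ENNReal.ofReal ((2 * Real.pi)⁻¹ * (3 * ρ ^ 2 - 1)) * ∫⁻ x in Ioo (0 : ℝ) 1,
          ∑ m, 3 * ‖laplaceOnAxis (h m) (ρ ^ 3 - ρ)‖ₑ ^ 2 * ‖ker m ρ 0 x‖ₑ ^ 2 := by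
        refine mul_le_mul' le_rfl (lintegral_mono fun x => ?_)
        rw [amplitude_eq_sum]
        refine (enorm_sum_sq_le _).trans (le_of_eq (Finset.sum_congr rfl fun m _ => ?_))
        rw [enorm_mul, mul_pow, mul_assoc]
    _ = ENNReal.ofReal ((2 * Real.pi)⁻¹ * (3 * ρ ^ 2 - 1)) *
          ∑ m, 3 * ‖laplaceOnAxis (h m) (ρ ^ 3 - ρ)‖ₑ ^ 2 *
            ∫⁻ x in Ioo (0 : ℝ) 1, ‖ker m ρ 0 x‖ₑ ^ 2 := by
        rw [lintegral_finsetSum _ fun m _ => (hm m).const_mul _]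
        simp only [lintegral_const_mul _ (hm _)]
    _ ≤ ENNReal.ofReal ((2 * Real.pi)⁻¹ * (3 * ρ ^ 2 - 1)) *
          ∑ m : Fin 3, 3 * ‖laplaceOnAxis (h m) (ρ ^ 3 - ρ)‖ₑ ^ 2 *
            (ENNReal.ofReal C * ENNReal.ofReal (1 / ρ ^ (2 * (m : ℕ)))) := by
        refine mul_le_mul' le_rfl (Finset.sum_le_sum fun m _ => mul_le_mul' le_rfl ?_)
        rw [← ENNReal.ofReal_mul hC0, mul_one_div]
        exact lintegral_ker (hC ρ h1 h2 m)
    _ = 3 * ENNReal.ofReal C * waveEnergy h ρ := by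
        simp only [waveEnergy, Finset.mul_sum]
        exact Finset.sum_congr rfl fun m _ => by ring

/-- Plancherel in `t` at fixed `x`, then Tonelli, then the kernel bound in `x`. The constant does
not depend on the cut, so the bound applies to differences of truncations. -/
lemma exists_sq_eLpNorm_wave_le : ∃ C : ℝ≥0∞, C ≠ ⊤ ∧
    ∀ (h : Fin 3 → 𝓢'(ℝ, ℂ)) (r : Fin 3 → ℝ) (S : Set ℝ), IsCut S →
      (∀ m, TemperedDistribution.MemSobolev (r m) 2 (h m)) →
      eLpNorm (wave S h) 2 (volume.restrict (Ioo (0 : ℝ) 1 ×ˢ univ)) ^ 2 ≤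
        C * ∫⁻ ρ in S, waveEnergy h ρ := by
  obtain ⟨C, hC, hCb⟩ := exists_lintegral_amplitude_le
  refine ⟨C, hC, fun h r S hS hh => ?_⟩
  have hmeas : AEMeasurable (Function.uncurry fun x ρ : ℝ =>
      ENNReal.ofReal ((2 * Real.pi)⁻¹ * (3 * ρ ^ 2 - 1)) * ‖amplitude h ρ 0 x‖ₑ ^ 2)
      ((volume.restrict (Ioo (0 : ℝ) 1)).prod (volume.restrict S)) := by
    have hw : Measurable fun z : ℝ × ℝ => ENNReal.ofReal ((2 * Real.pi)⁻¹ * (3 * z.2 ^ 2 - 1)) := by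
      fun_prop
    refine hw.aemeasurable.mul (AEMeasurable.pow_const (AEStronglyMeasurable.enorm ?_) 2)
    simp only [amplitude, expSol]
    refine Finset.aestronglyMeasurable_fun_sum _ fun j _ => ?_
    have := continuous_lam j
    exact (hS.aestronglyMeasurable_dataCoeff hh j).comp_snd.mul
      (Continuous.aestronglyMeasurable (by fun_prop))
  have hw := hS.aestronglyMeasurable_wave hh (volume.restrict (Ioo (0 : ℝ) 1 ×ˢ univ))
  rw [volume_restrict_prod, Measure.restrict_univ] at hw
  rw [sq_eLpNorm_two, volume_restrict_prod, Measure.restrict_univ, lintegral_prod _ (hw.enorm.pow_const 2)]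
  calc ∫⁻ x in Ioo (0 : ℝ) 1, ∫⁻ t : ℝ, ‖wave S h (x, t)‖ₑ ^ 2
      ≤ ∫⁻ x in Ioo (0 : ℝ) 1, ∫⁻ ρ in S, ENNReal.ofReal ((2 * Real.pi)⁻¹ * (3 * ρ ^ 2 - 1)) *
          ‖amplitude h ρ 0 x‖ₑ ^ 2 := by
        refine lintegral_mono fun x => ?_
        have e : waveDensity h (x, 0) = fun ρ => ((3 * ρ ^ 2 - 1 : ℝ) : ℂ) * amplitude h ρ 0 x := by
          ext ρ
          simp only [waveDensity, Complex.ofReal_zero, mul_zero, Complex.exp_zero, one_mul]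
        have hA := hS.integrableOn_waveDensity hh (x, 0)
        rw [e] at hA
        simp only [wave, waveDensity]
        exact lintegral_oscillatory_le (A := fun ρ => amplitude h ρ 0 x) hS.measurable
          (hS.one_lt.trans Ioi_subset_Ici_self) hA
    _ = ∫⁻ ρ in S, ∫⁻ x in Ioo (0 : ℝ) 1, ENNReal.ofReal ((2 * Real.pi)⁻¹ * (3 * ρ ^ 2 - 1)) *
          ‖amplitude h ρ 0 x‖ₑ ^ 2 := lintegral_lintegral_swap hmeas
    _ ≤ ∫⁻ ρ in S, C * waveEnergy h ρ :=
        setLIntegral_mono' hS.measurable fun ρ hρ => hCb h ρ (hS.one_le hρ) (hS.ne hρ)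
    _ = C * ∫⁻ ρ in S, waveEnergy h ρ := lintegral_const_mul' _ _ hC

end Energy

/-! ### The limit of the waves -/

section Limit

variable {h : Fin 3 → 𝓢'(ℝ, ℂ)} {r : Fin 3 → ℝ} {S : Set ℝ}

/-- An increasing sequence of ranges of integration. -/
def cutSeq (n : ℕ) : Set ℝ := cutRange n (1 / ((n : ℝ) + 1))

lemma isCut_cutSeq (n : ℕ) : IsCut (cutSeq n) := isCut_cutRange _ Nat.one_div_pos_of_nat

lemma monotone_cutSeq : Monotone cutSeq := fun n m hnm _ hρ =>
  ⟨hρ.1, hρ.2.1.trans_le (by exact_mod_cast hnm),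
    (Nat.one_div_le_one_div hnm).trans_lt hρ.2.2⟩

lemma iUnion_cutSeq : ⋃ n, cutSeq n = Ioi 1 \ {2 / √3} := by
  ext ρ
  simp only [mem_iUnion, Set.mem_sdiff, mem_Ioi, mem_singleton_iff]
  constructor
  · rintro ⟨n, hn⟩
    exact ⟨hn.1, (isCut_cutSeq n).ne hn⟩
  · rintro ⟨h1, h2⟩
    have h3 : 0 < |ρ - 2 / √3| := abs_pos.2 (sub_ne_zero.2 h2)
    obtain ⟨n, hn⟩ := exists_nat_one_div_lt h3
    obtain ⟨m, hm⟩ := exists_nat_gt ρ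
    refine ⟨max n m, h1, hm.trans_le (by exact_mod_cast le_max_right n m), ?_⟩
    exact (Nat.one_div_le_one_div (le_max_left n m)).trans_lt hn

lemma tendsto_setIntegral_cutSeq {f : ℝ → ℂ} (hf : IntegrableOn f (Ioi 1)) :
    Tendsto (fun n => ∫ ρ in cutSeq n, f ρ) atTop (𝓝 (∫ ρ in Ioi 1, f ρ)) := by
  have h0 := tendsto_setIntegral_of_monotone (f := f) (μ := volume)
    (fun n => (isCut_cutSeq n).measurable) monotone_cutSeq
    (by rw [iUnion_cutSeq]; exact hf.mono_set sdiff_subset)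
  have e : ∫ ρ in ⋃ n, cutSeq n, f ρ = ∫ ρ in Ioi 1, f ρ := by
    rw [iUnion_cutSeq]
    exact setIntegral_congr_set (sdiff_null_ae_eq_self (by simp))
  rwa [e] at h0

/-- Continuity from above for the finite measure with this density: what the cuts never reach is the
null set `{2/√3}`. -/
lemma tendsto_tail (hfin : ∫⁻ ρ in Ioi (1 : ℝ), waveEnergy h ρ < ⊤) :
    Tendsto (fun n => ∫⁻ ρ in Ioi 1 \ cutSeq n, waveEnergy h ρ) atTop (𝓝 0) := by
  have hm : ∀ n, MeasurableSet (Ioi (1 : ℝ) \ cutSeq n) := fun n =>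
    measurableSet_Ioi.diff (isCut_cutSeq n).measurable
  have h0 := tendsto_measure_iInter_atTop (μ := volume.withDensity (waveEnergy h))
    (s := fun n => Ioi (1 : ℝ) \ cutSeq n) (fun n => (hm n).nullMeasurableSet)
    (fun n m hnm => sdiff_subset_sdiff_right (monotone_cutSeq hnm))
    ⟨0, by
      rw [withDensity_apply _ (hm 0)]
      exact ((lintegral_mono_set sdiff_subset).trans_lt hfin).ne⟩
  have e : (volume.withDensity (waveEnergy h)) (⋂ n, Ioi (1 : ℝ) \ cutSeq n) = 0 := by
    rw [← sdiff_iUnion, iUnion_cutSeq]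
    refine withDensity_absolutelyContinuous _ _ (measure_mono_null ?_ (measure_singleton (2 / √3)))
    intro ρ hρ
    by_contra hne
    exact hρ.2 ⟨hρ.1, hne⟩
  rw [e] at h0
  refine h0.congr fun n => ?_
  rw [Function.comp_apply, withDensity_apply _ (hm n)]

/-- The waves with truncated frequency ranges converge in `L²((0, 1) × ℝ)`. -/
lemma exists_tendsto_wave (hh : ∀ m, TemperedDistribution.MemSobolev (r m) 2 (h m))
    (hr : ∀ m : Fin 3, -((m : ℕ) : ℝ) / 3 ≤ r m) :
    ∃ u : ℝ × ℝ → ℂ, MemLp u 2 (volume.restrict (Ioo (0 : ℝ) 1 ×ˢ univ)) ∧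
      Tendsto (fun q : ℝ × ℝ => eLpNorm (wave (cutRange q.1 q.2) h - u) 2
        (volume.restrict (Ioo (0 : ℝ) 1 ×ˢ univ))) (atTop ×ˢ 𝓝[>] (0 : ℝ)) (𝓝 0) := by
  set μ : Measure (ℝ × ℝ) := volume.restrict (Ioo (0 : ℝ) 1 ×ˢ univ) with hμ
  obtain ⟨C, hC, hb⟩ := exists_sq_eLpNorm_wave_le
  have hfin := lintegral_waveEnergy_lt_top hh hr
  have root : ∀ {a b : ℝ≥0∞}, a ^ 2 ≤ b → a ≤ b ^ (2 : ℝ)⁻¹ := by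
    intro a b hab
    rw [ENNReal.le_rpow_inv_iff (by norm_num)]
    simpa using hab
  -- The energy outside the `n`-th cut bounds the distance from its wave to that of any larger cut.
  set b : ℕ → ℝ≥0∞ := fun n =>
    (C * ∫⁻ ρ in Ioi 1 \ cutSeq n, waveEnergy h ρ) ^ (2 : ℝ)⁻¹ with hbdef
  have hb0 : Tendsto b atTop (𝓝 0) := by
    have h1 := ENNReal.Tendsto.const_mul (tendsto_tail hfin) (Or.inr hC)
    rw [mul_zero] at h1
    have h2 := (ENNReal.continuous_rpow_const (y := 2⁻¹)).tendsto 0 |>.comp h1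
    rw [ENNReal.zero_rpow_of_pos (by norm_num)] at h2
    exact h2
  have hmem : ∀ {S : Set ℝ}, IsCut S → MemLp (wave S h) 2 μ := by
    intro S hS
    refine ⟨hS.aestronglyMeasurable_wave hh μ, ?_⟩
    have h1 := root (hb h r S hS hh)
    refine h1.trans_lt (ENNReal.rpow_lt_top_of_nonneg (by norm_num) ?_)
    exact (ENNReal.mul_lt_top hC.lt_top ((lintegral_mono_set hS.one_lt).trans_lt hfin)).ne
  have hdiff : ∀ {S : Set ℝ} (n : ℕ), IsCut S → cutSeq n ⊆ S →
      eLpNorm (wave S h - wave (cutSeq n) h) 2 μ ≤ b n := by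
    intro S n hS hn
    have e : wave S h - wave (cutSeq n) h = wave (S \ cutSeq n) h :=
      funext (hS.wave_diff hh (isCut_cutSeq n).measurable hn)
    rw [e]
    have hS' := hS.mono sdiff_subset (hS.measurable.diff (isCut_cutSeq n).measurable)
    refine (root (hb h r _ hS' hh)).trans (ENNReal.rpow_le_rpow ?_ (by norm_num))
    exact mul_le_mul' le_rfl (lintegral_mono_set (sdiff_subset_sdiff_left hS.one_lt))
  set w : ℕ → Lp ℂ 2 μ := fun n => (hmem (isCut_cutSeq n)).toLp (wave (cutSeq n) h) with hw
  have hcau : CauchySeq w := by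
    rw [EMetric.cauchySeq_iff_le_tendsto_0]
    refine ⟨fun n => b n + b n, fun n m N hn hm => ?_, by simpa using hb0.add hb0⟩
    refine (edist_triangle_right (w n) (w m) (w N)).trans (add_le_add ?_ ?_)
    · rw [hw, Lp.edist_toLp_toLp]
      exact hdiff N (isCut_cutSeq n) (monotone_cutSeq hn)
    · rw [hw, Lp.edist_toLp_toLp]
      exact hdiff N (isCut_cutSeq m) (monotone_cutSeq hm)
  obtain ⟨v, hv⟩ := cauchySeq_tendsto_of_complete hcau
  set u : ℝ × ℝ → ℂ := ⇑v with hu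
  have hvm : MemLp u 2 μ := Lp.memLp v
  have hu' : Tendsto (fun n => eLpNorm (wave (cutSeq n) h - u) 2 μ) atTop (𝓝 0) := by
    have h1 := (tendsto_iff_edist_tendsto_0.1 hv)
    refine h1.congr fun n => ?_
    rw [Lp.edist_def]
    refine eLpNorm_congr_ae ?_
    filter_upwards [(hmem (isCut_cutSeq n)).coeFn_toLp] with p hp
    simp only [hw, Pi.sub_apply, hp, hu]
  refine ⟨u, hvm, ?_⟩
  rw [ENNReal.tendsto_nhds_zero]
  intro ε hε
  have hsum : Tendsto (fun n => b n + eLpNorm (wave (cutSeq n) h - u) 2 μ) atTop (𝓝 0) := by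
    simpa using hb0.add hu'
  obtain ⟨n, hn⟩ := ((ENNReal.tendsto_nhds_zero.1 hsum) ε hε).exists
  -- The sequence is cofinal: eventually a truncation contains the `n`-th cut, so the joint limit in
  -- `R` and `ε` follows from the sequence.
  have hev : ∀ᶠ q : ℝ × ℝ in atTop ×ˢ 𝓝[>] (0 : ℝ),
      (n : ℝ) ≤ q.1 ∧ q.2 ∈ Ioc (0 : ℝ) (1 / ((n : ℝ) + 1)) :=
    (eventually_ge_atTop (n : ℝ)).prod_mk (Ioc_mem_nhdsGT Nat.one_div_pos_of_nat)
  filter_upwards [hev] with q hq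
  have hS := isCut_cutRange q.1 hq.2.1
  have hsub : cutSeq n ⊆ cutRange q.1 q.2 := fun ρ hρ =>
    ⟨hρ.1, hρ.2.1.trans_le hq.1, hq.2.2.trans_lt hρ.2.2⟩
  refine le_trans ?_ hn
  have e : wave (cutRange q.1 q.2) h - u =
      (wave (cutRange q.1 q.2) h - wave (cutSeq n) h) + (wave (cutSeq n) h - u) := by abel
  rw [e]
  refine (eLpNorm_add_le ((hmem hS).sub (hmem (isCut_cutSeq n))).1
    ((hmem (isCut_cutSeq n)).sub (hvm)).1 (by norm_num)).trans ?_
  exact add_le_add (hdiff n hS hsub) le_rfl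

end Limit

/-! ### Existence, uniqueness and the representation of the solution -/

lemma adjL_eq_zero {φ : ℝ × ℝ → ℝ} {T' : ℝ} (h : ∀ p : ℝ × ℝ, T' ≤ p.2 → φ p = 0) {p : ℝ × ℝ}
    (hp : T' < p.2) : adjL φ p = 0 := by
  have h1 : (fun r => φ (p.1, r)) =ᶠ[𝓝 p.2] fun _ => 0 :=
    (eventually_ge_nhds hp).mono fun r hr => h (p.1, r) hr
  rw [adjL, dt, h1.deriv_eq, eq_zero_of_forall_ge h 1 p hp.le, eq_zero_of_forall_ge h 3 p hp.le]
  simp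

lemma IsTest.memLp_adjL {φ : ℝ × ℝ → ℝ} (hφ : IsTest φ) (μ : Measure (ℝ × ℝ))
    [IsFiniteMeasureOnCompacts μ] : MemLp (adjL φ) 2 μ :=
  hφ.continuous_adjL.memLp_of_hasCompactSupport hφ.hasCompactSupport_adjL

lemma setIntegral_mul_adjL {φ : ℝ × ℝ → ℝ} {T' : ℝ} (h : ∀ p : ℝ × ℝ, T' ≤ p.2 → φ p = 0)
    (v : ℝ × ℝ → ℝ) {A B : Set ℝ} (hB : MeasurableSet B) (hAB : A ⊆ B)
    (hT : ∀ t ∈ B \ A, T' < t) :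
    ∫ p in Ioo (0 : ℝ) 1 ×ˢ B, v p * adjL φ p = ∫ p in Ioo (0 : ℝ) 1 ×ˢ A, v p * adjL φ p := by
  refine setIntegral_eq_of_subset_of_forall_sdiff_eq_zero (measurableSet_Ioo.prod hB)
    (prod_mono_right hAB) fun p hp => ?_
  rw [adjL_eq_zero h (hT p.2 ⟨hp.1.2, fun hA => hp.2 ⟨hp.1.1, hA⟩⟩), mul_zero]

lemma MemHZero.pair_eq_zero {r : ℝ} {h : 𝓢'(ℝ, ℂ)} (hh : MemHZero r h) {ψ : ℝ → ℝ} {T' : ℝ}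
    (hT' : T' < 0) (h0 : ∀ t, T' ≤ t → ψ t = 0) : pair h (fun t => (ψ t : ℂ)) = 0 := by
  rw [pair]
  -- If `ψ` is not a test function the pairing is zero by default, so no regularity is needed.
  split_ifs with hf
  · refine hh.supported _ ?_
    have hs : tsupport (fun t => (ψ t : ℂ)) ⊆ Iic T' := by
      refine closure_minimal (fun t ht => ?_) isClosed_Iic
      by_contra hlt
      exact ht (by simp [h0 t (not_le.1 hlt).le])
    exact hs.trans (Iic_subset_Iio.2 hT')
  · rfl

/-- Test functions are unrestricted at `t = 0`, so the difference extended by zero to negative times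
is a homogeneous solution on `(-∞, T)`. -/
lemma IsSolution.ae_eq {h : Fin 3 → 𝓢'(ℝ, ℂ)} {v w : ℝ × ℝ → ℝ} (hv : IsSolution h v)
    (hw : IsSolution h w) : ∀ᵐ p ∂(volume.restrict (Ioo (0 : ℝ) 1 ×ˢ Ioi (0 : ℝ))), v p = w p := by
  set s : Set (ℝ × ℝ) := Ioo (0 : ℝ) 1 ×ˢ Ioi (0 : ℝ) with hs
  have hsm : MeasurableSet s := measurableSet_Ioo.prod measurableSet_Ioi
  have hinter : ∀ T : ℝ, (Ioo (0 : ℝ) 1 ×ˢ Iio T) ∩ s = Ioo (0 : ℝ) 1 ×ˢ Ioo (0 : ℝ) T := by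
    intro T
    rw [hs, prod_inter_prod, inter_self, inter_comm, Ioi_inter_Iio]
  have hzero : ∀ T : ℝ, 0 < T → ∀ᵐ p ∂(volume.restrict (Ioo (0 : ℝ) 1 ×ˢ Iio T)),
      s.indicator (fun p => v p - w p) p = 0 := by
    intro T hT
    refine ae_eq_zero_of_homogeneous ?_ fun φ hφ hφT => ?_
    · rw [memLp_indicator_iff_restrict hsm, Measure.restrict_restrict hsm, inter_comm, hinter]
      exact (hv.memLp T hT).sub (hw.memLp T hT)
    · obtain ⟨T', hT', h0⟩ := hφT
      have e : ∀ p, s.indicator (fun p => v p - w p) p * (dt φ p + dx 1 φ p + dx 3 φ p) =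
          s.indicator (fun p => (v p - w p) * adjL φ p) p := fun p => by
        rw [indicator_mul_left]
        rfl
      simp only [e]
      rw [setIntegral_indicator hsm, hinter]
      simp only [sub_mul]
      have hi : ∀ {f : ℝ × ℝ → ℝ}, IsSolution h f → Integrable (fun p => f p * adjL φ p)
          (volume.restrict (Ioo (0 : ℝ) 1 ×ˢ Ioo (0 : ℝ) T)) := fun hf =>
        MemLp.integrable_mul (p := 2) (q := 2) (hf.memLp T hT) (hφ.memLp_adjL _)
      rw [integral_sub (hi hv) (hi hw)]
      have hcut : ∀ f : ℝ × ℝ → ℝ, ∫ p in Ioo (0 : ℝ) 1 ×ˢ Ioo (0 : ℝ) T, f p * adjL φ p =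
          ∫ p in s, f p * adjL φ p := fun f =>
        (setIntegral_mul_adjL h0 f measurableSet_Ioi Ioo_subset_Ioi_self fun t ht => by
          by_contra hlt
          exact ht.2 ⟨ht.1, (not_lt.1 hlt).trans_lt hT'⟩).symm
      rw [hcut, hcut]
      have h1 := hv.identity φ hφ
      have h2 := hw.identity φ hφ
      have h3 : ((∫ p in s, v p * adjL φ p : ℝ) : ℂ) = ((∫ p in s, w p * adjL φ p : ℝ) : ℂ) := by
        simp only [adjL]
        linear_combination h1 - h2
      rw [Complex.ofReal_inj.1 h3, sub_self]
  have hun : s = ⋃ n : ℕ, Ioo (0 : ℝ) 1 ×ˢ Ioo (0 : ℝ) ((n : ℝ) + 1) := by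
    rw [hs, ← prod_iUnion]
    congr 1
    ext t
    simp only [mem_Ioi, mem_iUnion, mem_Ioo, exists_and_left]
    exact ⟨fun ht => ⟨ht, (exists_nat_gt t).imp fun n hn => by linarith⟩, fun ht => ht.1⟩
  rw [hun, ae_restrict_iUnion_iff]
  intro n
  have h1 := hzero (n + 1) (by positivity)
  have hss : Ioo (0 : ℝ) 1 ×ˢ Ioo (0 : ℝ) ((n : ℝ) + 1) ⊆ Ioo (0 : ℝ) 1 ×ˢ Iio ((n : ℝ) + 1) :=
    prod_mono_right Ioo_subset_Iio_self
  have h2 := ae_restrict_of_ae_restrict_of_subset hss h1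
  filter_upwards [h2, ae_restrict_mem (measurableSet_Ioo.prod measurableSet_Ioo)] with p hp hpm
  rw [indicator_of_mem (show p ∈ s from ⟨hpm.1, hpm.2.1⟩)] at hp
  exact sub_eq_zero.1 hp

section Existence

variable {h : Fin 3 → 𝓢'(ℝ, ℂ)} {r : Fin 3 → ℝ} {u : ℝ × ℝ → ℂ}

lemma tendsto_cutSeq_index :
    Tendsto (fun n : ℕ => ((n : ℝ), 1 / ((n : ℝ) + 1))) atTop (atTop ×ˢ 𝓝[>] (0 : ℝ)) := by
  refine tendsto_natCast_atTop_atTop.prodMk (tendsto_nhdsWithin_iff.2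
    ⟨tendsto_one_div_add_atTop_nhds_zero_nat, Eventually.of_forall fun n => ?_⟩)
  exact mem_Ioi.2 (Nat.one_div_pos_of_nat (α := ℝ))

lemma tendsto_wave_cutSeq
    (hu : Tendsto (fun q : ℝ × ℝ => eLpNorm (wave (cutRange q.1 q.2) h - u) 2
        (volume.restrict (Ioo (0 : ℝ) 1 ×ˢ univ))) (atTop ×ˢ 𝓝[>] (0 : ℝ)) (𝓝 0)) :
    Tendsto (fun n => eLpNorm (wave (cutSeq n) h - u) 2
        (volume.restrict (Ioo (0 : ℝ) 1 ×ˢ univ))) atTop (𝓝 0) := by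
  have h1 := hu.comp tendsto_cutSeq_index
  simp only [Function.comp_def] at h1
  exact h1

/-- For a test function both sides converge: the waves in `L²` against a compactly supported
function, the data pairings because the full frequency integrals converge absolutely. No initial
time appears yet. -/
lemma integral_limit_mul_adjL (hh : ∀ m, MemHZero (r m) (h m))
    (hum : MemLp u 2 (volume.restrict (Ioo (0 : ℝ) 1 ×ˢ univ)))
    (hu : Tendsto (fun n => eLpNorm (wave (cutSeq n) h - u) 2
        (volume.restrict (Ioo (0 : ℝ) 1 ×ˢ univ))) atTop (𝓝 0))
    {φ : ℝ × ℝ → ℝ} (hφ : IsTest φ) :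
    ((∫ p in Ioo (0 : ℝ) 1 ×ˢ univ, 2 * (u p).re * adjL φ p : ℝ) : ℂ)
      + pair (h 0) (fun t => (dx 2 φ (0, t) : ℂ)) + pair (h 1) (fun t => (dx 1 φ (1, t) : ℂ))
      - pair (h 2) (fun t => (φ (1, t) : ℂ)) = 0 := by
  set μ : Measure (ℝ × ℝ) := volume.restrict (Ioo (0 : ℝ) 1 ×ˢ univ) with hμ
  have hL : MemLp (fun p => (adjL φ p : ℂ)) 2 μ := (hφ.memLp_adjL μ).ofReal
  have hwm : ∀ n, AEStronglyMeasurable (wave (cutSeq n) h) μ := fun n =>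
    (isCut_cutSeq n).aestronglyMeasurable_wave (fun m => (hh m).sobolev) μ
  have huL : Integrable (fun p => u p * (adjL φ p : ℂ)) μ :=
    MemLp.integrable_mul (p := 2) (q := 2) hum hL
  have hlim : Tendsto (fun n => ∫ p, wave (cutSeq n) h p * (adjL φ p : ℂ) ∂μ) atTop
      (𝓝 (∫ p, u p * (adjL φ p : ℂ) ∂μ)) := by
    refine tendsto_integral_of_L1' _ huL.1 ?_ ?_
    · filter_upwards [(ENNReal.tendsto_nhds_zero.1 hu) 1 one_pos] with n hn
      have h1 : MemLp (wave (cutSeq n) h - u) 2 μ :=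
        ⟨(hwm n).sub hum.1, hn.trans_lt ENNReal.one_lt_top⟩
      have h2 : MemLp (wave (cutSeq n) h) 2 μ := by simpa using h1.add hum
      exact MemLp.integrable_mul (p := 2) (q := 2) h2 hL
    · have hb : ∀ n, eLpNorm ((fun p => wave (cutSeq n) h p * (adjL φ p : ℂ)) -
          fun p => u p * (adjL φ p : ℂ)) 1 μ ≤
          eLpNorm (wave (cutSeq n) h - u) 2 μ * eLpNorm (fun p => (adjL φ p : ℂ)) 2 μ := by
        intro n
        have e : ((fun p => wave (cutSeq n) h p * (adjL φ p : ℂ)) -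
            fun p => u p * (adjL φ p : ℂ)) =
            (wave (cutSeq n) h - u) • fun p => (adjL φ p : ℂ) := by
          ext p
          simp [sub_mul]
        rw [e]
        exact eLpNorm_smul_le_mul_eLpNorm hL.1 ((hwm n).sub hum.1)
      have h0 := ENNReal.Tendsto.mul_const (b := eLpNorm (fun p => (adjL φ p : ℂ)) 2 μ) hu
        (Or.inr hL.2.ne)
      rw [zero_mul] at h0
      exact tendsto_of_tendsto_of_tendsto_of_le_of_le tendsto_const_nhds h0
        (fun _ => zero_le) hb
  have hdata : ∀ (m : Fin 3) {ψ : ℝ → ℝ}, ContDiff ℝ ∞ ψ → HasCompactSupport ψ →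
      Tendsto (fun n => dataPairing (cutSeq n) (h m) ψ) atTop (𝓝 (dataPairing (Ioi 1) (h m) ψ)) :=
    fun m ψ hψ hψc =>
      (tendsto_setIntegral_cutSeq (integrableOn_data_oscTest (hh m) hψ hψc)).const_mul _
  have c0 := contDiff_slice (contDiff_dx hφ.smooth 2) 0
  have c1 := contDiff_slice (contDiff_dx hφ.smooth 1) 1
  have c2 := contDiff_slice hφ.smooth 1
  have k0 := hasCompactSupport_slice (hasCompactSupport_dx hφ.smooth hφ.compact 2) 0
  have k1 := hasCompactSupport_slice (hasCompactSupport_dx hφ.smooth hφ.compact 1) 1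
  have k2 := hasCompactSupport_slice hφ.compact 1
  have hlim' := ((hdata 0 c0 k0).neg.sub (hdata 1 c1 k1)).add (hdata 2 c2 k2)
  have hval := tendsto_nhds_unique hlim (hlim'.congr fun n =>
    ((isCut_cutSeq n).integral_superposition_mul_adjL hh hφ).symm)
  have hre : ∫ p, 2 * (u p).re * adjL φ p ∂μ = 2 * (∫ p, u p * (adjL φ p : ℂ) ∂μ).re := by
    have h1 := integral_re huL
    simp only [RCLike.re_to_complex, Complex.re_mul_ofReal] at h1
    rw [← h1, ← integral_const_mul]
    simp only [mul_assoc]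
  have p0 := (hh 0).pair_eq c0 k0
  have p1 := (hh 1).pair_eq c1 k1
  have p2 := (hh 2).pair_eq c2 k2
  rw [← dataPairing] at p0 p1 p2
  rw [hre, hval, p0, p1, p2, Complex.add_re, Complex.sub_re, Complex.neg_re]
  push_cast
  ring

/-- The identity over all times becomes the one over `t > 0` once the limit is known to vanish in
the past. -/
lemma isSolution_limit (hh : ∀ m, MemHZero (r m) (h m))
    (hum : MemLp u 2 (volume.restrict (Ioo (0 : ℝ) 1 ×ˢ univ)))
    (hu : Tendsto (fun n => eLpNorm (wave (cutSeq n) h - u) 2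
        (volume.restrict (Ioo (0 : ℝ) 1 ×ˢ univ))) atTop (𝓝 0)) :
    IsSolution h fun p => 2 * (u p).re := by
  set v : ℝ × ℝ → ℝ := fun p => 2 * (u p).re with hv
  have hvm : MemLp v 2 (volume.restrict (Ioo (0 : ℝ) 1 ×ˢ univ)) := hum.re.const_mul 2
  have hsub : ∀ A : Set ℝ, volume.restrict (Ioo (0 : ℝ) 1 ×ˢ A) ≤
      volume.restrict (Ioo (0 : ℝ) 1 ×ˢ (univ : Set ℝ)) := fun A =>
    Measure.restrict_mono (prod_mono_right (subset_univ A)) le_rfl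
  -- Data supported in `[0, ∞)` do not act on test functions that vanish from some negative time on,
  -- so uniqueness with `T = 0` applies.
  have hpast : ∀ᵐ p ∂(volume.restrict (Ioo (0 : ℝ) 1 ×ˢ Iio (0 : ℝ))), v p = 0 := by
    refine ae_eq_zero_of_homogeneous (hvm.mono_measure (hsub _)) fun φ hφ hφT => ?_
    obtain ⟨T', hT', h0⟩ := hφT
    have h1 := integral_limit_mul_adjL hh hum hu hφ
    rw [(hh 0).pair_eq_zero hT' fun t ht => eq_zero_of_forall_ge h0 2 (0, t) ht,
      (hh 1).pair_eq_zero hT' fun t ht => eq_zero_of_forall_ge h0 1 (1, t) ht,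
      (hh 2).pair_eq_zero hT' fun t ht => h0 (1, t) ht, add_zero, add_zero, sub_zero,
      Complex.ofReal_eq_zero] at h1
    refine Eq.trans ?_ h1
    exact (setIntegral_mul_adjL h0 v MeasurableSet.univ (subset_univ _) fun t ht =>
      hT'.trans_le (not_lt.1 ht.2)).symm
  refine ⟨fun T _ => hvm.mono_measure (hsub _), fun φ hφ => ?_⟩
  rw [← integral_limit_mul_adjL hh hum hu hφ]
  congr 4
  have hi : IntegrableOn (fun p => v p * adjL φ p) (Ioo (0 : ℝ) 1 ×ˢ univ) :=
    MemLp.integrable_mul (p := 2) (q := 2) hvm (hφ.memLp_adjL _)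
  have e1 : Ioo (0 : ℝ) 1 ×ˢ (univ : Set ℝ) =
      Ioo (0 : ℝ) 1 ×ˢ Iio (0 : ℝ) ∪ Ioo (0 : ℝ) 1 ×ˢ Ici (0 : ℝ) := by
    rw [← prod_union, Iio_union_Ici]
  have e2 : Ioo (0 : ℝ) 1 ×ˢ Ioi (0 : ℝ) =ᵐ[volume] Ioo (0 : ℝ) 1 ×ˢ Ici (0 : ℝ) :=
    Measure.set_prod_ae_eq (Filter.EventuallyEq.refl _ _) Ioi_ae_eq_Ici
  have e3 : ∫ p in Ioo (0 : ℝ) 1 ×ˢ Iio (0 : ℝ), v p * adjL φ p = 0 := by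
    refine integral_eq_zero_of_ae ?_
    filter_upwards [hpast] with p hp
    simp [hp]
  change ∫ p in Ioo (0 : ℝ) 1 ×ˢ Ioi (0 : ℝ), v p * adjL φ p =
    ∫ p in Ioo (0 : ℝ) 1 ×ˢ univ, v p * adjL φ p
  rw [e1, setIntegral_union, e3, zero_add, setIntegral_congr_set e2]
  · exact Set.disjoint_prod.2 (Or.inr (Set.disjoint_left.2 fun t h1 h2 =>
      absurd (mem_Iio.1 h1) (not_lt.2 (mem_Ici.1 h2))))
  · exact measurableSet_Ioo.prod measurableSet_Ici
  · exact hi.mono_set (prod_mono_right (subset_univ _))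
  · exact hi.mono_set (prod_mono_right (subset_univ _))

lemma tendsto_eLpNorm_Wbdr_sub (hh : ∀ m, MemHZero (r m) (h m))
    (hu : Tendsto (fun q : ℝ × ℝ => eLpNorm (wave (cutRange q.1 q.2) h - u) 2
        (volume.restrict (Ioo (0 : ℝ) 1 ×ˢ univ))) (atTop ×ˢ 𝓝[>] (0 : ℝ)) (𝓝 0))
    {v : ℝ × ℝ → ℝ} {A : Set ℝ}
    (hv : ∀ᵐ p ∂(volume.restrict (Ioo (0 : ℝ) 1 ×ˢ A)), v p = 2 * (u p).re) :
    Tendsto (fun q : ℝ × ℝ => eLpNorm (fun p => Wbdr (cutRange q.1 q.2) h p - (v p : ℂ)) 2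
      (volume.restrict (Ioo (0 : ℝ) 1 ×ˢ A))) (atTop ×ˢ 𝓝[>] (0 : ℝ)) (𝓝 0) := by
  have h0 := ENNReal.Tendsto.const_mul (a := ENNReal.ofReal 2) hu (Or.inr ENNReal.ofReal_ne_top)
  rw [mul_zero] at h0
  have hpos : ∀ᶠ q : ℝ × ℝ in atTop ×ˢ 𝓝[>] (0 : ℝ), 0 < q.2 :=
    tendsto_snd.eventually self_mem_nhdsWithin
  refine tendsto_of_tendsto_of_tendsto_of_le_of_le' tendsto_const_nhds h0
    (Eventually.of_forall fun _ => zero_le) ?_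
  filter_upwards [hpos] with q hq
  have hS := isCut_cutRange q.1 hq
  refine le_trans ?_ (mul_le_mul' le_rfl (eLpNorm_mono_measure _
    (Measure.restrict_mono (prod_mono_right (subset_univ A)) le_rfl)))
  refine eLpNorm_le_mul_eLpNorm_of_ae_le_mul ?_ 2
  filter_upwards [hv] with p hp
  rw [Wbdr_eq p fun j m => hS.integrableOn_integrand (fun m => (hh m).sobolev) j m p, hp,
    ← Complex.ofReal_sub, Complex.norm_real, ← mul_sub, norm_mul, Real.norm_ofNat]
  exact mul_le_mul_of_nonneg_left (Complex.abs_re_le_norm (wave (cutRange q.1 q.2) h p - u p))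
    (by norm_num)

/-- A subsequence of the waves converges to `u` almost everywhere. Where the integrals converge
absolutely, the same subsequence converges to the full integral. -/
lemma ae_eq_Wbdr (hh : ∀ m, MemHZero (r m) (h m))
    (hum : MemLp u 2 (volume.restrict (Ioo (0 : ℝ) 1 ×ˢ univ)))
    (hu : Tendsto (fun n => eLpNorm (wave (cutSeq n) h - u) 2
        (volume.restrict (Ioo (0 : ℝ) 1 ×ˢ univ))) atTop (𝓝 0)) :
    ∀ᵐ p ∂(volume.restrict (Ioo (0 : ℝ) 1 ×ˢ univ)),
      (∀ j m : Fin 3, IntegrableOn (integrand j m (h m) p) (Ioi 1)) →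
        ((2 * (u p).re : ℝ) : ℂ) = Wbdr (Ioi 1) h p := by
  have hm := tendstoInMeasure_of_tendsto_eLpNorm two_ne_zero (fun n =>
    (isCut_cutSeq n).aestronglyMeasurable_wave (fun m => (hh m).sobolev) _) hum.1 hu
  obtain ⟨ns, hns, hae⟩ := hm.exists_seq_tendsto_ae
  filter_upwards [hae] with p hp hint
  have hi : IntegrableOn (waveDensity h p) (Ioi 1) := by
    have e : waveDensity h p = fun ρ => ∑ m, ∑ j, integrand j m (h m) p ρ :=
      funext (waveDensity_eq_sum_integrand h p)
    rw [e]
    exact integrable_finsetSum _ fun m _ => integrable_finsetSum _ fun j _ => hint j m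
  have h1 : Tendsto (fun n => wave (cutSeq n) h p) atTop (𝓝 (wave (Ioi 1) h p)) :=
    (tendsto_setIntegral_cutSeq hi).const_mul _
  rw [Wbdr_eq p hint, tendsto_nhds_unique hp (h1.comp hns.tendsto_atTop)]

end Existence

end KdVBdr

end

theorem lemma2p1 (s : ℝ) (hs : -1 ≤ s) (h : Fin 3 → 𝓢'(ℝ, ℂ))
    (h1 : KdVBdr.MemHZero ((s + 1) / 3) (h 0))
    (h2 : KdVBdr.MemHZero (s / 3) (h 1))
    (h3 : KdVBdr.MemHZero ((s - 1) / 3) (h 2)) :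
    (∃ v : ℝ × ℝ → ℝ, KdVBdr.IsSolution h v) ∧
    ∀ v : ℝ × ℝ → ℝ, KdVBdr.IsSolution h v →
      (∀ T : ℝ, 0 < T →
        Tendsto
          (fun q : ℝ × ℝ =>
            eLpNorm (fun p => KdVBdr.Wbdr (KdVBdr.cutRange q.1 q.2) h p - (v p : ℂ)) 2
              (volume.restrict (Ioo (0 : ℝ) 1 ×ˢ Ioo (0 : ℝ) T)))
          (atTop ×ˢ 𝓝[>] (0 : ℝ)) (𝓝 0)) ∧
      (∀ᵐ p ∂(volume.restrict (Ioo (0 : ℝ) 1 ×ˢ Ioi (0 : ℝ))),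
        (∀ j m : Fin 3, IntegrableOn (KdVBdr.integrand j m (h m) p) (Ioi 1)) →
          (v p : ℂ) = KdVBdr.Wbdr (Ioi 1) h p) := by
  have hh : ∀ m, KdVBdr.MemHZero (![(s + 1) / 3, s / 3, (s - 1) / 3] m) (h m) := by
    intro m
    fin_cases m
    exacts [h1, h2, h3]
  -- The condition `s ≥ -1` says exactly that the orders are at least `0`, `-1/3`, `-2/3`.
  have hr : ∀ m : Fin 3, -((m : ℕ) : ℝ) / 3 ≤ ![(s + 1) / 3, s / 3, (s - 1) / 3] m := by
    intro m
    fin_cases m <;> simp <;> linarith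
  obtain ⟨u, hum, hu⟩ := KdVBdr.exists_tendsto_wave (fun m => (hh m).sobolev) hr
  have hseq := KdVBdr.tendsto_wave_cutSeq hu
  have hsol := KdVBdr.isSolution_limit hh hum hseq
  refine ⟨⟨_, hsol⟩, fun v hv => ?_⟩
  have hae := hv.ae_eq hsol
  refine ⟨fun T _ => KdVBdr.tendsto_eLpNorm_Wbdr_sub hh hu
    (ae_restrict_of_ae_restrict_of_subset (prod_mono_right Ioo_subset_Ioi_self) hae), ?_⟩
  have hW := ae_restrict_of_ae_restrict_of_subset
    (prod_mono_right (subset_univ (Ioi (0 : ℝ)))) (KdVBdr.ae_eq_Wbdr hh hum hseq)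
  filter_upwards [hae, hW] with p hp hpW hint
  rw [hp]
  exact hpW hint
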